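/- Let $\mathcal C,\mathcal D$ be multifusion categories over $\mathbb C$ (finite semisimple $\mathbb C$-linear rigid monoidal categories; in particular, unitary multifusion categories) and let $\mathcal M={}_{\mathcal C}\mathcal M_{\mathcal D}$ be a finite semisimple $\mathbb C$-linear $\mathcal C|\mathcal D$-bimodule category with bilinear actions. Write $\operatorname{Irr}$ for (representatives of) the isomorphism classes of simple objects, and let $\operatorname{Irr}_0\subseteq\operatorname{Irr}$ be the simple direct summands $\mathbf 1_i$ of the tensor unit. *The tube algebra.* $\mathbf{Tube}({}_{\mathcal C}\mathcal M_{\mathcal D})$ is the direct sum, over $a\in\operatorname{Irr}(\mathcal C)$, $b\in\operatorname{Irr}(\mathcal D)$, $c,d,e,f,g,h\in\operatorname{Irr}(\mathcal M)$, of $$\operatorname{Hom}(c,d\otimes b)\otimes\operatorname{Hom}(d,a\otimes e)\otimes\operatorname{Hom}(g\otimes b,h)\otimes\operatorname{Hom}(a\otimes f,g).$$ The pure tensor $[a;b]^{f,g,h;\zeta,\gamma}_{c,d,e;\mu,\nu}$ of $\mu:c\to d\otimes b$, $\nu:d\to a\otimes e$, $\gamma:g\otimes b\to h$, $\zeta:a\otimes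 f\to g$ is drawn as a diagram with a left arc $a$ and, around it, a right arc $b$, outer edges $c$ (below) and $h$ (above), and inner edges $e$, $f$. Diagrams with arbitrary objects on the arcs, and arbitrary morphisms $c\to(X\otimes e)\otimes Y$, $(X\otimes f)\otimes Y\to h$, are evaluated in this space by inserting $\sum_\alpha p_\alpha\,\iota_\alpha$-resolutions of the identities of $X$, $Y$, and then of $a\otimes e$, $a\otimes f$, into simple objects (dual bases on the lower and the upper strand). The product draws the first diagram around the second (associators of the actions rebracket the arcs into $a\otimes a'$ and $b'\otimes b$), and vanishes unless the inner edges of the first are the outer edges of the second. The unit is the sum over $c,h$ of the pairs of strands $c$, $h$ with both arcs labelled by the tensor units. The coproduct is $$\Delta\,[a;b]^{f,g,h;\zeta,\gamma}_{c,d,e;\mu,\nu}=\sum_{i,j,k,\rho,\sigma}[a;b]^{f,g,h;\zeta,\gamma}_{k,j,i;\rho,\sigma}\otimes[a;b]^{i,j,k;\sigma^*,\rho^*}_{c,d,e;\mu,\nu},$$ with $\rho,\rho^*$ and $\sigma,\sigma^*$ running over dual bases of $\operatorname{Hom}(k,j\otimes b)$, $\operatorname{Hom}(j\otimes b,k)$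 and of $\operatorname{Hom}(j,a\otimes i)$, $\operatorname{Hom}(a\otimes i,j)$; the counit is $\delta_{c,h}\delta_{d,g}\delta_{e,f}$ times the product of the scalars $\gamma\circ\mu\in\operatorname{End}(c)$ and $\zeta\circ\nu\in\operatorname{End}(d)$. *The boundary subalgebras.* $\mathbf R(\mathcal M_{\mathcal D})$ and $\mathbf L({}_{\mathcal C}\mathcal M)$ are the spans of the diagrams with $a\in\operatorname{Irr}_0(\mathcal C)$ (dotted left arc), respectively $b\in\operatorname{Irr}_0(\mathcal D)$ (dotted right arc), with the same operations. *The crossed product.* $\mathbf R(\mathcal M_{\mathcal D})\Join\mathbf L({}_{\mathcal C}\mathcal M)$ is spanned by the elements $r\Join l$, for diagrams $r\in\mathbf R(\mathcal M_{\mathcal D})$ and $l\in\mathbf L({}_{\mathcal C}\mathcal M)$ such that the inner edges $(d,g)$ of $r$ are the outer edges of $l$; that is, it is the direct sum over all edge labels of the tensor products of the corresponding summands of $\mathbf R$ and $\mathbf L$, and $r\Join l:=0$ for diagrams whose edges do not match. Its product is $(r\Join l)(r'\Join l')=\sum(r\,r'')\Join(l''\,l')$, where $\sum r''\Join l''$ arises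 from the diagram in which $l$ is drawn around $r'$, by removing the dotted arcs, moving the left arc inside the right arc with the associator $a\otimes(m\otimes b)\cong(a\otimes m)\otimes b$ of $\mathcal M$, and decomposing $a\otimes m$ on each strand into simple objects. Its unit is $1\Join1$, its coproduct is $\Delta(r\Join l)=\Delta(r)\Join\Delta(l)$ and its counit is $\varepsilon(r\Join l)=\varepsilon(r)\varepsilon(l)$ for diagrams with matching edges. **Proposition.** $\mathbf R(\mathcal M_{\mathcal D})$ and $\mathbf L({}_{\mathcal C}\mathcal M)$ are unital subalgebras of $\mathbf{Tube}({}_{\mathcal C}\mathcal M_{\mathcal D})$ to which the coproduct and the counit restrict; the crossed product is an associative unital algebra; and the gluing map $$\Phi:\mathbf R(\mathcal M_{\mathcal D})\Join\mathbf L({}_{\mathcal C}\mathcal M)\to\mathbf{Tube}({}_{\mathcal C}\mathcal M_{\mathcal D}),\qquad[\mathbf 1;b]^{g,g,h;\gamma}_{c,d,d;\mu}\Join[a;\mathbf 1]^{f,g',g';\zeta}_{d',d',e;\nu}\mapsto\delta_{d,d'}\delta_{g,g'}\,[a;b]^{f,g,h;\zeta,\gamma}_{c,d,e;\mu,\nu},$$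 is a linear bijection that preserves product, unit, coproduct and counit. Moreover $\Phi(r\Join l)=r\cdot l$, the product in $\mathbf{Tube}({}_{\mathcal C}\mathcal M_{\mathcal D})$, for all $r\in\mathbf R(\mathcal M_{\mathcal D})$, $l\in\mathbf L({}_{\mathcal C}\mathcal M)$. -/

import Mathlib

open CategoryTheory MonoidalCategory TensorProduct
open scoped MonoidalLeftAction MonoidalRightAction

namespace DomainWall

noncomputable section

/-! ### Finite semisimple categories, multifusion categories, bimodule categories -/

section Semisimple

variable (C : Type*) [Category* C] [Preadditive C]

/-- Isomorphism of simple objects. -/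
instance simpleSetoid : Setoid {X : C // Simple X} where
  r X Y := Nonempty (X.1 ≅ Y.1)
  iseqv :=
    { refl := fun X => ⟨Iso.refl X.1⟩
      symm := fun ⟨i⟩ => ⟨i.symm⟩
      trans := fun ⟨i⟩ ⟨j⟩ => ⟨i ≪≫ j⟩ }

/-- `Irr C`: the set of isomorphism classes of simple objects of `C`. -/
def Irr : Type _ := Quotient (simpleSetoid C)

instance : DecidableEq (Irr C) := Classical.decEq _

variable {C}

/-- A chosen simple object in the isomorphism class `a`. -/
def Irr.rep (a : Irr C) : C := (Quotient.out a).1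

/-- A decomposition of `X` as a finite direct sum of the chosen simple objects. The families
`incl` and `proj` restrict, for every simple object, to dual bases of the morphism spaces
from and to that simple object. -/
structure SimpleDecomp (X : C) where
  n : ℕ
  s : Fin n → Irr C
  incl : ∀ k, (s k).rep ⟶ X
  proj : ∀ k, X ⟶ (s k).rep
  incl_proj_self : ∀ k, incl k ≫ proj k = 𝟙 (s k).rep
  incl_proj_ne : ∀ k l, k ≠ l → incl k ≫ proj l = 0
  sum_proj_incl : ∑ k, proj k ≫ incl k = 𝟙 X

variable (C) in
/-- Finite semisimple `ℂ`-linear categories: finite-dimensional morphism spaces, finitely many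
simple objects up to isomorphism, and every object is a finite direct sum of simple objects. -/
class IsFiniteSemisimple [Linear ℂ C] : Prop where
  finiteDimensional_hom : ∀ X Y : C, FiniteDimensional ℂ (X ⟶ Y)
  finite_irr : Finite (Irr C)
  exists_decomp : ∀ X : C, Nonempty (SimpleDecomp X)

variable [Linear ℂ C] [IsFiniteSemisimple C]

instance : Fintype (Irr C) :=
  haveI := IsFiniteSemisimple.finite_irr (C := C)
  Fintype.ofFinite _

/-- A chosen decomposition into simple objects. -/
def dec (X : C) : SimpleDecomp X := (IsFiniteSemisimple.exists_decomp X).some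

/-- The scalar of an endomorphism of a simple object `X`: as `End X` is one-dimensional, `f` is
the multiple of the identity by the trace of `g ↦ f ≫ g`. -/
def endScalar (X : C) : (X ⟶ X) →ₗ[ℂ] ℂ where
  toFun f := LinearMap.trace ℂ (X ⟶ X) (Linear.leftComp ℂ X f)
  map_add' f g := by
    rw [← map_add]; congr 1; ext x; simp
  map_smul' r f := by
    rw [RingHom.id_apply, ← map_smul]; congr 1; ext x; simp

variable (C) in
/-- All labels. -/
abbrev allLabels : Finset (Irr C) := Finset.univ

variable (C) in
/-- The simple direct summands `𝟙ᵢ` of the tensor unit; these label the dotted arcs. -/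
def unitLabels [MonoidalCategory C] : Finset (Irr C) :=
  open scoped Classical in
  Finset.univ.filter fun i =>
    ∃ (x : i.rep ⟶ 𝟙_ C) (y : 𝟙_ C ⟶ i.rep), x ≫ y = 𝟙 i.rep

section
variable [MonoidalCategory C]

lemma unitLabels_spec (i : unitLabels C) :
    ∃ (x : i.1.rep ⟶ 𝟙_ C) (y : 𝟙_ C ⟶ i.1.rep), x ≫ y = 𝟙 i.1.rep := by
  classical
  have h := i.2
  simp only [unitLabels, Finset.mem_filter] at h
  exact h.2

/-- The inclusion `𝟙ᵢ ⟶ 𝟙` of a simple summand of the tensor unit. -/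
def unitIncl (i : unitLabels C) : i.1.rep ⟶ 𝟙_ C := (unitLabels_spec i).choose

/-- The projection `𝟙 ⟶ 𝟙ᵢ` onto a simple summand of the tensor unit, split by `unitIncl`. -/
def unitProj (i : unitLabels C) : 𝟙_ C ⟶ i.1.rep := (unitLabels_spec i).choose_spec.choose

end

end Semisimple

/-- A left action on a `ℂ`-linear category that is `ℂ`-bilinear on morphisms. -/
class LinearLeftAction (C M : Type*) [Category* C] [Category* M] [Preadditive C] [Linear ℂ C]
    [Preadditive M] [Linear ℂ M] [MonoidalCategory C] [MonoidalLeftAction C M] : Prop where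
  add_actionHomLeft : ∀ {c c' : C} (f g : c ⟶ c') (m : M), (f + g) ⊵ₗ m = f ⊵ₗ m + g ⊵ₗ m
  smul_actionHomLeft : ∀ {c c' : C} (r : ℂ) (f : c ⟶ c') (m : M), (r • f) ⊵ₗ m = r • f ⊵ₗ m
  actionHomRight_add : ∀ (c : C) {m m' : M} (f g : m ⟶ m'), c ⊴ₗ (f + g) = c ⊴ₗ f + c ⊴ₗ g
  actionHomRight_smul : ∀ (c : C) {m m' : M} (r : ℂ) (f : m ⟶ m'), c ⊴ₗ (r • f) = r • c ⊴ₗ f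

/-- A right action on a `ℂ`-linear category that is `ℂ`-bilinear on morphisms. -/
class LinearRightAction (D M : Type*) [Category* D] [Category* M] [Preadditive D] [Linear ℂ D]
    [Preadditive M] [Linear ℂ M] [MonoidalCategory D] [MonoidalRightAction D M] : Prop where
  add_actionHomLeft : ∀ {m m' : M} (f g : m ⟶ m') (d : D), (f + g) ⊵ᵣ d = f ⊵ᵣ d + g ⊵ᵣ d
  smul_actionHomLeft : ∀ {m m' : M} (r : ℂ) (f : m ⟶ m') (d : D), (r • f) ⊵ᵣ d = r • f ⊵ᵣ d
  actionHomRight_add : ∀ (m : M) {d d' : D} (f g : d ⟶ d'), m ⊴ᵣ (f + g) = m ⊴ᵣ f + m ⊴ᵣ g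
  actionHomRight_smul : ∀ (m : M) {d d' : D} (r : ℂ) (f : d ⟶ d'), m ⊴ᵣ (r • f) = r • m ⊴ᵣ f

/-- A `C|D`-bimodule category: commuting left and right actions, with the middle associator
`(c ⊙ m) ⊙ d ≅ c ⊙ (m ⊙ d)`, its naturality, the two mixed pentagons and the two triangles. -/
class BimoduleCategory (C D M : Type*) [Category* C] [Category* D] [Category* M]
    [MonoidalCategory C] [MonoidalCategory D]
    [MonoidalLeftAction C M] [MonoidalRightAction D M] where
  midAssoc : ∀ (c : C) (m : M) (d : D), (c ⊙ₗ m) ⊙ᵣ d ≅ c ⊙ₗ (m ⊙ᵣ d)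
  midAssoc_naturality : ∀ {c c' : C} {m m' : M} {d d' : D}
    (f : c ⟶ c') (g : m ⟶ m') (h : d ⟶ d'),
    ((f ⊙ₗₘ g) ⊙ᵣₘ h) ≫ (midAssoc c' m' d').hom = (midAssoc c m d).hom ≫ (f ⊙ₗₘ (g ⊙ᵣₘ h))
  pentagon_left : ∀ (c c' : C) (m : M) (d : D),
    (αₗ c c' m).hom ⊵ᵣ d ≫ (midAssoc c (c' ⊙ₗ m) d).hom ≫ c ⊴ₗ (midAssoc c' m d).hom =
      (midAssoc (c ⊗ c') m d).hom ≫ (αₗ c c' (m ⊙ᵣ d)).hom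
  pentagon_right : ∀ (c : C) (m : M) (d d' : D),
    (midAssoc c m (d ⊗ d')).hom ≫ c ⊴ₗ (αᵣ m d d').hom =
      (αᵣ (c ⊙ₗ m) d d').hom ≫ (midAssoc c m d).hom ⊵ᵣ d' ≫ (midAssoc c (m ⊙ᵣ d) d').hom
  triangle_left : ∀ (m : M) (d : D),
    (midAssoc (𝟙_ C) m d).hom ≫ (λₗ[C] (m ⊙ᵣ d)).hom = (λₗ[C] m).hom ⊵ᵣ d
  triangle_right : ∀ (c : C) (m : M),
    (midAssoc c m (𝟙_ D)).hom ≫ c ⊴ₗ (ρᵣ[D] m).hom = (ρᵣ[D] (c ⊙ₗ m)).hom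

/-! ### Algebra-coalgebra data -/

/-- The structure maps of a (weak) bialgebra: product, unit, coproduct and counit. -/
structure BialgData (V : Type*) [AddCommGroup V] [Module ℂ V] where
  mul : V →ₗ[ℂ] V →ₗ[ℂ] V
  one : V
  comul : V →ₗ[ℂ] V ⊗[ℂ] V
  counit : V →ₗ[ℂ] ℂ

/-- The product is associative and unital. -/
structure BialgData.IsAlgebra {V : Type*} [AddCommGroup V] [Module ℂ V]
    (S : BialgData V) : Prop where
  assoc : ∀ x y z, S.mul (S.mul x y) z = S.mul x (S.mul y z)
  one_mul : ∀ x, S.mul S.one x = x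
  mul_one : ∀ x, S.mul x S.one = x

/-- `F` preserves product, unit, coproduct and counit. -/
structure BialgData.IsHom {V W : Type*} [AddCommGroup V] [Module ℂ V] [AddCommGroup W]
    [Module ℂ W] (S : BialgData V) (T : BialgData W) (F : V →ₗ[ℂ] W) : Prop where
  map_mul : ∀ x y, F (S.mul x y) = T.mul (F x) (F y)
  map_one : F S.one = T.one
  map_comul : ∀ x, TensorProduct.map F F (S.comul x) = T.comul (F x)
  map_counit : ∀ x, T.counit (F x) = S.counit x

/-- `F` is injective and preserves product, unit, coproduct and counit: it identifies its source
with a unital subalgebra of its target that is closed under the coproduct. -/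
structure BialgData.IsSub {V W : Type*} [AddCommGroup V] [Module ℂ V] [AddCommGroup W]
    [Module ℂ W] (S : BialgData V) (T : BialgData W) (F : V →ₗ[ℂ] W) : Prop
    extends BialgData.IsHom S T F where
  injective : Function.Injective F

/-! ### Tube diagrams -/

section Diagrams

variable {C D M : Type*} [Category* C] [Category* D] [Category* M]
  [Preadditive C] [Linear ℂ C] [Preadditive D] [Linear ℂ D] [Preadditive M] [Linear ℂ M]
  [MonoidalCategory C] [MonoidalCategory D] [MonoidalLeftAction C M] [MonoidalRightAction D M]

/-- The vertex spaces of a basic tube diagram with left arc `a`, right arc `b`: on the lower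
strand (read upwards) `μ : c ⟶ d ⊙ b`, then `ν : d ⟶ a ⊙ e`; on the upper strand
`ζ : a ⊙ f ⟶ g`, then `γ : g ⊙ b ⟶ h`. An element is a combination of
`(μ ⊗ ν) ⊗ (γ ⊗ ζ)`. -/
abbrev Cell (a : C) (b : D) (c d e f g h : M) : Type _ :=
  ((c ⟶ d ⊙ᵣ b) ⊗[ℂ] (d ⟶ a ⊙ₗ e)) ⊗[ℂ] ((g ⊙ᵣ b ⟶ h) ⊗[ℂ] (a ⊙ₗ f ⟶ g))

/-- Tube diagrams with arbitrary objects `X`, `Y` on the arcs and arbitrary morphisms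
`c ⟶ (X ⊙ e) ⊙ Y` and `(X ⊙ f) ⊙ Y ⟶ h` on the two strands. -/
abbrev Diag (X : C) (Y : D) (c e f h : M) : Type _ :=
  (c ⟶ (X ⊙ₗ e) ⊙ᵣ Y) ⊗[ℂ] ((X ⊙ₗ f) ⊙ᵣ Y ⟶ h)

/-- Diagrams with a right arc only. -/
abbrev HalfR (b : D) (c d g h : M) : Type _ := (c ⟶ d ⊙ᵣ b) ⊗[ℂ] (g ⊙ᵣ b ⟶ h)

/-- Diagrams with a left arc only. -/
abbrev HalfL (a : C) (d e f g : M) : Type _ := (d ⟶ a ⊙ₗ e) ⊗[ℂ] (a ⊙ₗ f ⟶ g)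

variable [LinearLeftAction C M] [LinearRightAction D M]

/-- Compose the vertices on each strand: `(μ ⊗ ν) ⊗ (γ ⊗ ζ) ↦ (μ ≫ ν ⊵ b) ⊗ (ζ ⊵ b ≫ γ)`. -/
def assemble (a : C) (b : D) (c d e f g h : M) :
    Cell a b c d e f g h →ₗ[ℂ] Diag a b c e f h :=
  TensorProduct.map
    (TensorProduct.lift (LinearMap.mk₂ ℂ (fun μ ν => μ ≫ ν ⊵ᵣ b)
      (by intros; simp) (by intros; simp)
      (by intros; simp [LinearRightAction.add_actionHomLeft])
      (by intros; simp [LinearRightAction.smul_actionHomLeft])))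
    (TensorProduct.lift (LinearMap.mk₂ ℂ (fun γ ζ => ζ ⊵ᵣ b ≫ γ)
      (by intros; simp) (by intros; simp)
      (by intros; simp [LinearRightAction.add_actionHomLeft])
      (by intros; simp [LinearRightAction.smul_actionHomLeft])))

variable [BimoduleCategory C D M]

/-- The rebracketing `(X ⊙ ((X' ⊙ m) ⊙ Y')) ⊙ Y ≅ ((X ⊗ X') ⊙ m) ⊙ (Y' ⊗ Y)`. -/
def stackIso (X X' : C) (Y Y' : D) (m : M) :
    (X ⊙ₗ ((X' ⊙ₗ m) ⊙ᵣ Y')) ⊙ᵣ Y ≅ ((X ⊗ X') ⊙ₗ m) ⊙ᵣ (Y' ⊗ Y) where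
  hom := (BimoduleCategory.midAssoc X (X' ⊙ₗ m) Y').inv ⊵ᵣ Y ≫
    (αᵣ (X ⊙ₗ (X' ⊙ₗ m)) Y' Y).inv ≫ (αₗ X X' m).inv ⊵ᵣ (Y' ⊗ Y)
  inv := (αₗ X X' m).hom ⊵ᵣ (Y' ⊗ Y) ≫ (αᵣ (X ⊙ₗ (X' ⊙ₗ m)) Y' Y).hom ≫
    (BimoduleCategory.midAssoc X (X' ⊙ₗ m) Y').hom ⊵ᵣ Y
  hom_inv_id := by
    simp [← MonoidalRightAction.comp_actionHomLeft]
  inv_hom_id := by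
    simp [← MonoidalRightAction.comp_actionHomLeft,
      ← MonoidalRightAction.comp_actionHomLeft_assoc]

/-- The first diagram is drawn around the second one; the arcs become `X ⊗ X'` and `Y' ⊗ Y`. -/
def stack (X X' : C) (Y Y' : D) (c m n h e f : M) :
    Diag X Y c m n h →ₗ[ℂ] Diag X' Y' m e f n →ₗ[ℂ] Diag (X ⊗ X') (Y' ⊗ Y) c e f h :=
  TensorProduct.map₂
    (LinearMap.mk₂ ℂ (fun u u' => u ≫ (X ⊴ₗ u') ⊵ᵣ Y ≫ (stackIso X X' Y Y' e).hom)
      (by intros; simp) (by intros; simp)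
      (by intros; simp [LinearRightAction.add_actionHomLeft, LinearLeftAction.actionHomRight_add])
      (by intros; simp [LinearRightAction.smul_actionHomLeft,
            LinearLeftAction.actionHomRight_smul]))
    (LinearMap.mk₂ ℂ (fun v v' => (stackIso X X' Y Y' f).inv ≫ (X ⊴ₗ v') ⊵ᵣ Y ≫ v)
      (by intros; simp) (by intros; simp)
      (by intros; simp [LinearRightAction.add_actionHomLeft, LinearLeftAction.actionHomRight_add])
      (by intros; simp [LinearRightAction.smul_actionHomLeft,
            LinearLeftAction.actionHomRight_smul]))

/-- A left arc drawn around a right arc, with the middle associator moving the left arc inside: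
for `ν : d ⟶ a ⊙ m`, `μ : m ⟶ e ⊙ b` the lower strand is `d ⟶ a ⊙ (e ⊙ b) ≅ (a ⊙ e) ⊙ b`,
and similarly on the upper strand. -/
def slide (a : C) (b : D) (d g m n e f : M) :
    HalfL a d m n g →ₗ[ℂ] HalfR b m e f n →ₗ[ℂ] Diag a b d e f g :=
  TensorProduct.map₂
    (LinearMap.mk₂ ℂ (fun ν μ => ν ≫ (a ⊴ₗ μ) ≫ (BimoduleCategory.midAssoc a e b).inv)
      (by intros; simp) (by intros; simp)
      (by intros; simp [LinearLeftAction.actionHomRight_add])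
      (by intros; simp [LinearLeftAction.actionHomRight_smul]))
    (LinearMap.mk₂ ℂ (fun ζ γ => (BimoduleCategory.midAssoc a f b).hom ≫ (a ⊴ₗ γ) ≫ ζ)
      (by intros; simp) (by intros; simp)
      (by intros; simp [LinearLeftAction.actionHomRight_add])
      (by intros; simp [LinearLeftAction.actionHomRight_smul]))

end Diagrams

/-! ### The tube algebra and its subalgebras of diagrams with restricted arc labels -/

section Tube

variable {C D : Type*} (M : Type*) [Category* C] [Category* D] [Category* M]
  [Preadditive C] [Linear ℂ C] [Preadditive D] [Linear ℂ D] [Preadditive M] [Linear ℂ M]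
  [MonoidalCategory C] [MonoidalCategory D] [MonoidalLeftAction C M] [MonoidalRightAction D M]

/-- Tube diagrams with outer edges `c` (below), `h` (above), inner edges `e`, `f`, left arc in
`A`, right arc in `B`; the index `(a, b, d, g)` lists the remaining labels. -/
def TubeComp (A : Finset (Irr C)) (B : Finset (Irr D)) (c h e f : Irr M) : Type _ :=
  (t : A × B × Irr M × Irr M) → Cell t.1.1.rep t.2.1.1.rep c.rep t.2.2.1.rep e.rep
    f.rep t.2.2.2.rep h.rep

instance (A : Finset (Irr C)) (B : Finset (Irr D)) (c h e f : Irr M) :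
    AddCommGroup (TubeComp M A B c h e f) :=
  inferInstanceAs (AddCommGroup ((t : A × B × Irr M × Irr M) → Cell _ _ _ _ _ _ _ _))

instance (A : Finset (Irr C)) (B : Finset (Irr D)) (c h e f : Irr M) :
    Module ℂ (TubeComp M A B c h e f) :=
  inferInstanceAs (Module ℂ ((t : A × B × Irr M × Irr M) → Cell _ _ _ _ _ _ _ _))

/-- The span of the tube diagrams whose left arc is in `A` and whose right arc is in `B`: the
direct sum over all edge labels of the tensor products of vertex spaces. -/
def TubeOn (A : Finset (Irr C)) (B : Finset (Irr D)) : Type _ :=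
  (q : Irr M × Irr M × Irr M × Irr M) → TubeComp M A B q.1 q.2.1 q.2.2.1 q.2.2.2

instance (A : Finset (Irr C)) (B : Finset (Irr D)) : AddCommGroup (TubeOn M A B) :=
  inferInstanceAs (AddCommGroup ((q : Irr M × Irr M × Irr M × Irr M) → TubeComp M A B _ _ _ _))

instance (A : Finset (Irr C)) (B : Finset (Irr D)) : Module ℂ (TubeOn M A B) :=
  inferInstanceAs (Module ℂ ((q : Irr M × Irr M × Irr M × Irr M) → TubeComp M A B _ _ _ _))

variable {M}

section
variable (A : Finset (Irr C)) (B : Finset (Irr D))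

/-- The inclusion of the summand with outer edges `c`, `h` and inner edges `e`, `f`. -/
def emb (c h e f : Irr M) : TubeComp M A B c h e f →ₗ[ℂ] TubeOn M A B :=
  LinearMap.single ℂ (fun q : Irr M × Irr M × Irr M × Irr M =>
    TubeComp M A B q.1 q.2.1 q.2.2.1 q.2.2.2) (c, h, e, f)

/-- The projection to the summand with outer edges `c`, `h` and inner edges `e`, `f`. -/
def comp (c h e f : Irr M) : TubeOn M A B →ₗ[ℂ] TubeComp M A B c h e f :=
  LinearMap.proj (R := ℂ) (φ := fun q : Irr M × Irr M × Irr M × Irr M =>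
    TubeComp M A B q.1 q.2.1 q.2.2.1 q.2.2.2) (c, h, e, f)

/-- The coefficient of the labels `(a, b, d, g)`. -/
def coeff (c h e f : Irr M) (t : A × B × Irr M × Irr M) :
    TubeComp M A B c h e f →ₗ[ℂ] Cell t.1.1.rep t.2.1.1.rep c.rep t.2.2.1.rep e.rep
      f.rep t.2.2.2.rep h.rep :=
  LinearMap.proj (R := ℂ) (φ := fun t : A × B × Irr M × Irr M =>
    Cell t.1.1.rep t.2.1.1.rep c.rep t.2.2.1.rep e.rep f.rep t.2.2.2.rep h.rep) t

/-- The inclusion of the vertex space with labels `(a, b, d, g)`. -/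
def cellEmb (c h e f : Irr M) (t : A × B × Irr M × Irr M) :
    Cell t.1.1.rep t.2.1.1.rep c.rep t.2.2.1.rep e.rep f.rep t.2.2.2.rep h.rep →ₗ[ℂ]
      TubeComp M A B c h e f :=
  LinearMap.single ℂ (fun t : A × B × Irr M × Irr M =>
    Cell t.1.1.rep t.2.1.1.rep c.rep t.2.2.1.rep e.rep f.rep t.2.2.2.rep h.rep) t

end

variable [IsFiniteSemisimple C] [IsFiniteSemisimple D] [IsFiniteSemisimple M]
variable (A : Finset (Irr C)) (B : Finset (Irr D))

/-- Rewrite a diagram with arbitrary `X`, `Y` on the arcs as a combination of basic tube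
diagrams: insert resolutions of the identity of `X` and of `Y` into simple objects (parallel
moves), then of `a ⊙ e` and of `a ⊙ f`. Terms with arc labels outside `A`, `B` are dropped; none
occur when `A`, `B` are closed under the fusions considered, as for all labels or unit labels. -/
def expand (X : C) (Y : D) (c h e f : Irr M) :
    Diag X Y c.rep e.rep f.rep h.rep →ₗ[ℂ] TubeComp M A B c h e f :=
  ∑ k : Fin (dec X).n, ∑ l : Fin (dec Y).n,
    if hkl : (dec X).s k ∈ A ∧ (dec Y).s l ∈ B then
      ∑ p : Fin (dec (((dec X).s k).rep ⊙ₗ e.rep)).n,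
      ∑ q : Fin (dec (((dec X).s k).rep ⊙ₗ f.rep)).n,
        cellEmb A B c h e f
          (⟨(dec X).s k, hkl.1⟩, ⟨(dec Y).s l, hkl.2⟩, (dec (((dec X).s k).rep ⊙ₗ e.rep)).s p,
            (dec (((dec X).s k).rep ⊙ₗ f.rep)).s q) ∘ₗ
        TensorProduct.map
          ((TensorProduct.mk ℂ _ _).flip ((dec (((dec X).s k).rep ⊙ₗ e.rep)).incl p) ∘ₗ
            Linear.rightComp ℂ c.rep
              (((dec X).proj k ⊵ₗ e.rep) ⊵ᵣ Y ≫
                (((dec X).s k).rep ⊙ₗ e.rep) ⊴ᵣ (dec Y).proj l ≫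
                (dec (((dec X).s k).rep ⊙ₗ e.rep)).proj p ⊵ᵣ ((dec Y).s l).rep))
          ((TensorProduct.mk ℂ _ _).flip ((dec (((dec X).s k).rep ⊙ₗ f.rep)).proj q) ∘ₗ
            Linear.leftComp ℂ h.rep
              ((dec (((dec X).s k).rep ⊙ₗ f.rep)).incl q ⊵ᵣ ((dec Y).s l).rep ≫
                (((dec X).s k).rep ⊙ₗ f.rep) ⊴ᵣ (dec Y).incl l ≫
                ((dec X).incl k ⊵ₗ f.rep) ⊵ᵣ Y))
    else 0

variable [LinearLeftAction C M] [LinearRightAction D M]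

/-- A tube diagram as a diagram with composed vertices. -/
def toDiag (c h e f : Irr M) (t : A × B × Irr M × Irr M) :
    TubeComp M A B c h e f →ₗ[ℂ] Diag t.1.1.rep t.2.1.1.rep c.rep e.rep f.rep h.rep :=
  assemble _ _ _ _ _ _ _ _ ∘ₗ coeff A B c h e f t

/-- The counit: zero unless `c = h`, `e = f`, `d = g`; then
`(μ ⊗ ν) ⊗ (γ ⊗ ζ)` goes to the product of the scalars of `μ ≫ γ` and `ν ≫ ζ`. -/
def tubeCounit : TubeOn M A B →ₗ[ℂ] ℂ :=
  ∑ c : Irr M, ∑ e : Irr M, ∑ a : A, ∑ b : B, ∑ d : Irr M,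
    LinearMap.mul' ℂ ℂ ∘ₗ
    TensorProduct.map
      (TensorProduct.lift (LinearMap.mk₂ ℂ
        (fun (μ : c.rep ⟶ d.rep ⊙ᵣ b.1.rep) (γ : d.rep ⊙ᵣ b.1.rep ⟶ c.rep) =>
          endScalar c.rep (μ ≫ γ))
        (by intros; simp) (by intros; simp) (by intros; simp) (by intros; simp)))
      (TensorProduct.lift (LinearMap.mk₂ ℂ
        (fun (ν : d.rep ⟶ a.1.rep ⊙ₗ e.rep) (ζ : a.1.rep ⊙ₗ e.rep ⟶ d.rep) =>
          endScalar d.rep (ν ≫ ζ))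
        (by intros; simp) (by intros; simp) (by intros; simp) (by intros; simp))) ∘ₗ
    (TensorProduct.tensorTensorTensorComm ℂ _ _ _ _).toLinearMap ∘ₗ
    coeff A B c c e e (a, b, d, d) ∘ₗ comp A B c c e e

/-- The coproduct of a tube diagram with labels `a, …, h` and vertices `μ, ν, γ, ζ`: the sum over
`i`, `j`, `k` and over dual bases `σ`, `σ'` of `j ⟶ a ⊙ i`, `a ⊙ i ⟶ j` and `ρ`, `ρ'` of
`k ⟶ j ⊙ b`, `j ⊙ b ⟶ k` of the diagram with edges `f, g, h; k, j, i` and vertices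
`ρ, σ; γ, ζ` tensor the diagram with edges `i, j, k; c, d, e` and vertices `μ, ν; ρ', σ'`. -/
def tubeComul : TubeOn M A B →ₗ[ℂ] TubeOn M A B ⊗[ℂ] TubeOn M A B :=
  ∑ c : Irr M, ∑ h : Irr M, ∑ e : Irr M, ∑ f : Irr M, ∑ t : A × B × Irr M × Irr M,
  ∑ i : Irr M,
  ∑ p : Fin (dec (t.1.1.rep ⊙ₗ i.rep)).n,
  ∑ q : Fin (dec (((dec (t.1.1.rep ⊙ₗ i.rep)).s p).rep ⊙ᵣ t.2.1.1.rep)).n,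
    TensorProduct.map
      (emb A B ((dec (((dec (t.1.1.rep ⊙ₗ i.rep)).s p).rep ⊙ᵣ t.2.1.1.rep)).s q) h i f ∘ₗ
        cellEmb A B ((dec (((dec (t.1.1.rep ⊙ₗ i.rep)).s p).rep ⊙ᵣ t.2.1.1.rep)).s q) h i f
          (t.1, t.2.1, (dec (t.1.1.rep ⊙ₗ i.rep)).s p, t.2.2.2) ∘ₗ
        TensorProduct.mk ℂ _ _
          ((dec (((dec (t.1.1.rep ⊙ₗ i.rep)).s p).rep ⊙ᵣ t.2.1.1.rep)).incl q ⊗ₜ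
            (dec (t.1.1.rep ⊙ₗ i.rep)).incl p))
      (emb A B c ((dec (((dec (t.1.1.rep ⊙ₗ i.rep)).s p).rep ⊙ᵣ t.2.1.1.rep)).s q) e i ∘ₗ
        cellEmb A B c ((dec (((dec (t.1.1.rep ⊙ₗ i.rep)).s p).rep ⊙ᵣ t.2.1.1.rep)).s q) e i
          (t.1, t.2.1, t.2.2.1, (dec (t.1.1.rep ⊙ₗ i.rep)).s p) ∘ₗ
        (TensorProduct.mk ℂ _ _).flip
          ((dec (((dec (t.1.1.rep ⊙ₗ i.rep)).s p).rep ⊙ᵣ t.2.1.1.rep)).proj q ⊗ₜ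
            (dec (t.1.1.rep ⊙ₗ i.rep)).proj p)) ∘ₗ
    (TensorProduct.comm ℂ _ _).toLinearMap ∘ₗ
    coeff A B c h e f t ∘ₗ comp A B c h e f

variable [BimoduleCategory C D M]

/-- The product of tube diagrams with matching edges `m`, `n`. -/
def mulComp (c h m n e f : Irr M) :
    TubeComp M A B c h m n →ₗ[ℂ] TubeComp M A B m n e f →ₗ[ℂ] TubeComp M A B c h e f :=
  ∑ t : A × B × Irr M × Irr M, ∑ t' : A × B × Irr M × Irr M,
    ((stack t.1.1.rep t'.1.1.rep t.2.1.1.rep t'.2.1.1.rep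
        c.rep m.rep n.rep h.rep e.rep f.rep).compl₁₂
      (toDiag A B c h m n t) (toDiag A B m n e f t')).compr₂
    (expand A B (t.1.1.rep ⊗ t'.1.1.rep) (t'.2.1.1.rep ⊗ t.2.1.1.rep) c h e f)

/-- The product: the first diagram is drawn around the second one when the inner edges of the
first are the outer edges of the second; otherwise it is zero. -/
def tubeMul : TubeOn M A B →ₗ[ℂ] TubeOn M A B →ₗ[ℂ] TubeOn M A B :=
  ∑ c : Irr M, ∑ h : Irr M, ∑ m : Irr M, ∑ n : Irr M, ∑ e : Irr M, ∑ f : Irr M,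
    ((mulComp A B c h m n e f).compl₁₂ (comp A B c h m n) (comp A B m n e f)).compr₂
      (emb A B c h e f)

/-- The unit: the sum over `c`, `h` of the pairs of strands `c`, `h` with dotted arcs. -/
def tubeOne : TubeOn M A B :=
  ∑ c : Irr M, ∑ h : Irr M, emb A B c h c h
    (expand A B (𝟙_ C) (𝟙_ D) c h c h
      (((λₗ[C] c.rep).inv ≫ (ρᵣ[D] (𝟙_ C ⊙ₗ c.rep)).inv) ⊗ₜ
        ((ρᵣ[D] (𝟙_ C ⊙ₗ h.rep)).hom ≫ (λₗ[C] h.rep).hom)))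

/-- The algebra and coalgebra structure on the span of tube diagrams with arcs in `A`, `B`. -/
def tubeData : BialgData (TubeOn M A B) where
  mul := tubeMul A B
  one := tubeOne A B
  comul := tubeComul A B
  counit := tubeCounit A B

end Tube

section Main

variable (C D M : Type*) [Category* C] [Category* D] [Category* M]
  [Preadditive C] [Linear ℂ C] [Preadditive D] [Linear ℂ D] [Preadditive M] [Linear ℂ M]
  [MonoidalCategory C] [MonoidalCategory D] [MonoidalLeftAction C M] [MonoidalRightAction D M]
  [IsFiniteSemisimple C] [IsFiniteSemisimple D] [IsFiniteSemisimple M]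

/-- The domain wall tube algebra `Tube(_C M_D)`: all labels. -/
abbrev Tube : Type _ := TubeOn M (allLabels C) (allLabels D)

/-- `R(M_D)`: tube diagrams with dotted left arc. -/
abbrev RTube : Type _ := TubeOn M (unitLabels C) (allLabels D)

/-- `L(_C M)`: tube diagrams with dotted right arc. -/
abbrev LTube : Type _ := TubeOn M (allLabels C) (unitLabels D)

/-- The summand of `R(M_D)` with outer edges `c`, `h` and inner edges `d`, `g`. -/
abbrev RComp (c h d g : Irr M) : Type _ :=
  TubeComp M (unitLabels C) (allLabels D) c h d g

/-- The summand of `L(_C M)` with outer edges `d`, `g` and inner edges `e`, `f`. -/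
abbrev LComp (d g e f : Irr M) : Type _ :=
  TubeComp M (allLabels C) (unitLabels D) d g e f

variable {C D M} in
/-- Extension by zero, from diagrams with arcs in `A`, `B` to all tube diagrams. -/
def inclTube (A : Finset (Irr C)) (B : Finset (Irr D)) : TubeOn M A B →ₗ[ℂ] Tube C D M :=
  ∑ c : Irr M, ∑ h : Irr M, ∑ e : Irr M, ∑ f : Irr M, ∑ t : A × B × Irr M × Irr M,
    emb (allLabels C) (allLabels D) c h e f ∘ₗ
    cellEmb (allLabels C) (allLabels D) c h e f
      (⟨t.1.1, Finset.mem_univ _⟩, ⟨t.2.1.1, Finset.mem_univ _⟩, t.2.2.1, t.2.2.2) ∘ₗ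
    coeff A B c h e f t ∘ₗ comp A B c h e f

/-- The underlying space of the crossed product `R(M_D) ⋈ L(_C M)`: it is spanned by the pairs
of a diagram in `R(M_D)` and a diagram in `L(_C M)` whose intermediate edges `d`, `g` match, i.e.
it is the tensor product of `R(M_D)` and `L(_C M)` over the algebra spanned by the pairs of
strands `d`, `g` with both arcs dotted. -/
def Crossed : Type _ :=
  (q : Irr M × Irr M × Irr M × Irr M × Irr M × Irr M) →
    RComp C D M q.1 q.2.1 q.2.2.1 q.2.2.2.1 ⊗[ℂ]
      LComp C D M q.2.2.1 q.2.2.2.1 q.2.2.2.2.1 q.2.2.2.2.2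

instance : AddCommGroup (Crossed C D M) :=
  inferInstanceAs (AddCommGroup ((q : Irr M × Irr M × Irr M × Irr M × Irr M × Irr M) →
    RComp C D M _ _ _ _ ⊗[ℂ] LComp C D M _ _ _ _))

instance : Module ℂ (Crossed C D M) :=
  inferInstanceAs (Module ℂ ((q : Irr M × Irr M × Irr M × Irr M × Irr M × Irr M) →
    RComp C D M _ _ _ _ ⊗[ℂ] LComp C D M _ _ _ _))

variable {M}

/-- The inclusion of the summand of the crossed product with edges `c, h; d, g; e, f`. -/
def crossedEmb (c h d g e f : Irr M) :
    RComp C D M c h d g ⊗[ℂ] LComp C D M d g e f →ₗ[ℂ] Crossed C D M :=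
  LinearMap.single ℂ (fun q : Irr M × Irr M × Irr M × Irr M × Irr M × Irr M =>
    RComp C D M q.1 q.2.1 q.2.2.1 q.2.2.2.1 ⊗[ℂ]
      LComp C D M q.2.2.1 q.2.2.2.1 q.2.2.2.2.1 q.2.2.2.2.2) (c, h, d, g, e, f)

/-- The projection to the summand of the crossed product with edges `c, h; d, g; e, f`. -/
def crossedComp (c h d g e f : Irr M) :
    Crossed C D M →ₗ[ℂ] RComp C D M c h d g ⊗[ℂ] LComp C D M d g e f :=
  LinearMap.proj (R := ℂ) (φ := fun q : Irr M × Irr M × Irr M × Irr M × Irr M × Irr M =>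
    RComp C D M q.1 q.2.1 q.2.2.1 q.2.2.2.1 ⊗[ℂ]
      LComp C D M q.2.2.1 q.2.2.2.1 q.2.2.2.2.1 q.2.2.2.2.2) (c, h, d, g, e, f)

/-- `(r, l) ↦ r ⋈ l`; on diagrams it vanishes unless the inner edges of `r` are the outer edges
of `l`. -/
def cross : RTube C D M →ₗ[ℂ] LTube C D M →ₗ[ℂ] Crossed C D M :=
  ∑ c : Irr M, ∑ h : Irr M, ∑ d : Irr M, ∑ g : Irr M, ∑ e : Irr M, ∑ f : Irr M,
    ((TensorProduct.mk ℂ (RComp C D M c h d g) (LComp C D M d g e f)).compl₁₂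
      (comp _ _ c h d g) (comp _ _ d g e f)).compr₂ (crossedEmb C D c h d g e f)

variable [LinearLeftAction C M] [LinearRightAction D M]

variable {C D}

/-- Remove the dotted left arc of a diagram in `R(M_D)`. -/
def stripR (c h d g : Irr M) (t : unitLabels C × (allLabels D) × Irr M × Irr M) :
    RComp C D M c h d g →ₗ[ℂ] HalfR t.2.1.1.rep c.rep d.rep g.rep h.rep :=
  TensorProduct.map
    (Linear.rightComp ℂ c.rep ((unitIncl t.1 ⊵ₗ d.rep ≫ (λₗ[C] d.rep).hom) ⊵ᵣ t.2.1.1.rep))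
    (Linear.leftComp ℂ h.rep (((λₗ[C] g.rep).inv ≫ unitProj t.1 ⊵ₗ g.rep) ⊵ᵣ t.2.1.1.rep)) ∘ₗ
  toDiag _ _ c h d g t

/-- Remove the dotted right arc of a diagram in `L(_C M)`. -/
def stripL (d g e f : Irr M) (t : (allLabels C) × unitLabels D × Irr M × Irr M) :
    LComp C D M d g e f →ₗ[ℂ] HalfL t.1.1.rep d.rep e.rep f.rep g.rep :=
  TensorProduct.map
    (Linear.rightComp ℂ d.rep
      ((t.1.1.rep ⊙ₗ e.rep) ⊴ᵣ unitIncl t.2.1 ≫ (ρᵣ[D] (t.1.1.rep ⊙ₗ e.rep)).hom))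
    (Linear.leftComp ℂ g.rep
      ((ρᵣ[D] (t.1.1.rep ⊙ₗ f.rep)).inv ≫ (t.1.1.rep ⊙ₗ f.rep) ⊴ᵣ unitProj t.2.1)) ∘ₗ
  toDiag _ _ d g e f t

variable (C D) in
/-- The gluing map `Φ : R(M_D) ⋈ L(_C M) ⟶ Tube(_C M_D)`: it sends
`[dotted; b] with c, d; g, h; μ, γ` crossed with `[a; dotted] with d, e; f, g; ν, ζ` to the basic
tube diagram with arcs `a`, `b`, edges `c, d, e; f, g, h` and vertices `μ, ν; γ, ζ`. -/
def gluing : Crossed C D M →ₗ[ℂ] Tube C D M :=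
  ∑ c : Irr M, ∑ h : Irr M, ∑ d : Irr M, ∑ g : Irr M, ∑ e : Irr M, ∑ f : Irr M,
  ∑ t : unitLabels C × (allLabels D) × Irr M × Irr M,
  ∑ t' : (allLabels C) × unitLabels D × Irr M × Irr M,
    emb (allLabels C) (allLabels D) c h e f ∘ₗ
    cellEmb (allLabels C) (allLabels D) c h e f
      (t'.1, t.2.1, d, g) ∘ₗ
    (TensorProduct.tensorTensorTensorComm ℂ _ _ _ _).toLinearMap ∘ₗ
    TensorProduct.map (stripR c h d g t) (stripL d g e f t') ∘ₗ
    crossedComp C D c h d g e f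

/-- Rewrite a diagram with arcs `a`, `b` as a combination of pairs of a diagram with right arc
`b` (outside) and a diagram with left arc `a` (inside), by decomposing `a ⊙ e` and `a ⊙ f`. -/
def split (a : C) (b : D) (c h e f : Irr M) :
    Diag a b c.rep e.rep f.rep h.rep →ₗ[ℂ]
      ((p : Irr M × Irr M) → RComp C D M c h p.1 p.2 ⊗[ℂ] LComp C D M p.1 p.2 e f) :=
  ∑ x : Fin (dec (a ⊙ₗ e.rep)).n, ∑ y : Fin (dec (a ⊙ₗ f.rep)).n,
    LinearMap.single ℂ
      (fun p : Irr M × Irr M => RComp C D M c h p.1 p.2 ⊗[ℂ] LComp C D M p.1 p.2 e f)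
      ((dec (a ⊙ₗ e.rep)).s x, (dec (a ⊙ₗ f.rep)).s y) ∘ₗ
    (TensorProduct.mk ℂ _ _).flip
      (expand (allLabels C) (unitLabels D) a (𝟙_ D)
        ((dec (a ⊙ₗ e.rep)).s x) ((dec (a ⊙ₗ f.rep)).s y) e f
        (((dec (a ⊙ₗ e.rep)).incl x ≫ (ρᵣ[D] (a ⊙ₗ e.rep)).inv) ⊗ₜ
          ((ρᵣ[D] (a ⊙ₗ f.rep)).hom ≫ (dec (a ⊙ₗ f.rep)).proj y))) ∘ₗ
    expand (unitLabels C) (allLabels D) (𝟙_ C) b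
        c h ((dec (a ⊙ₗ e.rep)).s x) ((dec (a ⊙ₗ f.rep)).s y) ∘ₗ
    TensorProduct.map
      (Linear.rightComp ℂ c.rep
        (((dec (a ⊙ₗ e.rep)).proj x ≫ (λₗ[C] ((dec (a ⊙ₗ e.rep)).s x).rep).inv) ⊵ᵣ b))
      (Linear.leftComp ℂ h.rep
        (((λₗ[C] ((dec (a ⊙ₗ f.rep)).s y).rep).hom ≫ (dec (a ⊙ₗ f.rep)).incl y) ⊵ᵣ b))

variable [BimoduleCategory C D M]

/-- The exchange rule of the crossed product: a left arc drawn around a right arc is moved inside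
with the associator of the bimodule category, and the result is written as a combination of
pairs with the right arc outside and the left arc inside. -/
def exchange (d g m n d' g' : Irr M) :
    LComp C D M d g m n →ₗ[ℂ] RComp C D M m n d' g' →ₗ[ℂ]
      ((p : Irr M × Irr M) → RComp C D M d g p.1 p.2 ⊗[ℂ] LComp C D M p.1 p.2 d' g') :=
  ∑ t : (allLabels C) × unitLabels D × Irr M × Irr M,
  ∑ t' : unitLabels C × (allLabels D) × Irr M × Irr M,
    ((slide t.1.1.rep t'.2.1.1.rep d.rep g.rep m.rep n.rep d'.rep g'.rep).compl₁₂
      (stripL d g m n t) (stripR m n d' g' t')).compr₂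
    (split t.1.1.rep t'.2.1.1.rep d g d' g')

/-- The product in the crossed product on summands with matching edges:
`(r ⋈ l)(r' ⋈ l') = ∑ (r r'') ⋈ (l'' l')` where `∑ r'' ⋈ l''` is the exchange of `l` and `r'`. -/
def crossedMulComp (c h d g m n d' g' e f : Irr M) :
    (RComp C D M c h d g ⊗[ℂ] LComp C D M d g m n) ⊗[ℂ]
      (RComp C D M m n d' g' ⊗[ℂ] LComp C D M d' g' e f) →ₗ[ℂ] Crossed C D M :=
  ∑ x : Irr M, ∑ y : Irr M,
    crossedEmb C D c h x y e f ∘ₗ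
    TensorProduct.map
      (TensorProduct.lift (mulComp (unitLabels C) (allLabels D) c h d g x y))
      (TensorProduct.lift (mulComp (allLabels C) (unitLabels D) x y d' g' e f)) ∘ₗ
    (TensorProduct.assoc ℂ (RComp C D M c h d g) (RComp C D M d g x y)
      (LComp C D M x y d' g' ⊗[ℂ] LComp C D M d' g' e f)).symm.toLinearMap ∘ₗ
    LinearMap.lTensor (RComp C D M c h d g)
      ((TensorProduct.assoc ℂ (RComp C D M d g x y) (LComp C D M x y d' g')
          (LComp C D M d' g' e f)).toLinearMap ∘ₗ
        LinearMap.rTensor (LComp C D M d' g' e f)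
          (LinearMap.proj (R := ℂ) (φ := fun p : Irr M × Irr M =>
              RComp C D M d g p.1 p.2 ⊗[ℂ] LComp C D M p.1 p.2 d' g') (x, y) ∘ₗ
            TensorProduct.lift (exchange d g m n d' g')) ∘ₗ
        (TensorProduct.assoc ℂ (LComp C D M d g m n) (RComp C D M m n d' g')
          (LComp C D M d' g' e f)).symm.toLinearMap) ∘ₗ
    (TensorProduct.assoc ℂ (RComp C D M c h d g) (LComp C D M d g m n)
      (RComp C D M m n d' g' ⊗[ℂ] LComp C D M d' g' e f)).toLinearMap

/-- The product of the crossed product. -/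
def crossedMul : Crossed C D M →ₗ[ℂ] Crossed C D M →ₗ[ℂ] Crossed C D M :=
  ∑ c : Irr M, ∑ h : Irr M, ∑ d : Irr M, ∑ g : Irr M, ∑ m : Irr M, ∑ n : Irr M,
  ∑ d' : Irr M, ∑ g' : Irr M, ∑ e : Irr M, ∑ f : Irr M,
    ((TensorProduct.mk ℂ _ _).compl₁₂ (crossedComp C D c h d g m n)
      (crossedComp C D m n d' g' e f)).compr₂ (crossedMulComp c h d g m n d' g' e f)

/-- The coproduct of the crossed product: `Δ(r ⋈ l) = Δ(r) ⋈ Δ(l)`. -/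
def crossedComul : Crossed C D M →ₗ[ℂ] Crossed C D M ⊗[ℂ] Crossed C D M :=
  ∑ c : Irr M, ∑ h : Irr M, ∑ d : Irr M, ∑ g : Irr M, ∑ e : Irr M, ∑ f : Irr M,
    TensorProduct.map (TensorProduct.lift (cross C D)) (TensorProduct.lift (cross C D)) ∘ₗ
    (TensorProduct.tensorTensorTensorComm ℂ (RTube C D M) (RTube C D M) (LTube C D M)
      (LTube C D M)).toLinearMap ∘ₗ
    TensorProduct.map (tubeComul (unitLabels C) (allLabels D) ∘ₗ emb _ _ c h d g)
      (tubeComul (allLabels C) (unitLabels D) ∘ₗ emb _ _ d g e f) ∘ₗ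
    crossedComp C D c h d g e f

/-- The counit of the crossed product: `ε(r ⋈ l) = ε(r) ε(l)` for diagrams `r`, `l` with matching
edges. -/
def crossedCounit : Crossed C D M →ₗ[ℂ] ℂ :=
  ∑ c : Irr M, ∑ h : Irr M, ∑ d : Irr M, ∑ g : Irr M, ∑ e : Irr M, ∑ f : Irr M,
    LinearMap.mul' ℂ ℂ ∘ₗ
    TensorProduct.map (tubeCounit (unitLabels C) (allLabels D) ∘ₗ emb _ _ c h d g)
      (tubeCounit (allLabels C) (unitLabels D) ∘ₗ emb _ _ d g e f) ∘ₗ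
    crossedComp C D c h d g e f

variable (C D M) in
/-- The crossed product `R(M_D) ⋈ L(_C M)`; its unit is `1 ⋈ 1`. -/
def crossedData : BialgData (Crossed C D M) where
  mul := crossedMul
  one := cross C D (tubeOne _ _) (tubeOne _ _)
  comul := crossedComul
  counit := crossedCounit

end Main

end

end DomainWall

namespace DomainWall

noncomputable section

/-!
A label of a tube arc can be slid through the strand it ends on: a diagram with an arbitrary object
`X` on an arc depends only on its image in the coend over `X`, so its expansion in simple labels is
independent of the chosen resolution of `X` (`SlideInvariant`). Every identity between tube diagrams
thus reduces to one between planar composites, the only categorical input being the coherence of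
the actions. Both boundary algebras are the same construction with the labels of one arc restricted
to summands of the unit, a set of labels closed under fusion.

Removing the dotted arc identifies each boundary algebra with diagrams having a single arc, so that
both sides of the gluing map become the same direct sum over the edge labels, and the map is
bijective. Gluing `r ⋈ l` is drawing `r` around `l`, that is, the product `r l` in the tube algebra,
while the exchanged `∑ r'' ⋈ l''` glues to the product `l r'`. Multiplicativity is then
associativity of the tube algebra, and the algebra axioms of the crossed product are pulled back
along the bijection.
-/

/-! ### Coherence of the rebracketing of arcs -/

section Coherence

variable {C D M : Type*} [Category* C] [Category* D] [Category* M]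
  [MonoidalCategory C] [MonoidalCategory D] [MonoidalLeftAction C M] [MonoidalRightAction D M]

/-- The action of morphisms of `C` and `D` on the left and the right arc around a strand `m`. -/
def arcMap {X X' : C} {Y Y' : D} (φ : X ⟶ X') (ψ : Y ⟶ Y') (m : M) :
    (X ⊙ₗ m) ⊙ᵣ Y ⟶ (X' ⊙ₗ m) ⊙ᵣ Y' :=
  (φ ⊵ₗ m) ⊵ᵣ Y ≫ (X' ⊙ₗ m) ⊴ᵣ ψ

@[simp]
lemma arcMap_id (X : C) (Y : D) (m : M) : arcMap (𝟙 X) (𝟙 Y) m = 𝟙 _ := by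
  simp [arcMap]

lemma arcMap_comp {X X' X'' : C} {Y Y' Y'' : D} (φ : X ⟶ X') (φ' : X' ⟶ X'') (ψ : Y ⟶ Y')
    (ψ' : Y' ⟶ Y'') (m : M) :
    arcMap (φ ≫ φ') (ψ ≫ ψ') m = arcMap φ ψ m ≫ arcMap φ' ψ' m := by
  simp only [arcMap, MonoidalLeftAction.comp_actionHomLeft,
    MonoidalRightAction.comp_actionHomLeft, MonoidalRightAction.actionHomRight_comp,
    Category.assoc, MonoidalRightAction.action_exchange_assoc]

lemma arcMap_naturality {X X' : C} {Y Y' : D} (φ : X ⟶ X') (ψ : Y ⟶ Y') {m m' : M}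
    (g : m ⟶ m') :
    (X ⊴ₗ g) ⊵ᵣ Y ≫ arcMap φ ψ m' = arcMap φ ψ m ≫ (X' ⊴ₗ g) ⊵ᵣ Y' := by
  simp only [arcMap, Category.assoc, ← MonoidalRightAction.comp_actionHomLeft_assoc,
    MonoidalLeftAction.action_exchange, MonoidalRightAction.action_exchange]

variable [BimoduleCategory C D M]

open BimoduleCategory

lemma midAssoc_inv_naturality_left {c c' : C} (f : c ⟶ c') (m : M) (d : D) :
    f ⊵ₗ (m ⊙ᵣ d) ≫ (midAssoc c' m d).inv = (midAssoc c m d).inv ≫ (f ⊵ₗ m) ⊵ᵣ d := by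
  rw [Iso.comp_inv_eq, Category.assoc, Iso.eq_inv_comp]
  simpa using (midAssoc_naturality f (𝟙 m) (𝟙 d)).symm

lemma midAssoc_inv_naturality_mid (c : C) {m m' : M} (g : m ⟶ m') (d : D) :
    c ⊴ₗ (g ⊵ᵣ d) ≫ (midAssoc c m' d).inv = (midAssoc c m d).inv ≫ (c ⊴ₗ g) ⊵ᵣ d := by
  rw [Iso.comp_inv_eq, Category.assoc, Iso.eq_inv_comp]
  simpa using (midAssoc_naturality (𝟙 c) g (𝟙 d)).symm

lemma midAssoc_inv_naturality_right (c : C) (m : M) {d d' : D} (h : d ⟶ d') :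
    c ⊴ₗ (m ⊴ᵣ h) ≫ (midAssoc c m d').inv = (midAssoc c m d).inv ≫ (c ⊙ₗ m) ⊴ᵣ h := by
  rw [Iso.comp_inv_eq, Category.assoc, Iso.eq_inv_comp]
  simpa using (midAssoc_naturality (𝟙 c) (𝟙 m) h).symm

/-- The rebracketing of a left arc `X` drawn around two arcs `X'`, `Y'`: the part of `stackIso` in
which the outer right arc takes no part. -/
def leftStack (X X' : C) (Y' : D) (m : M) :
    X ⊙ₗ ((X' ⊙ₗ m) ⊙ᵣ Y') ⟶ ((X ⊗ X') ⊙ₗ m) ⊙ᵣ Y' :=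
  (midAssoc X (X' ⊙ₗ m) Y').inv ≫ (αₗ X X' m).inv ⊵ᵣ Y'

lemma stackIso_hom_eq (X X' : C) (Y Y' : D) (m : M) :
    (stackIso X X' Y Y' m).hom = leftStack X X' Y' m ⊵ᵣ Y ≫ (αᵣ _ Y' Y).inv := by
  simp [stackIso, leftStack]

lemma leftStack_naturality_strand (X X' : C) (Y' : D) {m m' : M} (g : m ⟶ m') :
    X ⊴ₗ ((X' ⊴ₗ g) ⊵ᵣ Y') ≫ leftStack X X' Y' m' =
      leftStack X X' Y' m ≫ ((X ⊗ X') ⊴ₗ g) ⊵ᵣ Y' := by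
  simp only [leftStack, Category.assoc, reassoc_of% midAssoc_inv_naturality_mid,
    ← MonoidalRightAction.comp_actionHomLeft]
  simp

lemma leftStack_naturality_outer {X X'' : C} (φ : X ⟶ X'') (X' : C) (Y' : D) (m : M) :
    φ ⊵ₗ ((X' ⊙ₗ m) ⊙ᵣ Y') ≫ leftStack X'' X' Y' m =
      leftStack X X' Y' m ≫ ((φ ▷ X') ⊵ₗ m) ⊵ᵣ Y' := by
  simp only [leftStack, Category.assoc, reassoc_of% midAssoc_inv_naturality_left,
    ← MonoidalRightAction.comp_actionHomLeft]
  simp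

lemma leftStack_naturality_inner (X : C) {X' X'' : C} (φ : X' ⟶ X'') {Y' Y'' : D}
    (ψ : Y' ⟶ Y'') (m : M) :
    X ⊴ₗ arcMap φ ψ m ≫ leftStack X X'' Y'' m =
      leftStack X X' Y' m ≫ arcMap (X ◁ φ) ψ m := by
  have h : X ⊴ₗ (φ ⊵ₗ m) ≫ (αₗ X X'' m).inv = (αₗ X X' m).inv ≫ (X ◁ φ) ⊵ₗ m := by simp
  simp only [leftStack, arcMap, MonoidalLeftAction.actionHomRight_comp, Category.assoc,
    reassoc_of% midAssoc_inv_naturality_right, reassoc_of% midAssoc_inv_naturality_mid,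
    MonoidalRightAction.action_exchange, ← MonoidalRightAction.comp_actionHomLeft_assoc, h]

lemma actionAssocIso_inv_naturality_left {m m' : M} (f : m ⟶ m') (Y Y' : D) :
    (f ⊵ᵣ Y) ⊵ᵣ Y' ≫ (αᵣ m' Y Y').inv = (αᵣ m Y Y').inv ≫ f ⊵ᵣ (Y ⊗ Y') := by
  simp

lemma actionAssocIso_inv_naturality_mid (m : M) {Y Y'' : D} (ψ : Y ⟶ Y'') (Y' : D) :
    (m ⊴ᵣ ψ) ⊵ᵣ Y' ≫ (αᵣ m Y'' Y').inv = (αᵣ m Y Y').inv ≫ m ⊴ᵣ (ψ ▷ Y') := by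
  simp

lemma actionAssocIso_inv_naturality_right (m : M) (Y : D) {Y' Y'' : D} (ψ : Y' ⟶ Y'') :
    (m ⊙ᵣ Y) ⊴ᵣ ψ ≫ (αᵣ m Y Y'').inv = (αᵣ m Y Y').inv ≫ m ⊴ᵣ (Y ◁ ψ) := by
  simp

lemma stackIso_hom_naturality_strand (X X' : C) (Y Y' : D) {m m' : M} (g : m ⟶ m') :
    (X ⊴ₗ ((X' ⊴ₗ g) ⊵ᵣ Y')) ⊵ᵣ Y ≫ (stackIso X X' Y Y' m').hom =
      (stackIso X X' Y Y' m).hom ≫ ((X ⊗ X') ⊴ₗ g) ⊵ᵣ (Y' ⊗ Y) := by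
  rw [stackIso_hom_eq, stackIso_hom_eq, ← MonoidalRightAction.comp_actionHomLeft_assoc,
    leftStack_naturality_strand, MonoidalRightAction.comp_actionHomLeft_assoc,
    actionAssocIso_inv_naturality_left, Category.assoc]

lemma stackIso_hom_naturality_inner {X' X'' : C} {Y' Y'' : D} (X : C) (Y : D) (φ : X' ⟶ X'')
    (ψ : Y' ⟶ Y'') (m : M) :
    (X ⊴ₗ arcMap φ ψ m) ⊵ᵣ Y ≫ (stackIso X X'' Y Y'' m).hom =
      (stackIso X X' Y Y' m).hom ≫ arcMap (X ◁ φ) (ψ ▷ Y) m := by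
  rw [stackIso_hom_eq, stackIso_hom_eq, ← MonoidalRightAction.comp_actionHomLeft_assoc,
    leftStack_naturality_inner]
  simp only [arcMap, MonoidalRightAction.comp_actionHomLeft, Category.assoc,
    reassoc_of% actionAssocIso_inv_naturality_left, actionAssocIso_inv_naturality_mid]

lemma stackIso_hom_naturality_outer {X X'' : C} {Y Y'' : D} (X' : C) (Y' : D) (φ : X ⟶ X'')
    (ψ : Y ⟶ Y'') (m : M) :
    arcMap φ ψ ((X' ⊙ₗ m) ⊙ᵣ Y') ≫ (stackIso X'' X' Y'' Y' m).hom =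
      (stackIso X X' Y Y' m).hom ≫ arcMap (φ ▷ X') (Y' ◁ ψ) m := by
  rw [stackIso_hom_eq, stackIso_hom_eq, arcMap, arcMap, Category.assoc,
    MonoidalRightAction.action_exchange_assoc, ← MonoidalRightAction.comp_actionHomLeft_assoc,
    leftStack_naturality_outer, MonoidalRightAction.comp_actionHomLeft_assoc,
    actionAssocIso_inv_naturality_right, reassoc_of% actionAssocIso_inv_naturality_left,
    Category.assoc]

lemma stackIso_inv_naturality_outer {X X'' : C} {Y Y'' : D} (X' : C) (Y' : D) (φ : X ⟶ X'')
    (ψ : Y ⟶ Y'') (m : M) :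
    (stackIso X X' Y Y' m).inv ≫ arcMap φ ψ ((X' ⊙ₗ m) ⊙ᵣ Y') =
      arcMap (φ ▷ X') (Y' ◁ ψ) m ≫ (stackIso X'' X' Y'' Y' m).inv := by
  rw [Iso.inv_comp_eq, ← reassoc_of% stackIso_hom_naturality_outer, Iso.hom_inv_id,
    Category.comp_id]

lemma stackIso_inv_naturality_strand (X X' : C) (Y Y' : D) {m m' : M} (g : m ⟶ m') :
    ((X ⊗ X') ⊴ₗ g) ⊵ᵣ (Y' ⊗ Y) ≫ (stackIso X X' Y Y' m').inv =
      (stackIso X X' Y Y' m).inv ≫ (X ⊴ₗ ((X' ⊴ₗ g) ⊵ᵣ Y')) ⊵ᵣ Y := by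
  rw [Iso.comp_inv_eq, Category.assoc, stackIso_hom_naturality_strand, Iso.inv_hom_id_assoc]

lemma stackIso_inv_naturality_inner {X' X'' : C} {Y' Y'' : D} (X : C) (Y : D) (φ : X' ⟶ X'')
    (ψ : Y' ⟶ Y'') (m : M) :
    (stackIso X X' Y Y' m).inv ≫ (X ⊴ₗ arcMap φ ψ m) ⊵ᵣ Y =
      arcMap (X ◁ φ) (ψ ▷ Y) m ≫ (stackIso X X'' Y Y'' m).inv := by
  rw [Iso.inv_comp_eq, ← reassoc_of% stackIso_hom_naturality_inner, Iso.hom_inv_id,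
    Category.comp_id]

lemma leftStack_assoc_left (X X' X'' : C) (Y : D) (m : M) :
    (αₗ X X' ((X'' ⊙ₗ m) ⊙ᵣ Y)).inv ≫ leftStack (X ⊗ X') X'' Y m ≫
        ((α_ X X' X'').hom ⊵ₗ m) ⊵ᵣ Y =
      X ⊴ₗ leftStack X' X'' Y m ≫ leftStack X (X' ⊗ X'') Y m := by
  have h : X ⊴ₗ (midAssoc X' (X'' ⊙ₗ m) Y).inv ≫ (midAssoc X (X' ⊙ₗ X'' ⊙ₗ m) Y).inv =
      (αₗ X X' _).inv ≫ (midAssoc (X ⊗ X') (X'' ⊙ₗ m) Y).inv ≫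
        (αₗ X X' (X'' ⊙ₗ m)).hom ⊵ᵣ Y := by
    rw [← cancel_mono (midAssoc X (X' ⊙ₗ X'' ⊙ₗ m) Y).hom,
      ← cancel_mono (X ⊴ₗ (midAssoc X' (X'' ⊙ₗ m) Y).hom)]
    simp [pentagon_left]
  have h' : (αₗ X X' (X'' ⊙ₗ m)).hom ≫ X ⊴ₗ (αₗ X' X'' m).inv ≫ (αₗ X (X' ⊗ X'') m).inv =
      (αₗ (X ⊗ X') X'' m).inv ≫ (α_ X X' X'').hom ⊵ₗ m := by
    rw [Iso.eq_inv_comp, ← cancel_mono (αₗ X (X' ⊗ X'') m).hom,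
      ← cancel_mono (X ⊴ₗ (αₗ X' X'' m).hom)]
    simp
  simp only [leftStack, MonoidalLeftAction.actionHomRight_comp, Category.assoc,
    reassoc_of% midAssoc_inv_naturality_mid]
  rw [reassoc_of% h]
  simp only [← MonoidalRightAction.comp_actionHomLeft, h']

lemma leftStack_assoc_right (X X' : C) (Y Y' : D) (m : M) :
    X ⊴ₗ (αᵣ (X' ⊙ₗ m) Y Y').inv ≫ leftStack X X' (Y ⊗ Y') m =
      (midAssoc X ((X' ⊙ₗ m) ⊙ᵣ Y) Y').inv ≫ leftStack X X' Y m ⊵ᵣ Y' ≫ (αᵣ _ Y Y').inv := by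
  have h : X ⊴ₗ (αᵣ (X' ⊙ₗ m) Y Y').inv ≫ (midAssoc X (X' ⊙ₗ m) (Y ⊗ Y')).inv =
      (midAssoc X ((X' ⊙ₗ m) ⊙ᵣ Y) Y').inv ≫ (midAssoc X (X' ⊙ₗ m) Y).inv ⊵ᵣ Y' ≫
        (αᵣ _ Y Y').inv := by
    rw [← cancel_mono (midAssoc X (X' ⊙ₗ m) (Y ⊗ Y')).hom,
      ← cancel_mono (X ⊴ₗ (αᵣ (X' ⊙ₗ m) Y Y').hom)]
    simp [pentagon_right]
  simp only [leftStack, reassoc_of% h, MonoidalRightAction.comp_actionHomLeft, Category.assoc,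
    actionAssocIso_inv_naturality_left]

lemma stackIso_hom_assoc (X X' X'' : C) (Y Y' Y'' : D) (m : M) :
    (stackIso X X' Y Y' ((X'' ⊙ₗ m) ⊙ᵣ Y'')).hom ≫ (stackIso (X ⊗ X') X'' (Y' ⊗ Y) Y'' m).hom ≫
        arcMap (α_ X X' X'').hom (α_ Y'' Y' Y).inv m =
      (X ⊴ₗ (stackIso X' X'' Y' Y'' m).hom) ⊵ᵣ Y ≫
        (stackIso X (X' ⊗ X'') Y (Y'' ⊗ Y') m).hom := by
  have h (z : M) : (αᵣ (z ⊙ᵣ Y'') Y' Y).inv ≫ (αᵣ z Y'' (Y' ⊗ Y)).inv ≫ z ⊴ᵣ (α_ Y'' Y' Y).inv =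
      (αᵣ z Y'' Y').inv ⊵ᵣ Y ≫ (αᵣ z (Y'' ⊗ Y') Y).inv := by
    rw [← IsIso.inv_eq_inv]
    simp
  simp only [stackIso_hom_eq, arcMap, Category.assoc]
  rw [← reassoc_of% actionAssocIso_inv_naturality_left,
    ← reassoc_of% actionAssocIso_inv_naturality_left,
    ← reassoc_of% actionAssocIso_inv_naturality_left, h]
  simp only [← MonoidalRightAction.comp_actionHomLeft_assoc,
    MonoidalLeftAction.actionHomRight_comp, Category.assoc, leftStack_assoc_right]
  congr 2
  simp only [← MonoidalRightAction.comp_actionHomLeft_assoc,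
    reassoc_of% midAssoc_inv_naturality_mid, ← leftStack_assoc_left]
  simp only [leftStack, Category.assoc, MonoidalRightAction.comp_actionHomLeft]

lemma stackIso_hom_arcMap {X X' X'' : C} {Y Y' Y'' : D} (φ : X ⊗ X' ⟶ X'')
    (ψ : Y' ⊗ Y ⟶ Y'') (m : M) :
    (stackIso X X' Y Y' m).hom ≫ arcMap φ ψ m =
      (leftStack X X' Y' m ≫ (φ ⊵ₗ m) ⊵ᵣ Y') ⊵ᵣ Y ≫ (αᵣ _ Y' Y).inv ≫ (X'' ⊙ₗ m) ⊴ᵣ ψ := by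
  rw [stackIso_hom_eq, arcMap, Category.assoc, ← reassoc_of% actionAssocIso_inv_naturality_left,
    MonoidalRightAction.comp_actionHomLeft_assoc]

lemma leftStack_outer_unit (X : C) (Y : D) (m : M) :
    leftStack (𝟙_ C) X Y m ≫ ((λ_ X).hom ⊵ₗ m) ⊵ᵣ Y = (λₗ[C] _).hom := by
  simp only [leftStack, Category.assoc, ← MonoidalRightAction.comp_actionHomLeft,
    MonoidalLeftAction.leftUnitor_actionHom, Iso.inv_hom_id_assoc, ← triangle_left]

lemma leftStack_inner_unit (X : C) (Y : D) (m : M) :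
    leftStack X (𝟙_ C) Y m ≫ ((ρ_ X).hom ⊵ₗ m) ⊵ᵣ Y =
      X ⊴ₗ ((λₗ[C] m).hom ⊵ᵣ Y) ≫ (midAssoc X m Y).inv := by
  simp only [leftStack, Category.assoc, ← MonoidalRightAction.comp_actionHomLeft,
    MonoidalLeftAction.rightUnitor_actionHom, Iso.inv_hom_id_assoc, midAssoc_inv_naturality_mid]

lemma actionAssocIso_inv_rightUnitor (m : M) (Y : D) :
    (αᵣ m Y (𝟙_ D)).inv ≫ m ⊴ᵣ (ρ_ Y).hom = (ρᵣ[D] (m ⊙ᵣ Y)).hom := by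
  simp

lemma actionAssocIso_inv_leftUnitor (m : M) (Y : D) :
    (αᵣ m (𝟙_ D) Y).inv ≫ m ⊴ᵣ (λ_ Y).hom = (ρᵣ[D] m).hom ⊵ᵣ Y := by
  simp

lemma midAssoc_inv_unit_right (X : C) (m : M) :
    (midAssoc X m (𝟙_ D)).inv ≫ (ρᵣ[D] (X ⊙ₗ m)).hom = X ⊴ₗ (ρᵣ[D] m).hom := by
  rw [← triangle_right, Iso.inv_hom_id_assoc]

lemma stackIso_hom_outer_unit (X : C) (Y : D) (m : M) :
    (stackIso (𝟙_ C) X (𝟙_ D) Y m).hom ≫ arcMap (λ_ X).hom (ρ_ Y).hom m =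
      (ρᵣ[D] _).hom ≫ (λₗ[C] _).hom := by
  rw [stackIso_hom_arcMap, leftStack_outer_unit, actionAssocIso_inv_rightUnitor,
    MonoidalRightAction.actionUnitIso_hom_naturality]

lemma stackIso_hom_inner_unit (X : C) (Y : D) (m : M) :
    (stackIso X (𝟙_ C) Y (𝟙_ D) m).hom ≫ arcMap (ρ_ X).hom (λ_ Y).hom m =
      (X ⊴ₗ ((ρᵣ[D] _).hom ≫ (λₗ[C] m).hom)) ⊵ᵣ Y := by
  rw [stackIso_hom_arcMap, leftStack_inner_unit, actionAssocIso_inv_leftUnitor,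
    ← MonoidalRightAction.comp_actionHomLeft, Category.assoc, midAssoc_inv_unit_right,
    ← MonoidalLeftAction.actionHomRight_comp, MonoidalRightAction.actionUnitIso_hom_naturality]

lemma stackIso_hom_right_around_left (X : C) (Y : D) (m : M) :
    (stackIso (𝟙_ C) X Y (𝟙_ D) m).hom ≫ arcMap (λ_ X).hom (λ_ Y).hom m =
      ((λₗ[C] _).hom ≫ (ρᵣ[D] _).hom) ⊵ᵣ Y := by
  rw [stackIso_hom_arcMap, leftStack_outer_unit, actionAssocIso_inv_leftUnitor,
    MonoidalRightAction.comp_actionHomLeft]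

lemma stackIso_hom_left_around_right (X : C) (Y : D) (m : M) :
    (stackIso X (𝟙_ C) (𝟙_ D) Y m).hom ≫ arcMap (ρ_ X).hom (ρ_ Y).hom m =
      (ρᵣ[D] _).hom ≫ X ⊴ₗ ((λₗ[C] m).hom ⊵ᵣ Y) ≫ (midAssoc X m Y).inv := by
  rw [stackIso_hom_arcMap, leftStack_inner_unit, actionAssocIso_inv_rightUnitor,
    MonoidalRightAction.actionUnitIso_hom_naturality]

end Coherence

/-! ### Sums over decompositions into simple objects -/

section Slide

variable {C : Type*} [Category* C] [Preadditive C]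

instance Irr.simple_rep (a : Irr C) : Simple a.rep := (Quotient.out a).2

lemma Irr.eq_of_iso {a b : Irr C} (i : a.rep ≅ b.rep) : a = b := by
  rw [← Quotient.out_eq a, ← Quotient.out_eq b]
  exact Quotient.sound ⟨i⟩

lemma Irr.hom_eq_zero [Limits.HasKernels C] {a b : Irr C} (h : a ≠ b) (f : a.rep ⟶ b.rep) :
    f = 0 := by
  by_contra hf
  have := isIso_of_hom_simple hf
  exact h (Irr.eq_of_iso (asIso f))

/-- The decomposition of a chosen simple object with one summand. -/
def SimpleDecomp.ofRep (a : Irr C) : SimpleDecomp a.rep where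
  n := 1
  s _ := a
  incl _ := 𝟙 _
  proj _ := 𝟙 _
  incl_proj_self _ := by simp
  incl_proj_ne k l h := (h (Subsingleton.elim k l)).elim
  sum_proj_incl := by simp

/-- All simple summands of `X` have their labels in `A`. -/
def LabelsIn (A : Finset (Irr C)) (X : C) : Prop :=
  ∀ (a : Irr C) (x : a.rep ⟶ X) (y : X ⟶ a.rep), x ≫ y = 𝟙 a.rep → a ∈ A

lemma LabelsIn.of_retract {A : Finset (Irr C)} {X X' : C} (h : LabelsIn A X) (i : X' ⟶ X)
    (r : X ⟶ X') (hir : i ≫ r = 𝟙 X') : LabelsIn A X' :=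
  fun a x y hxy => h a (x ≫ i) (r ≫ y) (by simp [reassoc_of% hir, hxy])

lemma labelsIn_rep [Limits.HasKernels C] {A : Finset (Irr C)} {a : Irr C} (ha : a ∈ A) :
    LabelsIn A a.rep := by
  intro b x y hxy
  by_cases h : b = a
  · exact h ▸ ha
  · rw [Irr.hom_eq_zero h x, Limits.zero_comp] at hxy
    exact (id_nonzero b.rep hxy.symm).elim

variable [Linear ℂ C] [IsFiniteSemisimple C]

lemma labelsIn_univ (X : C) : LabelsIn (allLabels C) X := fun _ _ _ _ => Finset.mem_univ _

lemma LabelsIn.mem {A : Finset (Irr C)} {X : C} (h : LabelsIn A X) (k) : (dec X).s k ∈ A :=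
  h _ _ _ ((dec X).incl_proj_self k)

section SumSlide

variable [Limits.HasKernels C]

lemma Irr.exists_smul_id {a : Irr C} (f : a.rep ⟶ a.rep) : ∃ r : ℂ, f = r • 𝟙 a.rep := by
  have := IsFiniteSemisimple.finiteDimensional_hom a.rep a.rep
  obtain ⟨r, hr⟩ := endomorphism_simple_eq_smul_id ℂ f
  exact ⟨r, hr.symm⟩

variable {V : Type*} [AddCommGroup V] [Module ℂ V] {X X' : C}

lemma bilin_comp_right_eq_comp_left
    (G : ∀ a : Irr C, (X ⟶ a.rep) →ₗ[ℂ] (a.rep ⟶ X') →ₗ[ℂ] V) {a b : Irr C} (α : X ⟶ a.rep)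
    (θ : a.rep ⟶ b.rep) (β : b.rep ⟶ X') :
    G a α (θ ≫ β) = G b (α ≫ θ) β := by
  by_cases h : a = b
  · subst h
    obtain ⟨r, rfl⟩ := Irr.exists_smul_id θ
    simp
  · simp [Irr.hom_eq_zero h θ]

-- Both sides expand to the sum over `k`, `l` of the matrix coefficients
-- `δ.incl k ≫ φ ≫ δ'.proj l` of `φ`, placed on either side of `G`.
lemma SimpleDecomp.sum_slide (δ : SimpleDecomp X) (δ' : SimpleDecomp X') (φ : X ⟶ X')
    (G : ∀ a : Irr C, (X ⟶ a.rep) →ₗ[ℂ] (a.rep ⟶ X') →ₗ[ℂ] V) :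
    ∑ k, G (δ.s k) (δ.proj k) (δ.incl k ≫ φ) = ∑ k, G (δ'.s k) (φ ≫ δ'.proj k) (δ'.incl k) := by
  have h₁ (k) : δ.incl k ≫ φ = ∑ l, (δ.incl k ≫ φ ≫ δ'.proj l) ≫ δ'.incl l := by
    simp only [Category.assoc, ← Preadditive.comp_sum, δ'.sum_proj_incl, Category.comp_id]
  have h₂ (l) : φ ≫ δ'.proj l = ∑ k, δ.proj k ≫ (δ.incl k ≫ φ ≫ δ'.proj l) := by
    simp only [← Category.assoc (δ.proj _), ← Preadditive.sum_comp, δ.sum_proj_incl,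
      Category.id_comp]
  calc
    _ = ∑ k, ∑ l, G (δ.s k) (δ.proj k) ((δ.incl k ≫ φ ≫ δ'.proj l) ≫ δ'.incl l) := by
      refine Finset.sum_congr rfl fun k _ => ?_
      rw [← map_sum, ← h₁]
    _ = ∑ k, ∑ l, G (δ'.s l) (δ.proj k ≫ (δ.incl k ≫ φ ≫ δ'.proj l)) (δ'.incl l) := by
      simp only [bilin_comp_right_eq_comp_left]
    _ = _ := by
      rw [Finset.sum_comm]
      refine Finset.sum_congr rfl fun l _ => ?_
      rw [← LinearMap.sum_apply, ← map_sum, ← h₂]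

lemma sum_dec_slide (φ : X ⟶ X')
    (G : ∀ a : Irr C, (X ⟶ a.rep) →ₗ[ℂ] (a.rep ⟶ X') →ₗ[ℂ] V) :
    ∑ k, G ((dec X).s k) ((dec X).proj k) ((dec X).incl k ≫ φ) =
      ∑ k, G ((dec X').s k) (φ ≫ (dec X').proj k) ((dec X').incl k) :=
  SimpleDecomp.sum_slide _ _ _ _

lemma sum_dec_from_rep {a : Irr C} (φ : a.rep ⟶ X)
    (G : ∀ d : Irr C, (a.rep ⟶ d.rep) →ₗ[ℂ] (d.rep ⟶ X) →ₗ[ℂ] V) :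
    ∑ k, G ((dec X).s k) (φ ≫ (dec X).proj k) ((dec X).incl k) = G a (𝟙 _) φ := by
  rw [← SimpleDecomp.sum_slide (SimpleDecomp.ofRep a) (dec X) φ G]
  exact (Fin.sum_univ_one fun _ : Fin 1 => G a (𝟙 _) (𝟙 _ ≫ φ)).trans (by simp)

lemma sum_dec_to_rep {a : Irr C} (φ : X ⟶ a.rep)
    (G : ∀ d : Irr C, (X ⟶ d.rep) →ₗ[ℂ] (d.rep ⟶ a.rep) →ₗ[ℂ] V) :
    ∑ k, G ((dec X).s k) ((dec X).proj k) ((dec X).incl k ≫ φ) = G a φ (𝟙 _) := by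
  rw [SimpleDecomp.sum_slide (dec X) (SimpleDecomp.ofRep a) φ G]
  exact (Fin.sum_univ_one fun _ : Fin 1 => G a (φ ≫ 𝟙 _) (𝟙 _)).trans (by simp)

lemma sum_dec_rep {a : Irr C}
    (G : ∀ d : Irr C, (a.rep ⟶ d.rep) →ₗ[ℂ] (d.rep ⟶ a.rep) →ₗ[ℂ] V) :
    ∑ k, G ((dec a.rep).s k) ((dec a.rep).proj k) ((dec a.rep).incl k) = G a (𝟙 _) (𝟙 _) := by
  simpa using sum_dec_from_rep (𝟙 a.rep) G

end SumSlide

variable [MonoidalCategory C]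

lemma unitIncl_unitProj (i : unitLabels C) : unitIncl i ≫ unitProj i = 𝟙 i.1.rep :=
  (unitLabels_spec i).choose_spec.choose_spec

lemma labelsIn_unit : LabelsIn (unitLabels C) (𝟙_ C) := fun a x y h => by
  classical
  simp only [unitLabels, Finset.mem_filter]
  exact ⟨Finset.mem_univ _, x, y, h⟩

/-- Sets of labels that contain the summands of the unit and are closed under fusion. -/
structure FusionClosed (A : Finset (Irr C)) : Prop where
  unit : LabelsIn A (𝟙_ C)
  tensor : ∀ a ∈ A, ∀ b ∈ A, LabelsIn A (a.rep ⊗ b.rep)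

variable (C) in
lemma fusionClosed_allLabels : FusionClosed (allLabels C) :=
  ⟨labelsIn_univ _, fun _ _ _ _ => labelsIn_univ _⟩

variable (C) in
lemma fusionClosed_unitLabels : FusionClosed (unitLabels C) := by
  refine ⟨labelsIn_unit, fun a ha b hb => ?_⟩
  refine labelsIn_unit.of_retract
    ((unitIncl ⟨a, ha⟩ ⊗ₘ unitIncl ⟨b, hb⟩) ≫ (λ_ _).hom)
    ((λ_ _).inv ≫ (unitProj ⟨a, ha⟩ ⊗ₘ unitProj ⟨b, hb⟩)) ?_
  simp [MonoidalCategory.tensorHom_comp_tensorHom, unitIncl_unitProj]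

end Slide

/-! ### Expansion of diagrams into basic tube diagrams -/

section Expand

variable {C D M : Type*} [Category* C] [Category* D] [Category* M]
  [Preadditive M] [Linear ℂ M]
  [MonoidalCategory C] [MonoidalCategory D] [MonoidalLeftAction C M] [MonoidalRightAction D M]

section Linearity

variable [Preadditive D] [Linear ℂ D] [LinearRightAction D M]

lemma actionHomLeft_sum {ι : Type*} (s : Finset ι) {m m' : M} (g : ι → (m ⟶ m')) (Y : D) :
    (∑ i ∈ s, g i) ⊵ᵣ Y = ∑ i ∈ s, g i ⊵ᵣ Y :=
  map_sum (AddMonoidHom.mk' (fun g : m ⟶ m' => g ⊵ᵣ Y)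
    fun g g' => LinearRightAction.add_actionHomLeft g g' Y) g s

variable {X X' : C} {Y Y' : D} (m : M)

@[simp]
lemma arcMap_add_right (φ : X ⟶ X') (ψ ψ' : Y ⟶ Y') :
    arcMap φ (ψ + ψ') m = arcMap φ ψ m + arcMap φ ψ' m := by
  simp [arcMap, LinearRightAction.actionHomRight_add]

@[simp]
lemma arcMap_smul_right (r : ℂ) (φ : X ⟶ X') (ψ : Y ⟶ Y') :
    arcMap φ (r • ψ) m = r • arcMap φ ψ m := by
  simp [arcMap, LinearRightAction.actionHomRight_smul]

lemma arcMap_sum_right {ι : Type*} (s : Finset ι) (φ : X ⟶ X') (ψ : ι → (Y ⟶ Y')) :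
    arcMap φ (∑ i ∈ s, ψ i) m = ∑ i ∈ s, arcMap φ (ψ i) m :=
  map_sum (AddMonoidHom.mk' (fun ψ => arcMap φ ψ m) (arcMap_add_right m φ)) ψ s

variable [Preadditive C] [Linear ℂ C] [LinearLeftAction C M]

@[simp]
lemma arcMap_add_left (φ φ' : X ⟶ X') (ψ : Y ⟶ Y') :
    arcMap (φ + φ') ψ m = arcMap φ ψ m + arcMap φ' ψ m := by
  simp [arcMap, LinearLeftAction.add_actionHomLeft, LinearRightAction.add_actionHomLeft]

@[simp]
lemma arcMap_smul_left (r : ℂ) (φ : X ⟶ X') (ψ : Y ⟶ Y') :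
    arcMap (r • φ) ψ m = r • arcMap φ ψ m := by
  simp [arcMap, LinearLeftAction.smul_actionHomLeft, LinearRightAction.smul_actionHomLeft]

lemma arcMap_sum_left {ι : Type*} (s : Finset ι) (φ : ι → (X ⟶ X')) (ψ : Y ⟶ Y') :
    arcMap (∑ i ∈ s, φ i) ψ m = ∑ i ∈ s, arcMap (φ i) ψ m :=
  map_sum (AddMonoidHom.mk' (fun φ => arcMap φ ψ m) fun φ φ' => arcMap_add_left m φ φ' ψ) φ s

end Linearity

@[simp]
lemma assemble_tmul [Preadditive D] [Linear ℂ D] [LinearRightAction D M] (a : C) (b : D)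
    {c d e f g h : M} (μ : c ⟶ d ⊙ᵣ b) (ν : d ⟶ a ⊙ₗ e)
    (γ : g ⊙ᵣ b ⟶ h) (ζ : a ⊙ₗ f ⟶ g) :
    assemble a b c d e f g h ((μ ⊗ₜ ν) ⊗ₜ (γ ⊗ₜ ζ)) = (μ ≫ ν ⊵ᵣ b) ⊗ₜ (ζ ⊵ᵣ b ≫ γ) := rfl

variable [Preadditive C] [Preadditive D] [IsFiniteSemisimple M]
variable (A : Finset (Irr C)) (B : Finset (Irr D))

/-- The expansion of a diagram with simple objects on the arcs, which decomposes only `a ⊙ e` and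
`a ⊙ f`. -/
def expandSimple (a : Irr C) (b : Irr D) (c h e f : Irr M) :
    Diag a.rep b.rep c.rep e.rep f.rep h.rep →ₗ[ℂ] TubeComp M A B c h e f :=
  if hab : a ∈ A ∧ b ∈ B then
    ∑ p : Fin (dec (a.rep ⊙ₗ e.rep)).n, ∑ q : Fin (dec (a.rep ⊙ₗ f.rep)).n,
      cellEmb A B c h e f (⟨a, hab.1⟩, ⟨b, hab.2⟩, (dec (a.rep ⊙ₗ e.rep)).s p,
          (dec (a.rep ⊙ₗ f.rep)).s q) ∘ₗ
        TensorProduct.map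
          ((TensorProduct.mk ℂ _ _).flip ((dec (a.rep ⊙ₗ e.rep)).incl p) ∘ₗ
            Linear.rightComp ℂ c.rep ((dec (a.rep ⊙ₗ e.rep)).proj p ⊵ᵣ b.rep))
          ((TensorProduct.mk ℂ _ _).flip ((dec (a.rep ⊙ₗ f.rep)).proj q) ∘ₗ
            Linear.leftComp ℂ h.rep ((dec (a.rep ⊙ₗ f.rep)).incl q ⊵ᵣ b.rep))
  else 0

variable {A B}

lemma expandSimple_tmul {a : Irr C} {b : Irr D} (ha : a ∈ A) (hb : b ∈ B) {c h e f : Irr M}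
    (u : c.rep ⟶ (a.rep ⊙ₗ e.rep) ⊙ᵣ b.rep) (v : (a.rep ⊙ₗ f.rep) ⊙ᵣ b.rep ⟶ h.rep) :
    expandSimple A B a b c h e f (u ⊗ₜ v) =
      ∑ p, ∑ q, cellEmb A B c h e f (⟨a, ha⟩, ⟨b, hb⟩, (dec (a.rep ⊙ₗ e.rep)).s p,
          (dec (a.rep ⊙ₗ f.rep)).s q)
        (((u ≫ (dec (a.rep ⊙ₗ e.rep)).proj p ⊵ᵣ b.rep) ⊗ₜ (dec (a.rep ⊙ₗ e.rep)).incl p) ⊗ₜ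
          (((dec (a.rep ⊙ₗ f.rep)).incl q ⊵ᵣ b.rep ≫ v) ⊗ₜ (dec (a.rep ⊙ₗ f.rep)).proj q)) := by
  rw [expandSimple, dif_pos ⟨ha, hb⟩]
  simp only [LinearMap.sum_apply]
  rfl

lemma expandSimple_comp_tmul_comp [Limits.HasKernels M] [Linear ℂ D] [LinearRightAction D M]
    (t : A × B × Irr M × Irr M) {c h e f : Irr M}
    (μ : c.rep ⟶ t.2.2.1.rep ⊙ᵣ t.2.1.1.rep) (ν : t.2.2.1.rep ⟶ t.1.1.rep ⊙ₗ e.rep)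
    (γ : t.2.2.2.rep ⊙ᵣ t.2.1.1.rep ⟶ h.rep) (ζ : t.1.1.rep ⊙ₗ f.rep ⟶ t.2.2.2.rep) :
    expandSimple A B t.1.1 t.2.1.1 c h e f
        ((μ ≫ ν ⊵ᵣ t.2.1.1.rep) ⊗ₜ (ζ ⊵ᵣ t.2.1.1.rep ≫ γ)) =
      cellEmb A B c h e f t ((μ ⊗ₜ ν) ⊗ₜ (γ ⊗ₜ ζ)) := by
  obtain ⟨⟨a, ha⟩, ⟨b, hb⟩, d, g⟩ := t
  rw [expandSimple_tmul ha hb]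
  simp only [Category.assoc, ← MonoidalRightAction.comp_actionHomLeft,
    ← MonoidalRightAction.comp_actionHomLeft_assoc]
  have lower := sum_dec_from_rep (V := TubeComp M A B c h e f) ν fun d' => LinearMap.mk₂ ℂ
    (fun (α : d.rep ⟶ d'.rep) (β : d'.rep ⟶ a.rep ⊙ₗ e.rep) =>
      ∑ q, cellEmb A B c h e f (⟨a, ha⟩, ⟨b, hb⟩, d', (dec (a.rep ⊙ₗ f.rep)).s q)
        (((μ ≫ α ⊵ᵣ b.rep) ⊗ₜ β) ⊗ₜ
          ((((dec (a.rep ⊙ₗ f.rep)).incl q ≫ ζ) ⊵ᵣ b.rep ≫ γ) ⊗ₜ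
            (dec (a.rep ⊙ₗ f.rep)).proj q)))
    (by intros; simp [LinearRightAction.add_actionHomLeft, add_tmul, Finset.sum_add_distrib])
    (by intros; simp [LinearRightAction.smul_actionHomLeft, ← smul_tmul', Finset.smul_sum])
    (by intros; simp [tmul_add, add_tmul, Finset.sum_add_distrib])
    (by intros; simp only [tmul_smul, ← smul_tmul', map_smul, Finset.smul_sum])
  have upper := sum_dec_to_rep (V := TubeComp M A B c h e f) ζ fun g' => LinearMap.mk₂ ℂ
    (fun (α : a.rep ⊙ₗ f.rep ⟶ g'.rep) (β : g'.rep ⟶ g.rep) =>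
      cellEmb A B c h e f (⟨a, ha⟩, ⟨b, hb⟩, d, g')
        ((μ ⊗ₜ ν) ⊗ₜ ((β ⊵ᵣ b.rep ≫ γ) ⊗ₜ α)))
    (by intros; simp only [tmul_add, map_add])
    (by intros; simp only [tmul_smul, map_smul])
    (by intros; simp only [LinearRightAction.add_actionHomLeft, Preadditive.add_comp,
          add_tmul, tmul_add, map_add])
    (by intros; simp only [LinearRightAction.smul_actionHomLeft, Linear.smul_comp,
          ← smul_tmul', tmul_smul, map_smul])
  simp only [LinearMap.mk₂_apply, MonoidalRightAction.id_actionHomLeft, Category.comp_id,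
    Category.id_comp] at lower upper
  rw [lower, upper]

variable [Linear ℂ C] [Linear ℂ D] [IsFiniteSemisimple C] [IsFiniteSemisimple D]

variable (A B) in
lemma expand_tmul (X : C) (Y : D) {c h e f : Irr M}
    (u : c.rep ⟶ (X ⊙ₗ e.rep) ⊙ᵣ Y) (v : (X ⊙ₗ f.rep) ⊙ᵣ Y ⟶ h.rep) :
    expand A B X Y c h e f (u ⊗ₜ v) =
      ∑ k, ∑ l, expandSimple A B ((dec X).s k) ((dec Y).s l) c h e f
        ((u ≫ arcMap ((dec X).proj k) ((dec Y).proj l) e.rep) ⊗ₜ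
          (arcMap ((dec X).incl k) ((dec Y).incl l) f.rep ≫ v)) := by
  simp only [expand, LinearMap.sum_apply]
  refine Finset.sum_congr rfl fun k _ => Finset.sum_congr rfl fun l _ => ?_
  by_cases hkl : (dec X).s k ∈ A ∧ (dec Y).s l ∈ B
  · rw [dif_pos hkl, expandSimple_tmul hkl.1 hkl.2]
    simp only [LinearMap.sum_apply]
    refine Finset.sum_congr rfl fun p _ => Finset.sum_congr rfl fun q _ => ?_
    simp only [LinearMap.comp_apply, TensorProduct.map_tmul, LinearMap.flip_apply,
      TensorProduct.mk_apply, Linear.rightComp_apply, Linear.leftComp_apply, Category.assoc,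
      arcMap]
    rw [MonoidalRightAction.action_exchange_assoc (f := (dec X).incl k ⊵ₗ f.rep)]
  · rw [dif_neg hkl, expandSimple, dif_neg hkl, LinearMap.zero_apply, LinearMap.zero_apply]

section Kernels

variable [LinearLeftAction C M] [LinearRightAction D M]
  [Limits.HasKernels C] [Limits.HasKernels D]

variable (A B) in
lemma expand_slide {X X' : C} {Y Y' : D} (φ : X ⟶ X') (ψ : Y ⟶ Y') {c h e f : Irr M}
    (u : c.rep ⟶ (X ⊙ₗ e.rep) ⊙ᵣ Y) (v : (X' ⊙ₗ f.rep) ⊙ᵣ Y' ⟶ h.rep) :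
    expand A B X Y c h e f (u ⊗ₜ (arcMap φ ψ f.rep ≫ v)) =
      expand A B X' Y' c h e f ((u ≫ arcMap φ ψ e.rep) ⊗ₜ v) := by
  simp only [expand_tmul, Category.assoc, ← arcMap_comp, ← reassoc_of% arcMap_comp]
  have left := sum_dec_slide (V := TubeComp M A B c h e f) φ fun a => LinearMap.mk₂ ℂ
    (fun (α : X ⟶ a.rep) (β : a.rep ⟶ X') =>
      ∑ l, expandSimple A B a ((dec Y).s l) c h e f
        ((u ≫ arcMap α ((dec Y).proj l) e.rep) ⊗ₜ
          (arcMap β ((dec Y).incl l ≫ ψ) f.rep ≫ v)))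
    (by intros; simp [add_tmul, Finset.sum_add_distrib])
    (by intros; simp [← smul_tmul', Finset.smul_sum])
    (by intros; simp [tmul_add, Finset.sum_add_distrib])
    (by intros; simp [tmul_smul, Finset.smul_sum])
  simp only [LinearMap.mk₂_apply] at left
  rw [left]
  refine Finset.sum_congr rfl fun k _ => ?_
  exact sum_dec_slide (V := TubeComp M A B c h e f) ψ fun b => LinearMap.mk₂ ℂ
    (fun (α : Y ⟶ b.rep) (β : b.rep ⟶ Y') =>
      expandSimple A B ((dec X').s k) b c h e f
        ((u ≫ arcMap (φ ≫ (dec X').proj k) α e.rep) ⊗ₜ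
          (arcMap ((dec X').incl k) β f.rep ≫ v)))
    (by intros; simp [add_tmul]) (by intros; simp [← smul_tmul'])
    (by intros; simp [tmul_add]) (by intros; simp [tmul_smul])

lemma expand_rep (a : Irr C) (b : Irr D) {c h e f : Irr M}
    (x : Diag a.rep b.rep c.rep e.rep f.rep h.rep) :
    expand A B a.rep b.rep c h e f x = expandSimple A B a b c h e f x := by
  refine LinearMap.congr_fun (f := expand A B _ _ c h e f) (TensorProduct.ext' fun u v => ?_) x
  rw [expand_tmul]
  have left := sum_dec_rep (V := TubeComp M A B c h e f) (a := a) fun a' => LinearMap.mk₂ ℂ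
    (fun (α : a.rep ⟶ a'.rep) (β : a'.rep ⟶ a.rep) =>
      ∑ l, expandSimple A B a' ((dec b.rep).s l) c h e f
        ((u ≫ arcMap α ((dec b.rep).proj l) e.rep) ⊗ₜ
          (arcMap β ((dec b.rep).incl l) f.rep ≫ v)))
    (by intros; simp [add_tmul, Finset.sum_add_distrib])
    (by intros; simp [← smul_tmul', Finset.smul_sum])
    (by intros; simp [tmul_add, Finset.sum_add_distrib])
    (by intros; simp [tmul_smul, Finset.smul_sum])
  have right := sum_dec_rep (V := TubeComp M A B c h e f) (a := b) fun b' => LinearMap.mk₂ ℂ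
    (fun (α : b.rep ⟶ b'.rep) (β : b'.rep ⟶ b.rep) =>
      expandSimple A B a b' c h e f
        ((u ≫ arcMap (𝟙 a.rep) α e.rep) ⊗ₜ (arcMap (𝟙 a.rep) β f.rep ≫ v)))
    (by intros; simp [add_tmul]) (by intros; simp [← smul_tmul'])
    (by intros; simp [tmul_add]) (by intros; simp [tmul_smul])
  simp only [LinearMap.mk₂_apply] at left right
  rw [left, right]
  simp

lemma expand_assemble [Limits.HasKernels M] {c h e f : Irr M} (t : A × B × Irr M × Irr M)
    (z : Cell t.1.1.rep t.2.1.1.rep c.rep t.2.2.1.rep e.rep f.rep t.2.2.2.rep h.rep) :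
    expand A B t.1.1.rep t.2.1.1.rep c h e f (assemble _ _ _ _ _ _ _ _ z) =
      cellEmb A B c h e f t z := by
  refine LinearMap.congr_fun (f := expand A B _ _ c h e f ∘ₗ assemble _ _ _ _ _ _ _ _)
    (TensorProduct.ext_fourfold' fun μ ν γ ζ => ?_) z
  rw [LinearMap.comp_apply, assemble_tmul, expand_rep, expandSimple_comp_tmul_comp]

end Kernels

end Expand

/-! ### Generators of the span of tube diagrams -/

section Generators

variable {C D M : Type*} [Category* C] [Category* D] [Category* M]
  [Preadditive C] [Preadditive D] [Preadditive M] [Linear ℂ M]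
  [MonoidalCategory C] [MonoidalCategory D] [MonoidalLeftAction C M] [MonoidalRightAction D M]
  {A : Finset (Irr C)} {B : Finset (Irr D)}

lemma coeff_cellEmb_self {c h e f : Irr M} (t : A × B × Irr M × Irr M)
    (z : Cell t.1.1.rep t.2.1.1.rep c.rep t.2.2.1.rep e.rep f.rep t.2.2.2.rep h.rep) :
    coeff A B c h e f t (cellEmb A B c h e f t z) = z :=
  Pi.single_eq_same _ _

lemma coeff_cellEmb_of_ne {c h e f : Irr M} {t t' : A × B × Irr M × Irr M} (ht : t ≠ t')
    (z : Cell t'.1.1.rep t'.2.1.1.rep c.rep t'.2.2.1.rep e.rep f.rep t'.2.2.2.rep h.rep) :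
    coeff A B c h e f t (cellEmb A B c h e f t' z) = 0 :=
  Pi.single_eq_of_ne ht _

lemma comp_emb_self {c h e f : Irr M} (x : TubeComp M A B c h e f) :
    comp A B c h e f (emb A B c h e f x) = x :=
  Pi.single_eq_same (M := fun q : Irr M × Irr M × Irr M × Irr M =>
    TubeComp M A B q.1 q.2.1 q.2.2.1 q.2.2.2) (c, h, e, f) x

lemma comp_emb_of_ne {c h e f c' h' e' f' : Irr M} (hq : (c, h, e, f) ≠ (c', h', e', f'))
    (x : TubeComp M A B c' h' e' f') :
    comp A B c h e f (emb A B c' h' e' f' x) = 0 :=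
  Pi.single_eq_of_ne (M := fun q : Irr M × Irr M × Irr M × Irr M =>
    TubeComp M A B q.1 q.2.1 q.2.2.1 q.2.2.2) hq x

variable [IsFiniteSemisimple M]

lemma sum_cellEmb_coeff {c h e f : Irr M} (x : TubeComp M A B c h e f) :
    ∑ t, cellEmb A B c h e f t (coeff A B c h e f t x) = x :=
  Finset.univ_sum_single (M := fun t : A × B × Irr M × Irr M =>
    Cell t.1.1.rep t.2.1.1.rep c.rep t.2.2.1.rep e.rep f.rep t.2.2.2.rep h.rep) x

lemma sum_emb_comp (x : TubeOn M A B) :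
    ∑ c, ∑ h, ∑ e, ∑ f, emb A B c h e f (comp A B c h e f x) = x := by
  have h := Finset.univ_sum_single (M := fun q : Irr M × Irr M × Irr M × Irr M =>
    TubeComp M A B q.1 q.2.1 q.2.2.1 q.2.2.2) x
  simp only [Fintype.sum_prod_type] at h
  exact h

variable {V : Type*} [AddCommMonoid V]

lemma sum_coeff_cellEmb {c h e f : Irr M}
    (F : ∀ t : A × B × Irr M × Irr M,
      Cell t.1.1.rep t.2.1.1.rep c.rep t.2.2.1.rep e.rep f.rep t.2.2.2.rep h.rep → V)
    (hF : ∀ t, F t 0 = 0) (t : A × B × Irr M × Irr M)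
    (z : Cell t.1.1.rep t.2.1.1.rep c.rep t.2.2.1.rep e.rep f.rep t.2.2.2.rep h.rep) :
    ∑ t', F t' (coeff A B c h e f t' (cellEmb A B c h e f t z)) = F t z := by
  rw [Finset.sum_eq_single t, coeff_cellEmb_self]
  · intro t' _ ht
    rw [coeff_cellEmb_of_ne ht, hF]
  · simp

lemma sum_comp_emb
    (F : ∀ c h e f : Irr M, TubeComp M A B c h e f → V)
    (hF : ∀ c h e f, F c h e f 0 = 0) {c h e f : Irr M} (x : TubeComp M A B c h e f) :
    ∑ c', ∑ h', ∑ e', ∑ f', F c' h' e' f' (comp A B c' h' e' f' (emb A B c h e f x)) =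
      F c h e f x := by
  simp only [← Fintype.sum_prod_type']
  rw [Finset.sum_eq_single (c, h, e, f), comp_emb_self]
  · rintro ⟨c', h', e', f'⟩ - hq
    dsimp only
    rw [comp_emb_of_ne hq, hF]
  · exact fun hq => absurd (Finset.mem_univ _) hq

end Generators

section Expansion

variable {C D M : Type*} [Category* C] [Category* D] [Category* M]
  [Preadditive C] [Preadditive D] [Linear ℂ D] [Preadditive M] [Linear ℂ M]
  [MonoidalCategory C] [MonoidalCategory D] [MonoidalLeftAction C M] [MonoidalRightAction D M]

variable [IsFiniteSemisimple M] {A : Finset (Irr C)} {B : Finset (Irr D)}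

lemma sum_toDiag_expandSimple [LinearRightAction D M] {c h e f : Irr M} {V : Type*}
    [AddCommGroup V] [Module ℂ V]
    (T : ∀ (X : C) (Y : D), Diag X Y c.rep e.rep f.rep h.rep →ₗ[ℂ] V) {a : Irr C} {b : Irr D}
    (ha : a ∈ A) (hb : b ∈ B) (u : c.rep ⟶ (a.rep ⊙ₗ e.rep) ⊙ᵣ b.rep)
    (v : (a.rep ⊙ₗ f.rep) ⊙ᵣ b.rep ⟶ h.rep) :
    ∑ t, T _ _ (toDiag A B c h e f t (expandSimple A B a b c h e f (u ⊗ₜ v))) =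
      T a.rep b.rep (u ⊗ₜ v) := by
  have single_cell (p q) := sum_coeff_cellEmb (A := A) (B := B) (c := c) (h := h) (e := e) (f := f)
    (fun t z => T _ _ (assemble _ _ _ _ _ _ _ _ z)) (fun t => by simp)
    (⟨a, ha⟩, ⟨b, hb⟩, (dec (a.rep ⊙ₗ e.rep)).s p, (dec (a.rep ⊙ₗ f.rep)).s q)
    (((u ≫ (dec (a.rep ⊙ₗ e.rep)).proj p ⊵ᵣ b.rep) ⊗ₜ (dec (a.rep ⊙ₗ e.rep)).incl p) ⊗ₜ
      (((dec (a.rep ⊙ₗ f.rep)).incl q ⊵ᵣ b.rep ≫ v) ⊗ₜ (dec (a.rep ⊙ₗ f.rep)).proj q))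
  simp only [expandSimple_tmul ha hb, toDiag, LinearMap.comp_apply, map_sum]
  rw [Finset.sum_comm]
  refine (Finset.sum_congr rfl fun p _ =>
    Finset.sum_comm.trans (Finset.sum_congr rfl fun q _ => single_cell p q)).trans ?_
  change ∑ p, ∑ q, T a.rep b.rep (((u ≫ (dec (a.rep ⊙ₗ e.rep)).proj p ⊵ᵣ b.rep) ≫
      (dec (a.rep ⊙ₗ e.rep)).incl p ⊵ᵣ b.rep) ⊗ₜ ((dec (a.rep ⊙ₗ f.rep)).proj q ⊵ᵣ b.rep ≫
      (dec (a.rep ⊙ₗ f.rep)).incl q ⊵ᵣ b.rep ≫ v)) = _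
  simp only [Category.assoc, ← MonoidalRightAction.comp_actionHomLeft,
    ← MonoidalRightAction.comp_actionHomLeft_assoc]
  simp only [← map_sum, ← tmul_sum, ← sum_tmul, ← Preadditive.comp_sum, ← Preadditive.sum_comp,
    ← actionHomLeft_sum, SimpleDecomp.sum_proj_incl, MonoidalRightAction.id_actionHomLeft,
    Category.comp_id, Category.id_comp]

variable [Linear ℂ C]

/-- A family of linear maps on the spaces of diagrams with arbitrary arcs for which morphisms can
be moved along the arcs from the upper to the lower strand. -/
structure SlideInvariant {c e f h : M} {V : Type*} [AddCommGroup V] [Module ℂ V]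
    (T : ∀ (X : C) (Y : D), Diag X Y c e f h →ₗ[ℂ] V) : Prop where
  slide : ∀ {X X' : C} {Y Y' : D} (φ : X ⟶ X') (ψ : Y ⟶ Y') (u : c ⟶ (X ⊙ₗ e) ⊙ᵣ Y)
    (v : (X' ⊙ₗ f) ⊙ᵣ Y' ⟶ h),
    T X Y (u ⊗ₜ (arcMap φ ψ f ≫ v)) = T X' Y' ((u ≫ arcMap φ ψ e) ⊗ₜ v)

variable [IsFiniteSemisimple C] [IsFiniteSemisimple D]

lemma inclTube_emb {c h e f : Irr M} (x : TubeComp M A B c h e f) :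
    inclTube A B (emb A B c h e f x) =
      ∑ t : A × B × Irr M × Irr M, emb (allLabels C) (allLabels D) c h e f
        (cellEmb (allLabels C) (allLabels D) c h e f
          (⟨t.1.1, Finset.mem_univ _⟩, ⟨t.2.1.1, Finset.mem_univ _⟩, t.2.2.1, t.2.2.2)
          (coeff A B c h e f t x)) := by
  simp only [inclTube, LinearMap.sum_apply, LinearMap.comp_apply]
  exact sum_comp_emb (fun c h e f x => ∑ t : A × B × Irr M × Irr M,
    emb (allLabels C) (allLabels D) c h e f (cellEmb (allLabels C) (allLabels D) c h e f
      (⟨t.1.1, Finset.mem_univ _⟩, ⟨t.2.1.1, Finset.mem_univ _⟩, t.2.2.1, t.2.2.2)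
      (coeff A B c h e f t x))) (fun c h e f => by simp) x

lemma inclTube_emb_cellEmb {c h e f : Irr M} (t : A × B × Irr M × Irr M)
    (z : Cell t.1.1.rep t.2.1.1.rep c.rep t.2.2.1.rep e.rep f.rep t.2.2.2.rep h.rep) :
    inclTube A B (emb A B c h e f (cellEmb A B c h e f t z)) =
      emb (allLabels C) (allLabels D) c h e f (cellEmb (allLabels C) (allLabels D) c h e f
        (⟨t.1.1, Finset.mem_univ _⟩, ⟨t.2.1.1, Finset.mem_univ _⟩, t.2.2.1, t.2.2.2) z) := by
  rw [inclTube_emb]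
  exact sum_coeff_cellEmb (A := A) (B := B) (fun t z => emb (allLabels C) (allLabels D) c h e f
    (cellEmb (allLabels C) (allLabels D) c h e f
      (⟨t.1.1, Finset.mem_univ _⟩, ⟨t.2.1.1, Finset.mem_univ _⟩, t.2.2.1, t.2.2.2) z))
    (fun t => by simp) t z

lemma comp_inclTube {c h e f : Irr M} (x : TubeOn M A B) :
    comp _ _ c h e f (inclTube A B x) =
      ∑ t : A × B × Irr M × Irr M, cellEmb (allLabels C) (allLabels D) c h e f
        (⟨t.1.1, Finset.mem_univ _⟩, ⟨t.2.1.1, Finset.mem_univ _⟩, t.2.2.1, t.2.2.2)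
        (coeff A B c h e f t (comp _ _ c h e f x)) := by
  rw [← sum_emb_comp x]
  simp only [map_sum]
  simp_rw [Finset.sum_comm (s := Finset.univ (α := A × B × Irr M × Irr M)), inclTube_emb, map_sum]
  refine Finset.sum_congr rfl fun c' _ => Finset.sum_congr rfl fun h' _ =>
    Finset.sum_congr rfl fun e' _ => Finset.sum_congr rfl fun f' _ =>
    Finset.sum_congr rfl fun t _ => ?_
  by_cases hq : (c, h, e, f) = (c', h', e', f')
  · simp only [Prod.mk.injEq] at hq
    obtain ⟨rfl, rfl, rfl, rfl⟩ := hq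
    rw [comp_emb_self, comp_emb_self]
  · rw [comp_emb_of_ne hq, comp_emb_of_ne hq, map_zero, map_zero]

lemma coeff_comp_inclTube {c h e f : Irr M} (x : TubeOn M A B) (t : A × B × Irr M × Irr M) :
    coeff (allLabels C) (allLabels D) c h e f
      (⟨t.1.1, Finset.mem_univ _⟩, ⟨t.2.1.1, Finset.mem_univ _⟩, t.2.2.1, t.2.2.2)
      (comp _ _ c h e f (inclTube A B x)) = coeff A B c h e f t (comp _ _ c h e f x) := by
  rw [comp_inclTube, map_sum, Finset.sum_eq_single t]
  · exact coeff_cellEmb_self (A := allLabels C) (B := allLabels D) (_, _, _, _) _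
  · rintro t' - ht
    refine coeff_cellEmb_of_ne (A := allLabels C) (B := allLabels D) (fun heq => ht ?_) _
    simp only [Prod.mk.injEq, Subtype.mk.injEq] at heq
    exact Prod.ext (Subtype.ext heq.1.symm) (Prod.ext (Subtype.ext heq.2.1.symm)
      (Prod.ext heq.2.2.1.symm heq.2.2.2.symm))
  · simp

lemma inclTube_injective : Function.Injective (inclTube A B : TubeOn M A B →ₗ[ℂ] Tube C D M) := by
  intro x y hxy
  funext ⟨c, h, e, f⟩
  funext t
  have hcoeff := coeff_comp_inclTube (c := c) (h := h) (e := e) (f := f) x t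
  rw [hxy, coeff_comp_inclTube] at hcoeff
  exact hcoeff.symm

variable (A B) in
/-- The element of the span of tube diagrams represented by a diagram with arbitrary arcs. -/
def gen (X : C) (Y : D) (c h e f : Irr M) :
    Diag X Y c.rep e.rep f.rep h.rep →ₗ[ℂ] TubeOn M A B :=
  emb A B c h e f ∘ₗ expand A B X Y c h e f

section

variable {c h e f : Irr M} {V : Type*} [AddCommGroup V] [Module ℂ V]
  [LinearLeftAction C M] [LinearRightAction D M]

theorem SlideInvariant.sum_toDiag_expand
    {T : ∀ (X : C) (Y : D), Diag X Y c.rep e.rep f.rep h.rep →ₗ[ℂ] V} (hT : SlideInvariant T)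
    {X : C} {Y : D} (hX : LabelsIn A X) (hY : LabelsIn B Y)
    (x : Diag X Y c.rep e.rep f.rep h.rep) :
    ∑ t, T _ _ (toDiag A B c h e f t (expand A B X Y c h e f x)) = T X Y x := by
  induction x using TensorProduct.induction_on with
  | zero => simp
  | add x y hx hy => simp only [map_add, Finset.sum_add_distrib, hx, hy]
  | tmul u v =>
    simp only [expand_tmul, map_sum]
    rw [Finset.sum_comm]
    refine (Finset.sum_congr rfl fun k _ => Finset.sum_comm.trans (Finset.sum_congr rfl fun l _ =>
      (sum_toDiag_expandSimple T (hX.mem k) (hY.mem l) _ _).trans (hT.slide _ _ _ _).symm)).trans ?_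
    simp only [← reassoc_of% arcMap_comp]
    simp only [← map_sum, ← tmul_sum, ← Preadditive.sum_comp, ← arcMap_sum_right,
      ← arcMap_sum_left, SimpleDecomp.sum_proj_incl, arcMap_id, Category.id_comp]

end

variable [LinearLeftAction C M] [LinearRightAction D M]
  [Limits.HasKernels C] [Limits.HasKernels D]

variable (A B) in
lemma slideInvariant_expand (c h e f : Irr M) :
    SlideInvariant fun (X : C) (Y : D) => expand A B X Y c h e f :=
  ⟨fun φ ψ u v => expand_slide A B φ ψ u v⟩

lemma slideInvariant_gen (c h e f : Irr M) :
    SlideInvariant fun (X : C) (Y : D) => gen A B X Y c h e f where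
  slide φ ψ u v := by simp only [gen, LinearMap.comp_apply, expand_slide]

variable [Limits.HasKernels M]

lemma sum_expand_toDiag {c h e f : Irr M} (x : TubeComp M A B c h e f) :
    ∑ t : A × B × Irr M × Irr M, expand A B t.1.1.rep t.2.1.1.rep c h e f
      (toDiag A B c h e f t x) = x := by
  simp only [toDiag, LinearMap.comp_apply, expand_assemble, sum_cellEmb_coeff]

lemma emb_eq_sum_gen {c h e f : Irr M} (x : TubeComp M A B c h e f) :
    emb A B c h e f x = ∑ t : A × B × Irr M × Irr M, gen A B t.1.1.rep t.2.1.1.rep c h e f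
      (toDiag A B c h e f t x) := by
  conv_lhs => rw [← sum_expand_toDiag x, map_sum]
  rfl

lemma tubeOn_induction {P : TubeOn M A B → Prop} (zero : P 0) (add : ∀ x y, P x → P y → P (x + y))
    (gen : ∀ a ∈ A, ∀ b ∈ B, ∀ (c h e f : Irr M) (u : c.rep ⟶ (a.rep ⊙ₗ e.rep) ⊙ᵣ b.rep)
      (v : (a.rep ⊙ₗ f.rep) ⊙ᵣ b.rep ⟶ h.rep), P (gen A B a.rep b.rep c h e f (u ⊗ₜ v)))
    (x : TubeOn M A B) : P x := by
  rw [← sum_emb_comp x]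
  refine Finset.sum_induction _ _ add zero fun c _ => Finset.sum_induction _ _ add zero fun h _ =>
    Finset.sum_induction _ _ add zero fun e _ => Finset.sum_induction _ _ add zero fun f _ => ?_
  rw [emb_eq_sum_gen]
  refine Finset.sum_induction _ _ add zero fun t _ => ?_
  generalize toDiag A B c h e f t (comp A B c h e f x) = z
  induction z using TensorProduct.induction_on with
  | zero => simpa using zero
  | add y z hy hz => rw [map_add]; exact add _ _ hy hz
  | tmul u v => exact gen _ t.1.2 _ t.2.1.2 _ _ _ _ u v

lemma inclTube_gen {X : C} {Y : D} (hX : LabelsIn A X) (hY : LabelsIn B Y) {c h e f : Irr M}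
    (x : Diag X Y c.rep e.rep f.rep h.rep) :
    inclTube A B (gen A B X Y c h e f x) = gen (allLabels C) (allLabels D) X Y c h e f x := by
  rw [gen, LinearMap.comp_apply, inclTube_emb]
  rw [← (slideInvariant_gen (A := allLabels C) (B := allLabels D) c h e f).sum_toDiag_expand
    hX hY x]
  refine Finset.sum_congr rfl fun t _ => ?_
  rw [gen, LinearMap.comp_apply, toDiag, LinearMap.comp_apply]
  exact congrArg _ (expand_assemble (A := allLabels C) (B := allLabels D)
    (⟨t.1.1, Finset.mem_univ _⟩, ⟨t.2.1.1, Finset.mem_univ _⟩, t.2.2.1, t.2.2.2) _).symm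

end Expansion

/-! ### The product of tube diagrams -/

section Product

variable {C D M : Type*} [Category* C] [Category* D] [Category* M]
  [Preadditive C] [Linear ℂ C] [Preadditive D] [Linear ℂ D] [Preadditive M] [Linear ℂ M]
  [MonoidalCategory C] [MonoidalCategory D] [MonoidalLeftAction C M] [MonoidalRightAction D M]

section Unit

variable [IsFiniteSemisimple C] [IsFiniteSemisimple D] [IsFiniteSemisimple M]
  {A : Finset (Irr C)} {B : Finset (Irr D)}

variable (C D) in
/-- The pair of strands `c`, `h` with dotted arcs. -/
def unitDiag (c h : M) : Diag (𝟙_ C) (𝟙_ D) c c h h :=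
  ((λₗ[C] c).inv ≫ (ρᵣ[D] (𝟙_ C ⊙ₗ c)).inv) ⊗ₜ ((ρᵣ[D] (𝟙_ C ⊙ₗ h)).hom ≫ (λₗ[C] h).hom)

lemma tubeOne_eq : tubeOne A B = ∑ c : Irr M, ∑ h : Irr M,
    gen A B (𝟙_ C) (𝟙_ D) c h c h (unitDiag C D c.rep h.rep) := rfl

theorem inclTube_one [LinearLeftAction C M] [LinearRightAction D M] [Limits.HasKernels C]
    [Limits.HasKernels D] [Limits.HasKernels M] (hA : FusionClosed A) (hB : FusionClosed B) :
    inclTube A B (tubeOne A B : TubeOn M A B) = tubeOne (allLabels C) (allLabels D) := by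
  simp only [tubeOne_eq, map_sum, inclTube_gen hA.unit hB.unit]

end Unit

variable [LinearLeftAction C M] [LinearRightAction D M] [BimoduleCategory C D M]

@[simp]
lemma stack_tmul (X X' : C) (Y Y' : D) {c m n h e f : M}
    (u : c ⟶ (X ⊙ₗ m) ⊙ᵣ Y) (v : (X ⊙ₗ n) ⊙ᵣ Y ⟶ h)
    (u' : m ⟶ (X' ⊙ₗ e) ⊙ᵣ Y') (v' : (X' ⊙ₗ f) ⊙ᵣ Y' ⟶ n) :
    stack X X' Y Y' c m n h e f (u ⊗ₜ v) (u' ⊗ₜ v') =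
      (u ≫ (X ⊴ₗ u') ⊵ᵣ Y ≫ (stackIso X X' Y Y' e).hom) ⊗ₜ
        ((stackIso X X' Y Y' f).inv ≫ (X ⊴ₗ v') ⊵ᵣ Y ≫ v) := rfl

variable [IsFiniteSemisimple C] [IsFiniteSemisimple D] [IsFiniteSemisimple M]
  {A : Finset (Irr C)} {B : Finset (Irr D)}

lemma mulComp_apply {c m n h e f : Irr M} (x : TubeComp M A B c h m n)
    (y : TubeComp M A B m n e f) :
    mulComp A B c h m n e f x y = ∑ t : A × B × Irr M × Irr M, ∑ t' : A × B × Irr M × Irr M,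
      expand A B (t.1.1.rep ⊗ t'.1.1.rep) (t'.2.1.1.rep ⊗ t.2.1.1.rep) c h e f
        (stack t.1.1.rep t'.1.1.rep t.2.1.1.rep t'.2.1.1.rep _ _ _ _ _ _
          (toDiag A B c h m n t x) (toDiag A B m n e f t' y)) := by
  simp only [mulComp, LinearMap.sum_apply]
  rfl

lemma tubeMul_apply (x y : TubeOn M A B) :
    tubeMul A B x y = ∑ c, ∑ h, ∑ m, ∑ n, ∑ e, ∑ f,
      emb A B c h e f (mulComp A B c h m n e f (comp A B c h m n x) (comp A B m n e f y)) := by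
  simp only [tubeMul, LinearMap.sum_apply]
  rfl

lemma tubeMul_emb_left {c h m n : Irr M} (x : TubeComp M A B c h m n) (y : TubeOn M A B) :
    tubeMul A B (emb A B c h m n x) y =
      ∑ e, ∑ f, emb A B c h e f (mulComp A B c h m n e f x (comp A B m n e f y)) := by
  rw [tubeMul_apply]
  exact sum_comp_emb (fun c h m n x =>
    ∑ e, ∑ f, emb A B c h e f (mulComp A B c h m n e f x (comp A B m n e f y)))
    (fun c h m n => by simp) x

lemma tubeMul_emb {c h m n e f : Irr M} (x : TubeComp M A B c h m n)
    (y : TubeComp M A B m n e f) :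
    tubeMul A B (emb A B c h m n x) (emb A B m n e f y) =
      emb A B c h e f (mulComp A B c h m n e f x y) := by
  rw [tubeMul_emb_left, Fintype.sum_eq_single e, Fintype.sum_eq_single f, comp_emb_self]
  · intro f' hf
    rw [comp_emb_of_ne (by simp [hf]), map_zero, map_zero]
  · intro e' he
    refine Finset.sum_eq_zero fun f' _ => ?_
    rw [comp_emb_of_ne (by simp [he]), map_zero, map_zero]

lemma tubeMul_emb_of_ne {c h m n m' n' e f : Irr M} (hmn : (m, n) ≠ (m', n'))
    (x : TubeComp M A B c h m n) (y : TubeComp M A B m' n' e f) :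
    tubeMul A B (emb A B c h m n x) (emb A B m' n' e f y) = 0 := by
  rw [tubeMul_emb_left]
  refine Finset.sum_eq_zero fun e' _ => Finset.sum_eq_zero fun f' _ => ?_
  rw [comp_emb_of_ne (by simp_all), map_zero, map_zero]

lemma tubeMul_gen_of_ne {c h m n m' n' e f : Irr M} (hmn : (m, n) ≠ (m', n'))
    {X X' : C} {Y Y' : D} (x : Diag X Y c.rep m.rep n.rep h.rep)
    (x' : Diag X' Y' m'.rep e.rep f.rep n'.rep) :
    tubeMul A B (gen A B X Y c h m n x) (gen A B X' Y' m' n' e f x') = 0 :=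
  tubeMul_emb_of_ne hmn _ _

variable [Limits.HasKernels C] [Limits.HasKernels D]

section

variable {c m n h e f : Irr M}

lemma slideInvariant_stack_left {X' : C} {Y' : D} (x' : Diag X' Y' m.rep e.rep f.rep n.rep) :
    SlideInvariant fun (X : C) (Y : D) => expand A B (X ⊗ X') (Y' ⊗ Y) c h e f ∘ₗ
      (stack X X' Y Y' c.rep m.rep n.rep h.rep e.rep f.rep).flip x' where
  slide {X X₁ Y Y₁} φ ψ u v := by
    simp only [LinearMap.comp_apply, LinearMap.flip_apply]
    induction x' using TensorProduct.induction_on with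
    | zero => simp
    | add x y hx hy => simp only [map_add, hx, hy]
    | tmul u' v' =>
      simp only [stack_tmul, Category.assoc]
      rw [reassoc_of% arcMap_naturality, ← Category.assoc (stackIso _ _ _ _ _).inv,
        stackIso_inv_naturality_outer, Category.assoc, expand_slide]
      simp only [Category.assoc, ← stackIso_hom_naturality_outer, reassoc_of% arcMap_naturality]

lemma slideInvariant_stack_right {X : C} {Y : D} (x : Diag X Y c.rep m.rep n.rep h.rep) :
    SlideInvariant fun (X' : C) (Y' : D) => expand A B (X ⊗ X') (Y' ⊗ Y) c h e f ∘ₗ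
      stack X X' Y Y' c.rep m.rep n.rep h.rep e.rep f.rep x where
  slide {X' X₁ Y' Y₁} φ ψ u' v' := by
    simp only [LinearMap.comp_apply]
    induction x using TensorProduct.induction_on with
    | zero => simp
    | add x y hx hy => simp only [map_add, LinearMap.add_apply, hx, hy]
    | tmul u v =>
      simp only [stack_tmul, Category.assoc, MonoidalLeftAction.actionHomRight_comp,
        MonoidalRightAction.comp_actionHomLeft, stackIso_hom_naturality_inner]
      rw [← Category.assoc (stackIso _ _ _ _ _).inv, stackIso_inv_naturality_inner,
        Category.assoc, expand_slide]
      simp only [Category.assoc]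

lemma mulComp_expand {X X' : C} {Y Y' : D} (hX : LabelsIn A X) (hY : LabelsIn B Y)
    (hX' : LabelsIn A X') (hY' : LabelsIn B Y') (x : Diag X Y c.rep m.rep n.rep h.rep)
    (x' : Diag X' Y' m.rep e.rep f.rep n.rep) :
    mulComp A B c h m n e f (expand A B X Y c h m n x) (expand A B X' Y' m n e f x') =
      expand A B (X ⊗ X') (Y' ⊗ Y) c h e f (stack X X' Y Y' _ _ _ _ _ _ x x') := by
  rw [mulComp_apply]
  refine (Finset.sum_congr rfl fun t _ =>
    (slideInvariant_stack_right (A := A) (B := B) _).sum_toDiag_expand hX' hY' x').trans ?_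
  exact (slideInvariant_stack_left (A := A) (B := B) x').sum_toDiag_expand hX hY x

end

lemma tubeMul_gen {c h m n e f : Irr M} {X X' : C} {Y Y' : D}
    (hX : LabelsIn A X) (hY : LabelsIn B Y)
    (hX' : LabelsIn A X') (hY' : LabelsIn B Y') (x : Diag X Y c.rep m.rep n.rep h.rep)
    (x' : Diag X' Y' m.rep e.rep f.rep n.rep) :
    tubeMul A B (gen A B X Y c h m n x) (gen A B X' Y' m n e f x') =
      gen A B (X ⊗ X') (Y' ⊗ Y) c h e f (stack X X' Y Y' _ _ _ _ _ _ x x') := by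
  simp only [gen, LinearMap.comp_apply, tubeMul_emb, mulComp_expand hX hY hX' hY']

lemma tubeMul_gen_allLabels {c h m n e f : Irr M} {X X' : C} {Y Y' : D}
    (x : Diag X Y c.rep m.rep n.rep h.rep) (x' : Diag X' Y' m.rep e.rep f.rep n.rep) :
    tubeMul (allLabels C) (allLabels D) (gen _ _ X Y c h m n x) (gen _ _ X' Y' m n e f x') =
      gen _ _ (X ⊗ X') (Y' ⊗ Y) c h e f (stack X X' Y Y' _ _ _ _ _ _ x x') :=
  tubeMul_gen (labelsIn_univ _) (labelsIn_univ _) (labelsIn_univ _) (labelsIn_univ _) x x'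

lemma gen_stack_assoc {c h m n p q e f : Irr M} {X X' X'' : C} {Y Y' Y'' : D}
    (u : c.rep ⟶ (X ⊙ₗ m.rep) ⊙ᵣ Y) (v : (X ⊙ₗ n.rep) ⊙ᵣ Y ⟶ h.rep)
    (u' : m.rep ⟶ (X' ⊙ₗ p.rep) ⊙ᵣ Y') (v' : (X' ⊙ₗ q.rep) ⊙ᵣ Y' ⟶ n.rep)
    (u'' : p.rep ⟶ (X'' ⊙ₗ e.rep) ⊙ᵣ Y'') (v'' : (X'' ⊙ₗ f.rep) ⊙ᵣ Y'' ⟶ q.rep) :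
    gen A B _ _ c h e f (stack _ _ _ _ _ _ _ _ _ _
        (stack _ _ _ _ _ _ _ _ _ _ (u ⊗ₜ v) (u' ⊗ₜ v')) (u'' ⊗ₜ v'')) =
      gen A B _ _ c h e f (stack _ _ _ _ _ _ _ _ _ _
        (u ⊗ₜ v) (stack _ _ _ _ _ _ _ _ _ _ (u' ⊗ₜ v') (u'' ⊗ₜ v''))) := by
  have slide_assoc := (slideInvariant_gen (A := A) (B := B) c h e f).slide
    (α_ X X' X'').hom (α_ Y'' Y' Y).inv
  have stack_inv_assoc : (stackIso (X ⊗ X') X'' (Y' ⊗ Y) Y'' f.rep).inv ≫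
      (stackIso X X' Y Y' ((X'' ⊙ₗ f.rep) ⊙ᵣ Y'')).inv =
      arcMap (α_ X X' X'').hom (α_ Y'' Y' Y).inv f.rep ≫
        (stackIso X (X' ⊗ X'') Y (Y'' ⊗ Y') f.rep).inv ≫
        (X ⊴ₗ (stackIso X' X'' Y' Y'' f.rep).inv) ⊵ᵣ Y := by
    rw [Iso.inv_comp_eq, ← cancel_epi (stackIso X X' Y Y' ((X'' ⊙ₗ f.rep) ⊙ᵣ Y'')).hom,
      reassoc_of% stackIso_hom_assoc]
    simp [← MonoidalRightAction.comp_actionHomLeft, ← MonoidalLeftAction.actionHomRight_comp]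
  simp only [stack_tmul, Category.assoc, MonoidalLeftAction.actionHomRight_comp,
    MonoidalRightAction.comp_actionHomLeft, ← reassoc_of% stackIso_hom_naturality_strand,
    reassoc_of% stackIso_inv_naturality_strand, reassoc_of% stack_inv_assoc, slide_assoc,
    stackIso_hom_assoc]

lemma gen_stack_unitDiag_left {X : C} {Y : D} {c h e f : Irr M}
    (u : c.rep ⟶ (X ⊙ₗ e.rep) ⊙ᵣ Y) (v : (X ⊙ₗ f.rep) ⊙ᵣ Y ⟶ h.rep) :
    gen A B _ _ c h e f (stack _ _ _ _ _ _ _ _ _ _ (unitDiag C D c.rep h.rep) (u ⊗ₜ v)) =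
      gen A B X Y c h e f (u ⊗ₜ v) := by
  have slide_unit := (slideInvariant_gen (A := A) (B := B) c h e f).slide (λ_ X).hom (ρ_ Y).hom
  have unit_naturality {m m' : M} (g : m ⟶ m') :
      (𝟙_ C ⊴ₗ g) ⊵ᵣ 𝟙_ D ≫ (ρᵣ[D] _).hom ≫ (λₗ[C] _).hom =
        (ρᵣ[D] _).hom ≫ (λₗ[C] _).hom ≫ g := by
    rw [← MonoidalRightAction.actionUnitIso_hom_naturality_assoc,
      MonoidalLeftAction.actionUnitIso_hom_naturality]
  simp only [unitDiag, stack_tmul, Category.assoc, unit_naturality]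
  rw [← Category.assoc (ρᵣ[D] _).hom, ← stackIso_hom_outer_unit, Category.assoc,
    Iso.inv_hom_id_assoc, slide_unit]
  simp only [Category.assoc, stackIso_hom_outer_unit, unit_naturality, Iso.inv_hom_id_assoc]

lemma gen_stack_unitDiag_right {X : C} {Y : D} {c h e f : Irr M}
    (u : c.rep ⟶ (X ⊙ₗ e.rep) ⊙ᵣ Y) (v : (X ⊙ₗ f.rep) ⊙ᵣ Y ⟶ h.rep) :
    gen A B _ _ c h e f (stack _ _ _ _ _ _ _ _ _ _ (u ⊗ₜ v) (unitDiag C D e.rep f.rep)) =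
      gen A B X Y c h e f (u ⊗ₜ v) := by
  have slide_unit := (slideInvariant_gen (A := A) (B := B) c h e f).slide (ρ_ X).hom (λ_ Y).hom
  simp only [unitDiag, stack_tmul]
  rw [← stackIso_hom_inner_unit, Category.assoc, Iso.inv_hom_id_assoc, slide_unit]
  simp only [Category.assoc, stackIso_hom_inner_unit, ← MonoidalRightAction.comp_actionHomLeft,
    ← MonoidalLeftAction.actionHomRight_comp, Iso.inv_hom_id_assoc, Iso.inv_hom_id]
  simp

variable [Limits.HasKernels M]

theorem tubeMul_assoc (hA : FusionClosed A) (hB : FusionClosed B) (x y z : TubeOn M A B) :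
    tubeMul A B (tubeMul A B x y) z = tubeMul A B x (tubeMul A B y z) := by
  induction x using tubeOn_induction with
  | zero => simp
  | add x x' hx hx' => simp only [map_add, LinearMap.add_apply, hx, hx']
  | gen a ha b hb c h m n u v =>
  induction y using tubeOn_induction with
  | zero => simp
  | add x x' hx hx' => simp only [map_add, LinearMap.add_apply, hx, hx']
  | gen a' ha' b' hb' m' n' p q u' v' =>
  induction z using tubeOn_induction with
  | zero => simp
  | add x x' hx hx' => simp only [map_add, hx, hx']
  | gen a'' ha'' b'' hb'' p' q' e f u'' v'' =>
  have outer := hA.tensor a ha a' ha'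
  have outer' := hB.tensor b' hb' b hb
  have inner := hA.tensor a' ha' a'' ha''
  have inner' := hB.tensor b'' hb'' b' hb'
  replace ha := labelsIn_rep ha
  replace hb := labelsIn_rep hb
  replace ha' := labelsIn_rep ha'
  replace hb' := labelsIn_rep hb'
  replace ha'' := labelsIn_rep ha''
  replace hb'' := labelsIn_rep hb''
  by_cases hmn : (m, n) = (m', n') <;> by_cases hpq : (p, q) = (p', q')
  · cases hmn
    cases hpq
    rw [tubeMul_gen ha hb ha' hb', tubeMul_gen outer outer' ha'' hb'', gen_stack_assoc,
      tubeMul_gen ha' hb' ha'' hb'', tubeMul_gen ha hb inner inner']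
  · cases hmn
    rw [tubeMul_gen ha hb ha' hb', tubeMul_gen_of_ne hpq, tubeMul_gen_of_ne hpq, map_zero]
  · cases hpq
    rw [tubeMul_gen ha' hb' ha'' hb'', tubeMul_gen_of_ne hmn, tubeMul_gen_of_ne hmn, map_zero,
      LinearMap.zero_apply]
  · rw [tubeMul_gen_of_ne hmn, tubeMul_gen_of_ne hpq, map_zero, map_zero, LinearMap.zero_apply]

theorem tubeOne_mul (hA : LabelsIn A (𝟙_ C)) (hB : LabelsIn B (𝟙_ D)) (x : TubeOn M A B) :
    tubeMul A B (tubeOne A B) x = x := by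
  induction x using tubeOn_induction with
  | zero => simp
  | add x x' hx hx' => simp only [map_add, hx, hx']
  | gen a ha b hb c h e f u v =>
  simp only [tubeOne_eq, map_sum, LinearMap.sum_apply]
  rw [Fintype.sum_eq_single c, Fintype.sum_eq_single h,
    tubeMul_gen hA hB (labelsIn_rep ha) (labelsIn_rep hb), gen_stack_unitDiag_left]
  · exact fun h' hh => tubeMul_gen_of_ne (by simp [hh]) _ _
  · exact fun c' hc => Finset.sum_eq_zero fun h' _ => tubeMul_gen_of_ne (by simp [hc]) _ _

theorem tubeMul_one (hA : LabelsIn A (𝟙_ C)) (hB : LabelsIn B (𝟙_ D)) (x : TubeOn M A B) :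
    tubeMul A B x (tubeOne A B) = x := by
  induction x using tubeOn_induction with
  | zero => simp
  | add x x' hx hx' => simp only [map_add, LinearMap.add_apply, hx, hx']
  | gen a ha b hb c h e f u v =>
  simp only [tubeOne_eq, map_sum]
  rw [Fintype.sum_eq_single e, Fintype.sum_eq_single f,
    tubeMul_gen (labelsIn_rep ha) (labelsIn_rep hb) hA hB, gen_stack_unitDiag_right]
  · exact fun h' hh => tubeMul_gen_of_ne (by simp [Ne.symm hh]) _ _
  · exact fun c' hc => Finset.sum_eq_zero fun h' _ => tubeMul_gen_of_ne (by simp [Ne.symm hc]) _ _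

theorem inclTube_mul (hA : FusionClosed A) (hB : FusionClosed B) (x y : TubeOn M A B) :
    inclTube A B (tubeMul A B x y) =
      tubeMul (allLabels C) (allLabels D) (inclTube A B x) (inclTube A B y) := by
  induction x using tubeOn_induction with
  | zero => simp
  | add x x' hx hx' => simp only [map_add, LinearMap.add_apply, hx, hx']
  | gen a ha b hb c h m n u v =>
  induction y using tubeOn_induction with
  | zero => simp
  | add x x' hx hx' => simp only [map_add, hx, hx']
  | gen a' ha' b' hb' m' n' e f u' v' =>
  rw [inclTube_gen (labelsIn_rep ha) (labelsIn_rep hb),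
    inclTube_gen (labelsIn_rep ha') (labelsIn_rep hb')]
  by_cases hmn : (m, n) = (m', n')
  · cases hmn
    rw [tubeMul_gen (labelsIn_rep ha) (labelsIn_rep hb) (labelsIn_rep ha') (labelsIn_rep hb'),
      tubeMul_gen_allLabels, inclTube_gen (hA.tensor _ ha _ ha') (hB.tensor _ hb' _ hb)]
  · rw [tubeMul_gen_of_ne hmn, tubeMul_gen_of_ne hmn, map_zero]

end Product

/-! ### The coproduct of tube diagrams -/

section Coproduct

variable {C D M : Type*} [Category* C] [Category* D] [Category* M]
  [Preadditive C] [Preadditive D] [Preadditive M] [Linear ℂ M]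
  [MonoidalCategory C] [MonoidalCategory D] [MonoidalLeftAction C M] [MonoidalRightAction D M]

lemma actionHom_sum [Linear ℂ C] [Linear ℂ D] [LinearLeftAction C M] [LinearRightAction D M]
    {ι : Type*} (s : Finset ι) (X : C) (Y : D) {m m' : M} (g : ι → (m ⟶ m')) :
    (X ⊴ₗ (∑ i ∈ s, g i)) ⊵ᵣ Y = ∑ i ∈ s, (X ⊴ₗ g i) ⊵ᵣ Y :=
  map_sum (IsLinearMap.mk' (R := ℂ) (fun g : m ⟶ m' => (X ⊴ₗ g) ⊵ᵣ Y)
    ⟨fun g g' => by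
      rw [LinearLeftAction.actionHomRight_add, LinearRightAction.add_actionHomLeft],
      fun r g => by
      rw [LinearLeftAction.actionHomRight_smul, LinearRightAction.smul_actionHomLeft]⟩) g s

variable [IsFiniteSemisimple M] {A : Finset (Irr C)} {B : Finset (Irr D)}

/-- The coproduct on a single vertex space. -/
def cellComul (c h e f : Irr M) (t : A × B × Irr M × Irr M) :
    Cell t.1.1.rep t.2.1.1.rep c.rep t.2.2.1.rep e.rep f.rep t.2.2.2.rep h.rep →ₗ[ℂ]
      TubeOn M A B ⊗[ℂ] TubeOn M A B :=
  ∑ i : Irr M,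
  ∑ p : Fin (dec (t.1.1.rep ⊙ₗ i.rep)).n,
  ∑ q : Fin (dec (((dec (t.1.1.rep ⊙ₗ i.rep)).s p).rep ⊙ᵣ t.2.1.1.rep)).n,
    TensorProduct.map
      (emb A B ((dec (((dec (t.1.1.rep ⊙ₗ i.rep)).s p).rep ⊙ᵣ t.2.1.1.rep)).s q) h i f ∘ₗ
        cellEmb A B ((dec (((dec (t.1.1.rep ⊙ₗ i.rep)).s p).rep ⊙ᵣ t.2.1.1.rep)).s q) h i f
          (t.1, t.2.1, (dec (t.1.1.rep ⊙ₗ i.rep)).s p, t.2.2.2) ∘ₗ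
        TensorProduct.mk ℂ _ _
          ((dec (((dec (t.1.1.rep ⊙ₗ i.rep)).s p).rep ⊙ᵣ t.2.1.1.rep)).incl q ⊗ₜ
            (dec (t.1.1.rep ⊙ₗ i.rep)).incl p))
      (emb A B c ((dec (((dec (t.1.1.rep ⊙ₗ i.rep)).s p).rep ⊙ᵣ t.2.1.1.rep)).s q) e i ∘ₗ
        cellEmb A B c ((dec (((dec (t.1.1.rep ⊙ₗ i.rep)).s p).rep ⊙ᵣ t.2.1.1.rep)).s q) e i
          (t.1, t.2.1, t.2.2.1, (dec (t.1.1.rep ⊙ₗ i.rep)).s p) ∘ₗ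
        (TensorProduct.mk ℂ _ _).flip
          ((dec (((dec (t.1.1.rep ⊙ₗ i.rep)).s p).rep ⊙ᵣ t.2.1.1.rep)).proj q ⊗ₜ
            (dec (t.1.1.rep ⊙ₗ i.rep)).proj p)) ∘ₗ
    (TensorProduct.comm ℂ _ _).toLinearMap

lemma tubeComul_apply (x : TubeOn M A B) :
    tubeComul A B x = ∑ c, ∑ h, ∑ e, ∑ f, ∑ t,
      cellComul c h e f t (coeff A B c h e f t (comp A B c h e f x)) := by
  simp only [tubeComul, cellComul, LinearMap.sum_apply]
  rfl

lemma tubeComul_emb {c h e f : Irr M} (x : TubeComp M A B c h e f) :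
    tubeComul A B (emb A B c h e f x) = ∑ t, cellComul c h e f t (coeff A B c h e f t x) := by
  rw [tubeComul_apply]
  exact sum_comp_emb (fun c h e f x => ∑ t, cellComul c h e f t (coeff A B c h e f t x))
    (fun c h e f => by simp) x

lemma cellComul_tmul {c h e f : Irr M} (t : A × B × Irr M × Irr M)
    (x : (c.rep ⟶ t.2.2.1.rep ⊙ᵣ t.2.1.1.rep) ⊗[ℂ] (t.2.2.1.rep ⟶ t.1.1.rep ⊙ₗ e.rep))
    (y : (t.2.2.2.rep ⊙ᵣ t.2.1.1.rep ⟶ h.rep) ⊗[ℂ] (t.1.1.rep ⊙ₗ f.rep ⟶ t.2.2.2.rep)) :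
    cellComul c h e f t (x ⊗ₜ y) =
      ∑ i : Irr M,
      ∑ p : Fin (dec (t.1.1.rep ⊙ₗ i.rep)).n,
      ∑ q : Fin (dec (((dec (t.1.1.rep ⊙ₗ i.rep)).s p).rep ⊙ᵣ t.2.1.1.rep)).n,
        emb A B ((dec (((dec (t.1.1.rep ⊙ₗ i.rep)).s p).rep ⊙ᵣ t.2.1.1.rep)).s q) h i f
          (cellEmb A B ((dec (((dec (t.1.1.rep ⊙ₗ i.rep)).s p).rep ⊙ᵣ t.2.1.1.rep)).s q) h i f
            (t.1, t.2.1, (dec (t.1.1.rep ⊙ₗ i.rep)).s p, t.2.2.2)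
            (((dec (((dec (t.1.1.rep ⊙ₗ i.rep)).s p).rep ⊙ᵣ t.2.1.1.rep)).incl q ⊗ₜ
              (dec (t.1.1.rep ⊙ₗ i.rep)).incl p) ⊗ₜ y)) ⊗ₜ
        emb A B c ((dec (((dec (t.1.1.rep ⊙ₗ i.rep)).s p).rep ⊙ᵣ t.2.1.1.rep)).s q) e i
          (cellEmb A B c ((dec (((dec (t.1.1.rep ⊙ₗ i.rep)).s p).rep ⊙ᵣ t.2.1.1.rep)).s q) e i
            (t.1, t.2.1, t.2.2.1, (dec (t.1.1.rep ⊙ₗ i.rep)).s p)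
            (x ⊗ₜ ((dec (((dec (t.1.1.rep ⊙ₗ i.rep)).s p).rep ⊙ᵣ t.2.1.1.rep)).proj q ⊗ₜ
              (dec (t.1.1.rep ⊙ₗ i.rep)).proj p))) := by
  simp only [cellComul, LinearMap.sum_apply]
  rfl

variable [Linear ℂ C] [Linear ℂ D] [IsFiniteSemisimple C] [IsFiniteSemisimple D]

lemma map_inclTube_cellComul {c h e f : Irr M} (t : A × B × Irr M × Irr M)
    (z : Cell t.1.1.rep t.2.1.1.rep c.rep t.2.2.1.rep e.rep f.rep t.2.2.2.rep h.rep) :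
    TensorProduct.map (inclTube A B) (inclTube A B) (cellComul c h e f t z) =
      cellComul (A := allLabels C) (B := allLabels D) c h e f
        (⟨t.1.1, Finset.mem_univ _⟩, ⟨t.2.1.1, Finset.mem_univ _⟩, t.2.2.1, t.2.2.2) z := by
  induction z using TensorProduct.induction_on with
  | zero => exact (congrArg _ (map_zero _)).trans ((map_zero _).trans (map_zero _).symm)
  | add x y hx hy =>
    exact (congrArg _ (map_add _ x y)).trans
      ((map_add _ _ _).trans ((congrArg₂ _ hx hy).trans (map_add _ x y).symm))
  | tmul x y =>
    refine Eq.trans ?_ (cellComul_tmul (A := allLabels C) (B := allLabels D)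
      (⟨t.1.1, Finset.mem_univ _⟩, ⟨t.2.1.1, Finset.mem_univ _⟩, t.2.2.1, t.2.2.2) x y).symm
    simp only [cellComul_tmul, map_sum, TensorProduct.map_tmul]
    exact Finset.sum_congr rfl fun i _ => Finset.sum_congr rfl fun p _ =>
      Finset.sum_congr rfl fun q _ => congrArg₂ (· ⊗ₜ[ℂ] ·) (inclTube_emb_cellEmb _ _)
        (inclTube_emb_cellEmb _ _)

theorem map_inclTube_tubeComul (x : TubeOn M A B) :
    TensorProduct.map (inclTube A B) (inclTube A B) (tubeComul A B x) =
      tubeComul (allLabels C) (allLabels D) (inclTube A B x) := by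
  rw [← sum_emb_comp x]
  simp only [map_sum, tubeComul_emb]
  refine Finset.sum_congr rfl fun c _ => Finset.sum_congr rfl fun h _ =>
    Finset.sum_congr rfl fun e _ => Finset.sum_congr rfl fun f _ => ?_
  rw [inclTube_emb, map_sum]
  refine Finset.sum_congr rfl fun t _ => ?_
  rw [map_inclTube_cellComul, tubeComul_emb]
  exact (sum_coeff_cellEmb (A := allLabels C) (B := allLabels D)
    (fun t z => cellComul c h e f t z) (fun t => map_zero _)
    (⟨t.1.1, Finset.mem_univ _⟩, ⟨t.2.1.1, Finset.mem_univ _⟩, t.2.2.1, t.2.2.2) _).symm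

variable (A B) in
/-- The coproduct of a diagram with arbitrary arcs. -/
def diagComul (X : C) (Y : D) (c h e f : Irr M) :
    Diag X Y c.rep e.rep f.rep h.rep →ₗ[ℂ] TubeOn M A B ⊗[ℂ] TubeOn M A B :=
  ∑ i : Irr M, ∑ q : Fin (dec ((X ⊙ₗ i.rep) ⊙ᵣ Y)).n,
    TensorProduct.map
      (gen A B X Y ((dec ((X ⊙ₗ i.rep) ⊙ᵣ Y)).s q) h i f ∘ₗ
        TensorProduct.mk ℂ _ _ ((dec ((X ⊙ₗ i.rep) ⊙ᵣ Y)).incl q))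
      (gen A B X Y c ((dec ((X ⊙ₗ i.rep) ⊙ᵣ Y)).s q) e i ∘ₗ
        (TensorProduct.mk ℂ _ _).flip ((dec ((X ⊙ₗ i.rep) ⊙ᵣ Y)).proj q)) ∘ₗ
    (TensorProduct.comm ℂ _ _).toLinearMap

lemma diagComul_tmul (X : C) (Y : D) {c h e f : Irr M} (u : c.rep ⟶ (X ⊙ₗ e.rep) ⊙ᵣ Y)
    (v : (X ⊙ₗ f.rep) ⊙ᵣ Y ⟶ h.rep) :
    diagComul A B X Y c h e f (u ⊗ₜ v) =
      ∑ i : Irr M, ∑ q : Fin (dec ((X ⊙ₗ i.rep) ⊙ᵣ Y)).n,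
        gen A B X Y ((dec ((X ⊙ₗ i.rep) ⊙ᵣ Y)).s q) h i f
          ((dec ((X ⊙ₗ i.rep) ⊙ᵣ Y)).incl q ⊗ₜ v) ⊗ₜ
        gen A B X Y c ((dec ((X ⊙ₗ i.rep) ⊙ᵣ Y)).s q) e i
          (u ⊗ₜ (dec ((X ⊙ₗ i.rep) ⊙ᵣ Y)).proj q) := by
  simp only [diagComul, LinearMap.sum_apply]
  rfl

/-- The summation over a pair of strands `k` of which `diagComul` is built; `α`, `β` are arbitrary
morphisms in place of dual bases. -/
def cutMap {X X' : C} {Y Y' : D} {Z W : M} {c h e f i i' : Irr M}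
    (x : W ⟶ (X ⊙ₗ i.rep) ⊙ᵣ Y) (v : (X ⊙ₗ f.rep) ⊙ᵣ Y ⟶ h.rep)
    (u : c.rep ⟶ (X' ⊙ₗ e.rep) ⊙ᵣ Y') (y : (X' ⊙ₗ i'.rep) ⊙ᵣ Y' ⟶ Z) (k : Irr M) :
    (Z ⟶ k.rep) →ₗ[ℂ] (k.rep ⟶ W) →ₗ[ℂ] TubeOn M A B ⊗[ℂ] TubeOn M A B :=
  LinearMap.mk₂ ℂ (fun α β => gen A B X Y k h i f ((β ≫ x) ⊗ₜ v) ⊗ₜ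
      gen A B X' Y' c k e i' (u ⊗ₜ (y ≫ α)))
    (by intros; simp only [Preadditive.comp_add, tmul_add, map_add])
    (by intros; simp only [Linear.comp_smul, tmul_smul, map_smul])
    (by intros; simp only [Preadditive.add_comp, add_tmul, map_add])
    (by intros; simp only [Linear.smul_comp, ← smul_tmul', map_smul])

variable [Limits.HasKernels M]

lemma sum_cutMap_slide {X X' : C} {Y Y' : D} {Z W : M} {c h e f i i' : Irr M} (g : Z ⟶ W)
    (x : W ⟶ (X ⊙ₗ i.rep) ⊙ᵣ Y) (v : (X ⊙ₗ f.rep) ⊙ᵣ Y ⟶ h.rep)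
    (u : c.rep ⟶ (X' ⊙ₗ e.rep) ⊙ᵣ Y') (y : (X' ⊙ₗ i'.rep) ⊙ᵣ Y' ⟶ Z) :
    ∑ q, gen A B X Y ((dec Z).s q) h i f (((dec Z).incl q ≫ g ≫ x) ⊗ₜ v) ⊗ₜ[ℂ]
        gen A B X' Y' c ((dec Z).s q) e i' (u ⊗ₜ (y ≫ (dec Z).proj q)) =
      ∑ q, gen A B X Y ((dec W).s q) h i f (((dec W).incl q ≫ x) ⊗ₜ v) ⊗ₜ[ℂ]
        gen A B X' Y' c ((dec W).s q) e i' (u ⊗ₜ (y ≫ g ≫ (dec W).proj q)) := by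
  simpa only [cutMap, LinearMap.mk₂_apply, Category.assoc] using
    sum_dec_slide g (cutMap (A := A) (B := B) x v u y)

variable [LinearLeftAction C M] [LinearRightAction D M]

lemma sum_gen_stack_cut [BimoduleCategory C D M] {X X' : C} {Y Y' : D}
    {c h m n e f : Irr M} (i : Irr M)
    (u : c.rep ⟶ (X ⊙ₗ m.rep) ⊙ᵣ Y) (v : (X ⊙ₗ n.rep) ⊙ᵣ Y ⟶ h.rep)
    (u' : m.rep ⟶ (X' ⊙ₗ e.rep) ⊙ᵣ Y') (v' : (X' ⊙ₗ f.rep) ⊙ᵣ Y' ⟶ n.rep) :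
    ∑ q, ∑ p,
      gen A B (X ⊗ X') (Y' ⊗ Y) ((dec ((X ⊙ₗ ((dec ((X' ⊙ₗ i.rep) ⊙ᵣ Y')).s q).rep) ⊙ᵣ Y)).s p)
          h i f (stack _ _ _ _ _ _ _ _ _ _
            ((dec ((X ⊙ₗ ((dec ((X' ⊙ₗ i.rep) ⊙ᵣ Y')).s q).rep) ⊙ᵣ Y)).incl p ⊗ₜ v)
            ((dec ((X' ⊙ₗ i.rep) ⊙ᵣ Y')).incl q ⊗ₜ v')) ⊗ₜ[ℂ]
        gen A B (X ⊗ X') (Y' ⊗ Y) c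
          ((dec ((X ⊙ₗ ((dec ((X' ⊙ₗ i.rep) ⊙ᵣ Y')).s q).rep) ⊙ᵣ Y)).s p) e i
          (stack _ _ _ _ _ _ _ _ _ _
            (u ⊗ₜ (dec ((X ⊙ₗ ((dec ((X' ⊙ₗ i.rep) ⊙ᵣ Y')).s q).rep) ⊙ᵣ Y)).proj p)
            (u' ⊗ₜ (dec ((X' ⊙ₗ i.rep) ⊙ᵣ Y')).proj q)) =
      ∑ k, gen A B (X ⊗ X') (Y' ⊗ Y) ((dec (((X ⊗ X') ⊙ₗ i.rep) ⊙ᵣ Y' ⊗ Y)).s k) h i f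
          ((dec (((X ⊗ X') ⊙ₗ i.rep) ⊙ᵣ Y' ⊗ Y)).incl k ⊗ₜ
            ((stackIso X X' Y Y' f.rep).inv ≫ (X ⊴ₗ v') ⊵ᵣ Y ≫ v)) ⊗ₜ[ℂ]
        gen A B (X ⊗ X') (Y' ⊗ Y) c ((dec (((X ⊗ X') ⊙ₗ i.rep) ⊙ᵣ Y' ⊗ Y)).s k) e i
          ((u ≫ (X ⊴ₗ u') ⊵ᵣ Y ≫ (stackIso X X' Y Y' e.rep).hom) ⊗ₜ
            (dec (((X ⊗ X') ⊙ₗ i.rep) ⊙ᵣ Y' ⊗ Y)).proj k) := by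
  have slide_incl (q) := sum_cutMap_slide (A := A) (B := B)
    ((X ⊴ₗ (dec ((X' ⊙ₗ i.rep) ⊙ᵣ Y')).incl q) ⊵ᵣ Y ≫ (stackIso X X' Y Y' i.rep).hom) (𝟙 _)
    ((stackIso X X' Y Y' f.rep).inv ≫ (X ⊴ₗ v') ⊵ᵣ Y ≫ v)
    (u ≫ (X ⊴ₗ u') ⊵ᵣ Y ≫ (stackIso X X' Y Y' e.rep).hom)
    ((stackIso X X' Y Y' i.rep).inv ≫ (X ⊴ₗ (dec ((X' ⊙ₗ i.rep) ⊙ᵣ Y')).proj q) ⊵ᵣ Y)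
  simp only [Category.comp_id, Category.assoc] at slide_incl
  simp only [stack_tmul, slide_incl]
  rw [Finset.sum_comm]
  refine Finset.sum_congr rfl fun k _ => ?_
  rw [← tmul_sum, ← map_sum, ← tmul_sum]
  simp only [← Preadditive.comp_sum, ← Preadditive.sum_comp, ← Category.assoc,
    ← MonoidalRightAction.comp_actionHomLeft, ← MonoidalLeftAction.actionHomRight_comp,
    ← actionHom_sum, SimpleDecomp.sum_proj_incl, MonoidalLeftAction.actionHomRight_id,
    MonoidalRightAction.id_actionHomLeft, Category.comp_id, Iso.inv_hom_id, Category.id_comp]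

variable [Limits.HasKernels C] [Limits.HasKernels D]

lemma slideInvariant_diagComul (c h e f : Irr M) :
    SlideInvariant fun (X : C) (Y : D) => diagComul A B X Y c h e f where
  slide {X X' Y Y'} φ ψ u v := by
    simp only [diagComul_tmul, (slideInvariant_gen _ _ _ _).slide]
    refine Finset.sum_congr rfl fun i _ => ?_
    simpa only [Category.comp_id, Category.id_comp, (slideInvariant_gen _ _ _ _).slide] using
      sum_cutMap_slide (A := A) (B := B) (arcMap φ ψ i.rep) (𝟙 _) v u (𝟙 _)

lemma emb_cellEmb {c h e f : Irr M} (t : A × B × Irr M × Irr M)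
    (z : Cell t.1.1.rep t.2.1.1.rep c.rep t.2.2.1.rep e.rep f.rep t.2.2.2.rep h.rep) :
    emb A B c h e f (cellEmb A B c h e f t z) =
      gen A B t.1.1.rep t.2.1.1.rep c h e f (assemble _ _ _ _ _ _ _ _ z) := by
  rw [gen, LinearMap.comp_apply, expand_assemble]

lemma cellComul_eq_sum_gen {a : Irr C} {b : Irr D} (ha : a ∈ A) (hb : b ∈ B)
    {c d e f g h : Irr M} (μ : c.rep ⟶ d.rep ⊙ᵣ b.rep) (ν : d.rep ⟶ a.rep ⊙ₗ e.rep)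
    (γ : g.rep ⊙ᵣ b.rep ⟶ h.rep) (ζ : a.rep ⊙ₗ f.rep ⟶ g.rep) :
    cellComul (A := A) (B := B) c h e f (⟨a, ha⟩, ⟨b, hb⟩, d, g) ((μ ⊗ₜ ν) ⊗ₜ (γ ⊗ₜ ζ)) =
      ∑ i : Irr M, ∑ p : Fin (dec (a.rep ⊙ₗ i.rep)).n,
      ∑ q : Fin (dec (((dec (a.rep ⊙ₗ i.rep)).s p).rep ⊙ᵣ b.rep)).n,
        gen A B a.rep b.rep ((dec (((dec (a.rep ⊙ₗ i.rep)).s p).rep ⊙ᵣ b.rep)).s q) h i f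
          (((dec (((dec (a.rep ⊙ₗ i.rep)).s p).rep ⊙ᵣ b.rep)).incl q ≫
            (dec (a.rep ⊙ₗ i.rep)).incl p ⊵ᵣ b.rep) ⊗ₜ (ζ ⊵ᵣ b.rep ≫ γ)) ⊗ₜ
        gen A B a.rep b.rep c ((dec (((dec (a.rep ⊙ₗ i.rep)).s p).rep ⊙ᵣ b.rep)).s q) e i
          ((μ ≫ ν ⊵ᵣ b.rep) ⊗ₜ ((dec (a.rep ⊙ₗ i.rep)).proj p ⊵ᵣ b.rep ≫
            (dec (((dec (a.rep ⊙ₗ i.rep)).s p).rep ⊙ᵣ b.rep)).proj q)) := by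
  rw [cellComul_tmul]
  refine Finset.sum_congr rfl fun i _ => Finset.sum_congr rfl fun p _ =>
    Finset.sum_congr rfl fun q _ => ?_
  rw [emb_cellEmb, emb_cellEmb, assemble_tmul, assemble_tmul]

lemma cellComul_eq_diagComul {c h e f : Irr M} (t : A × B × Irr M × Irr M)
    (z : Cell t.1.1.rep t.2.1.1.rep c.rep t.2.2.1.rep e.rep f.rep t.2.2.2.rep h.rep) :
    cellComul c h e f t z =
      diagComul A B t.1.1.rep t.2.1.1.rep c h e f (assemble _ _ _ _ _ _ _ _ z) := by
  obtain ⟨⟨a, ha⟩, ⟨b, hb⟩, d, g⟩ := t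
  refine LinearMap.congr_fun (f := cellComul c h e f (⟨a, ha⟩, ⟨b, hb⟩, d, g))
    (g := diagComul A B a.rep b.rep c h e f ∘ₗ assemble _ _ _ _ _ _ _ _)
    (TensorProduct.ext_fourfold' fun μ ν γ ζ => ?_) z
  rw [cellComul_eq_sum_gen, LinearMap.comp_apply, assemble_tmul, diagComul_tmul]
  refine Finset.sum_congr rfl fun i _ => ?_
  have slide_incl (p) := sum_cutMap_slide (A := A) (B := B) (c := c) (h := h) (e := e) (f := f)
    (i := i) (i' := i) (X := a.rep) (Y := b.rep) (X' := a.rep) (Y' := b.rep)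
    ((dec (a.rep ⊙ₗ i.rep)).incl p ⊵ᵣ b.rep) (𝟙 _) (ζ ⊵ᵣ b.rep ≫ γ) (μ ≫ ν ⊵ᵣ b.rep)
    ((dec (a.rep ⊙ₗ i.rep)).proj p ⊵ᵣ b.rep)
  simp only [Category.comp_id] at slide_incl
  refine (Finset.sum_congr rfl fun p _ => slide_incl p).trans ?_
  rw [Finset.sum_comm]
  refine Finset.sum_congr rfl fun q _ => ?_
  simp only [← tmul_sum, ← map_sum, ← Category.assoc, ← Preadditive.sum_comp,
    ← MonoidalRightAction.comp_actionHomLeft, ← actionHomLeft_sum, SimpleDecomp.sum_proj_incl,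
    MonoidalRightAction.id_actionHomLeft, Category.id_comp]

theorem tubeComul_gen {X : C} {Y : D} (hX : LabelsIn A X) (hY : LabelsIn B Y) {c h e f : Irr M}
    (x : Diag X Y c.rep e.rep f.rep h.rep) :
    tubeComul A B (gen A B X Y c h e f x) = diagComul A B X Y c h e f x := by
  rw [← (slideInvariant_diagComul (A := A) (B := B) c h e f).sum_toDiag_expand hX hY x, gen,
    LinearMap.comp_apply, tubeComul_emb]
  simp only [cellComul_eq_diagComul]
  rfl

variable [BimoduleCategory C D M]

lemma diagComul_stack {X X' : C} {Y Y' : D} {c h m n e f : Irr M}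
    (u : c.rep ⟶ (X ⊙ₗ m.rep) ⊙ᵣ Y) (v : (X ⊙ₗ n.rep) ⊙ᵣ Y ⟶ h.rep)
    (u' : m.rep ⟶ (X' ⊙ₗ e.rep) ⊙ᵣ Y') (v' : (X' ⊙ₗ f.rep) ⊙ᵣ Y' ⟶ n.rep) :
    TensorProduct.map₂ (tubeMul (allLabels C) (allLabels D)) (tubeMul (allLabels C) (allLabels D))
        (diagComul _ _ X Y c h m n (u ⊗ₜ v)) (diagComul _ _ X' Y' m n e f (u' ⊗ₜ v')) =
      diagComul _ _ (X ⊗ X') (Y' ⊗ Y) c h e f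
        (stack _ _ _ _ _ _ _ _ _ _ (u ⊗ₜ v) (u' ⊗ₜ v')) := by
  rw [stack_tmul, diagComul_tmul, diagComul_tmul, diagComul_tmul]
  simp only [map_sum, LinearMap.sum_apply, TensorProduct.map₂_apply_tmul,
    TensorProduct.map_tmul]
  refine Finset.sum_congr rfl fun i _ => ?_
  rw [← sum_gen_stack_cut]
  refine Finset.sum_congr rfl fun q _ => ?_
  rw [Fintype.sum_eq_single ((dec ((X' ⊙ₗ i.rep) ⊙ᵣ Y')).s q)]
  · simp only [tubeMul_gen_allLabels]
  · intro j hj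
    refine Finset.sum_eq_zero fun k _ => ?_
    rw [tubeMul_gen_of_ne (by simp [hj]), zero_tmul]

end Coproduct

/-! ### The counit of tube diagrams -/

section Counit

lemma endScalar_smul_id {M : Type*} [Category* M] [Preadditive M] [Linear ℂ M]
    [Limits.HasKernels M] [IsFiniteSemisimple M] (c : Irr M) (r : ℂ) :
    endScalar c.rep (r • 𝟙 c.rep) = r := by
  have := IsFiniteSemisimple.finiteDimensional_hom c.rep c.rep
  have leftComp_id : Linear.leftComp ℂ c.rep (𝟙 c.rep) = LinearMap.id := by ext; simp
  rw [map_smul]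
  simp only [endScalar, LinearMap.coe_mk, AddHom.coe_mk, leftComp_id, LinearMap.trace_id,
    finrank_endomorphism_simple_eq_one]
  simp

variable {C D M : Type*} [Category* C] [Category* D] [Category* M]
  [Preadditive M] [Linear ℂ M]
  [MonoidalCategory C] [MonoidalCategory D] [MonoidalLeftAction C M] [MonoidalRightAction D M]

/-- The scalar of the endomorphism obtained by closing a diagram with equal edges. -/
def diagCounit (X : C) (Y : D) (c e : Irr M) : Diag X Y c.rep e.rep e.rep c.rep →ₗ[ℂ] ℂ :=
  TensorProduct.lift (LinearMap.mk₂ ℂ (fun u v => endScalar c.rep (u ≫ v))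
    (by intros; simp) (by intros; simp) (by intros; simp) (by intros; simp))

@[simp]
lemma diagCounit_tmul {X : C} {Y : D} {c e : Irr M} (u : c.rep ⟶ (X ⊙ₗ e.rep) ⊙ᵣ Y)
    (v : (X ⊙ₗ e.rep) ⊙ᵣ Y ⟶ c.rep) :
    diagCounit X Y c e (u ⊗ₜ v) = endScalar c.rep (u ≫ v) := rfl

lemma slideInvariant_diagCounit (c e : Irr M) :
    SlideInvariant fun (X : C) (Y : D) => diagCounit X Y c e where
  slide φ ψ u v := by simp

lemma endScalar_comp_actionHomLeft [Preadditive D] [Linear ℂ D] [LinearRightAction D M]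
    [Limits.HasKernels M] [IsFiniteSemisimple M] {m : M} {b : D} {c d : Irr M}
    (μ : c.rep ⟶ d.rep ⊙ᵣ b) (ν : d.rep ⟶ m) (γ : d.rep ⊙ᵣ b ⟶ c.rep) (ζ : m ⟶ d.rep) :
    endScalar c.rep ((μ ≫ ν ⊵ᵣ b) ≫ ζ ⊵ᵣ b ≫ γ) =
      endScalar c.rep (μ ≫ γ) * endScalar d.rep (ν ≫ ζ) := by
  obtain ⟨r, hr⟩ := Irr.exists_smul_id (ν ≫ ζ)
  rw [Category.assoc, ← MonoidalRightAction.comp_actionHomLeft_assoc, hr, endScalar_smul_id,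
    LinearRightAction.smul_actionHomLeft]
  simp [mul_comm]

lemma endScalar_comp_actionHomLeft_of_ne [Preadditive D] [Linear ℂ D] [LinearRightAction D M]
    [Limits.HasKernels M] {m : M} {b : D} {c d g : Irr M} (hdg : d ≠ g) (μ : c.rep ⟶ d.rep ⊙ᵣ b)
    (ν : d.rep ⟶ m) (γ : g.rep ⊙ᵣ b ⟶ c.rep) (ζ : m ⟶ g.rep) :
    endScalar c.rep ((μ ≫ ν ⊵ᵣ b) ≫ ζ ⊵ᵣ b ≫ γ) = 0 := by
  have zero_actionHomLeft : (0 : d.rep ⟶ g.rep) ⊵ᵣ b = 0 := by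
    simpa using LinearRightAction.smul_actionHomLeft (0 : ℂ) (0 : d.rep ⟶ g.rep) b
  rw [Category.assoc, ← MonoidalRightAction.comp_actionHomLeft_assoc,
    Irr.hom_eq_zero hdg (ν ≫ ζ), zero_actionHomLeft]
  simp

variable [Preadditive C] [Preadditive D] [IsFiniteSemisimple M]
  {A : Finset (Irr C)} {B : Finset (Irr D)}

/-- The counit on a single vertex space. -/
def cellCounit (a : Irr C) (b : Irr D) (c d e : Irr M) :
    Cell a.rep b.rep c.rep d.rep e.rep e.rep d.rep c.rep →ₗ[ℂ] ℂ :=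
  LinearMap.mul' ℂ ℂ ∘ₗ
  TensorProduct.map
    (TensorProduct.lift (LinearMap.mk₂ ℂ
      (fun (μ : c.rep ⟶ d.rep ⊙ᵣ b.rep) (γ : d.rep ⊙ᵣ b.rep ⟶ c.rep) =>
        endScalar c.rep (μ ≫ γ))
      (by intros; simp) (by intros; simp) (by intros; simp) (by intros; simp)))
    (TensorProduct.lift (LinearMap.mk₂ ℂ
      (fun (ν : d.rep ⟶ a.rep ⊙ₗ e.rep) (ζ : a.rep ⊙ₗ e.rep ⟶ d.rep) =>
        endScalar d.rep (ν ≫ ζ))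
      (by intros; simp) (by intros; simp) (by intros; simp) (by intros; simp))) ∘ₗ
  (TensorProduct.tensorTensorTensorComm ℂ _ _ _ _).toLinearMap

lemma tubeCounit_apply (x : TubeOn M A B) :
    tubeCounit A B x = ∑ c, ∑ e, ∑ a : A, ∑ b : B, ∑ d,
      cellCounit a.1 b.1 c d e (coeff A B c c e e (a, b, d, d) (comp A B c c e e x)) := by
  simp only [tubeCounit, LinearMap.sum_apply]
  rfl

lemma tubeCounit_emb_of_ne {c h e f : Irr M} (hne : (c, e) ≠ (h, f))
    (x : TubeComp M A B c h e f) : tubeCounit A B (emb A B c h e f x) = 0 := by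
  rw [tubeCounit_apply]
  refine Finset.sum_eq_zero fun c' _ => Finset.sum_eq_zero fun e' _ => ?_
  rw [comp_emb_of_ne (by grind)]
  simp

lemma tubeCounit_gen_of_ne [Linear ℂ C] [Linear ℂ D] [IsFiniteSemisimple C]
    [IsFiniteSemisimple D] {X : C} {Y : D} {c h e f : Irr M} (hne : (c, e) ≠ (h, f))
    (x : Diag X Y c.rep e.rep f.rep h.rep) :
    tubeCounit A B (gen A B X Y c h e f x) = 0 :=
  tubeCounit_emb_of_ne hne _

lemma tubeCounit_emb {c e : Irr M} (x : TubeComp M A B c c e e) :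
    tubeCounit A B (emb A B c c e e x) = ∑ a : A, ∑ b : B, ∑ d,
      cellCounit a.1 b.1 c d e (coeff A B c c e e (a, b, d, d) x) := by
  rw [tubeCounit_apply, Fintype.sum_eq_single c, Fintype.sum_eq_single e, comp_emb_self]
  · intro e' he
    rw [comp_emb_of_ne (by simp [he])]
    simp
  · intro c' hc
    refine Finset.sum_eq_zero fun e' _ => ?_
    rw [comp_emb_of_ne (by simp [hc])]
    simp

lemma tubeCounit_emb_cellEmb_self {c d e : Irr M} (a : A) (b : B)
    (z : Cell a.1.rep b.1.rep c.rep d.rep e.rep e.rep d.rep c.rep) :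
    tubeCounit A B (emb A B c c e e (cellEmb A B c c e e (a, b, d, d) z)) =
      cellCounit a.1 b.1 c d e z := by
  rw [tubeCounit_emb, Fintype.sum_eq_single a, Fintype.sum_eq_single b, Fintype.sum_eq_single d]
  · exact congrArg _ (coeff_cellEmb_self (A := A) (B := B) (a, b, d, d) z)
  · intro d' hd
    rw [coeff_cellEmb_of_ne (by simp [hd]), map_zero]
  · intro b' hb
    refine Finset.sum_eq_zero fun d' _ => ?_
    rw [coeff_cellEmb_of_ne (by simp [hb]), map_zero]
  · intro a' ha
    refine Finset.sum_eq_zero fun b' _ => Finset.sum_eq_zero fun d' _ => ?_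
    rw [coeff_cellEmb_of_ne (by simp [ha]), map_zero]

lemma tubeCounit_emb_cellEmb_of_ne {c d g e : Irr M} (hdg : d ≠ g) (a : A) (b : B)
    (z : Cell a.1.rep b.1.rep c.rep d.rep e.rep e.rep g.rep c.rep) :
    tubeCounit A B (emb A B c c e e (cellEmb A B c c e e (a, b, d, g) z)) = 0 := by
  rw [tubeCounit_emb]
  refine Finset.sum_eq_zero fun a' _ => Finset.sum_eq_zero fun b' _ =>
    Finset.sum_eq_zero fun d' _ => ?_
  rw [coeff_cellEmb_of_ne (by grind), map_zero]

variable [Linear ℂ D] [LinearRightAction D M] [Limits.HasKernels M]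

lemma tubeCounit_emb_cellEmb {c e : Irr M} (t : A × B × Irr M × Irr M)
    (z : Cell t.1.1.rep t.2.1.1.rep c.rep t.2.2.1.rep e.rep e.rep t.2.2.2.rep c.rep) :
    tubeCounit A B (emb A B c c e e (cellEmb A B c c e e t z)) =
      diagCounit _ _ c e (assemble _ _ _ _ _ _ _ _ z) := by
  obtain ⟨a, b, d, g⟩ := t
  by_cases hdg : d = g
  · subst hdg
    rw [tubeCounit_emb_cellEmb_self]
    exact LinearMap.congr_fun (f := cellCounit a.1 b.1 c d e)
      (g := diagCounit _ _ c e ∘ₗ assemble _ _ _ _ _ _ _ _)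
      (TensorProduct.ext_fourfold' fun μ ν γ ζ => (endScalar_comp_actionHomLeft μ ν γ ζ).symm) z
  · rw [tubeCounit_emb_cellEmb_of_ne hdg]
    exact LinearMap.congr_fun (f := 0) (g := diagCounit _ _ c e ∘ₗ assemble _ _ _ _ _ _ _ _)
      (TensorProduct.ext_fourfold' fun μ ν γ ζ =>
        (endScalar_comp_actionHomLeft_of_ne hdg μ ν γ ζ).symm) z

variable [Linear ℂ C] [IsFiniteSemisimple C] [IsFiniteSemisimple D] [LinearLeftAction C M]

lemma tubeCounit_gen {X : C} {Y : D} (hX : LabelsIn A X) (hY : LabelsIn B Y) {c e : Irr M}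
    (x : Diag X Y c.rep e.rep e.rep c.rep) :
    tubeCounit A B (gen A B X Y c c e e x) = diagCounit X Y c e x := by
  rw [← (slideInvariant_diagCounit c e).sum_toDiag_expand hX hY x, gen, LinearMap.comp_apply]
  conv_lhs => rw [← sum_cellEmb_coeff (expand A B X Y c c e e x), map_sum, map_sum]
  simp only [tubeCounit_emb_cellEmb]
  rfl

variable [Limits.HasKernels C] [Limits.HasKernels D]

theorem tubeCounit_inclTube (x : TubeOn M A B) :
    tubeCounit (allLabels C) (allLabels D) (inclTube A B x) = tubeCounit A B x := by
  induction x using tubeOn_induction with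
  | zero => simp
  | add x x' hx hx' => simp only [map_add, hx, hx']
  | gen a ha b hb c h e f u v =>
  rw [inclTube_gen (labelsIn_rep ha) (labelsIn_rep hb)]
  by_cases hne : (c, e) = (h, f)
  · cases hne
    rw [tubeCounit_gen (labelsIn_univ _) (labelsIn_univ _),
      tubeCounit_gen (labelsIn_rep ha) (labelsIn_rep hb)]
  · rw [tubeCounit_gen_of_ne hne, tubeCounit_gen_of_ne hne]

theorem inclTube_isSub [BimoduleCategory C D M] (hA : FusionClosed A) (hB : FusionClosed B) :
    (tubeData (M := M) A B).IsSub (tubeData (allLabels C) (allLabels D)) (inclTube A B) where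
  map_mul := inclTube_mul hA hB
  map_one := inclTube_one hA hB
  map_comul := map_inclTube_tubeComul
  map_counit := tubeCounit_inclTube
  injective := inclTube_injective

end Counit

/-! ### Diagrams with one dotted arc -/

section Dotted

variable {C D M : Type*} [Category* C] [Category* D] [Category* M]
  [MonoidalCategory C] [MonoidalCategory D] [Preadditive M] [Linear ℂ M]
  [MonoidalLeftAction C M] [MonoidalRightAction D M]

variable (C) in
/-- Insert a left arc labelled by the tensor unit. -/
def padR (b : D) (c d g h : M) : HalfR b c d g h →ₗ[ℂ] Diag (𝟙_ C) b c d g h :=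
  TensorProduct.map (Linear.rightComp ℂ c ((λₗ[C] d).inv ⊵ᵣ b))
    (Linear.leftComp ℂ h ((λₗ[C] g).hom ⊵ᵣ b))

variable (D) in
/-- Insert a right arc labelled by the tensor unit. -/
def padL (a : C) (d e f g : M) : HalfL a d e f g →ₗ[ℂ] Diag a (𝟙_ D) d e f g :=
  TensorProduct.map (Linear.rightComp ℂ d (ρᵣ[D] (a ⊙ₗ e)).inv)
    (Linear.leftComp ℂ g (ρᵣ[D] (a ⊙ₗ f)).hom)

@[simp]
lemma padR_tmul (b : D) {c d g h : M} (μ : c ⟶ d ⊙ᵣ b) (γ : g ⊙ᵣ b ⟶ h) :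
    padR C b c d g h (μ ⊗ₜ γ) = (μ ≫ (λₗ[C] d).inv ⊵ᵣ b) ⊗ₜ ((λₗ[C] g).hom ⊵ᵣ b ≫ γ) := rfl

@[simp]
lemma padL_tmul (a : C) {d e f g : M} (ν : d ⟶ a ⊙ₗ e) (ζ : a ⊙ₗ f ⟶ g) :
    padL D a d e f g (ν ⊗ₜ ζ) =
      (ν ≫ (ρᵣ[D] (a ⊙ₗ e)).inv) ⊗ₜ ((ρᵣ[D] (a ⊙ₗ f)).hom ≫ ζ) := rfl

lemma SlideInvariant.map_retract {c h d g : M} {V : Type*} [AddCommGroup V] [Module ℂ V]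
    {T : ∀ (X : C) (Y : D), Diag X Y c d g h →ₗ[ℂ] V} (hT : SlideInvariant T)
    {X X' : C} {Y Y' : D} {i : X' ⟶ X} {r : X ⟶ X'} {j : Y' ⟶ Y} {s : Y ⟶ Y'}
    (hir : r ≫ i = 𝟙 X) (hjs : s ≫ j = 𝟙 Y)
    (u : c ⟶ (X ⊙ₗ d) ⊙ᵣ Y) (v : (X ⊙ₗ g) ⊙ᵣ Y ⟶ h) :
    T X' Y' ((u ≫ arcMap r s d) ⊗ₜ (arcMap i j g ≫ v)) = T X Y (u ⊗ₜ v) := by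
  rw [hT.slide, Category.assoc, ← arcMap_comp, hir, hjs, arcMap_id, Category.comp_id]

variable [Preadditive C] [Preadditive D] [Linear ℂ C] [Linear ℂ D]
  [IsFiniteSemisimple C] [IsFiniteSemisimple D] [LinearRightAction D M]

lemma SlideInvariant.padR_stripR {c h d g : Irr M} {V : Type*} [AddCommGroup V] [Module ℂ V]
    {T : ∀ (X : C) (Y : D), Diag X Y c.rep d.rep g.rep h.rep →ₗ[ℂ] V} (hT : SlideInvariant T)
    (t : unitLabels C × (allLabels D) × Irr M × Irr M) (r : RComp C D M c h d g) :
    T _ _ (padR C _ _ _ _ _ (stripR c h d g t r)) = T _ _ (toDiag _ _ c h d g t r) := by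
  rw [stripR, LinearMap.comp_apply]
  generalize toDiag _ _ c h d g t r = z
  refine LinearMap.congr_fun (f := T _ _ ∘ₗ padR C _ _ _ _ _ ∘ₗ TensorProduct.map _ _) (g := T _ _)
    (TensorProduct.ext' fun u v => ?_) z
  refine Eq.trans ?_ (hT.map_retract (unitIncl_unitProj t.1) (Category.id_comp (𝟙 _)) u v)
  simp [arcMap, ← MonoidalRightAction.comp_actionHomLeft_assoc,
    ← MonoidalRightAction.comp_actionHomLeft]

lemma SlideInvariant.padL_stripL {d g e f : Irr M} {V : Type*} [AddCommGroup V] [Module ℂ V]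
    {T : ∀ (X : C) (Y : D), Diag X Y d.rep e.rep f.rep g.rep →ₗ[ℂ] V} (hT : SlideInvariant T)
    (t : (allLabels C) × unitLabels D × Irr M × Irr M) (l : LComp C D M d g e f) :
    T _ _ (padL D _ _ _ _ _ (stripL d g e f t l)) = T _ _ (toDiag _ _ d g e f t l) := by
  rw [stripL, LinearMap.comp_apply]
  generalize toDiag _ _ d g e f t l = z
  refine LinearMap.congr_fun (f := T _ _ ∘ₗ padL D _ _ _ _ _ ∘ₗ TensorProduct.map _ _) (g := T _ _)
    (TensorProduct.ext' fun u v => ?_) z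
  refine Eq.trans ?_ (hT.map_retract (Category.id_comp (𝟙 _)) (unitIncl_unitProj t.2.1) u v)
  simp [arcMap]

variable [Limits.HasKernels C] [Limits.HasKernels D]
  [IsFiniteSemisimple M] [LinearLeftAction C M]

lemma gen_stack_padR_padL [BimoduleCategory C D M] {A : Finset (Irr C)} {B : Finset (Irr D)}
    (a : C) (b : D) {c d g h e f : Irr M}
    (x : HalfR b c.rep d.rep g.rep h.rep) (y : HalfL a d.rep e.rep f.rep g.rep) :
    gen A B _ _ c h e f (stack _ _ _ _ _ _ _ _ _ _ (padR C b _ _ _ _ x) (padL D a _ _ _ _ y)) =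
      gen A B a b c h e f (assemble a b _ _ _ _ _ _
        (TensorProduct.tensorTensorTensorComm ℂ _ _ _ _ (x ⊗ₜ y))) := by
  refine LinearMap.congr_fun
    (f := gen A B _ _ c h e f ∘ₗ TensorProduct.lift ((stack _ _ _ _ _ _ _ _ _ _).compl₁₂
      (padR C b _ _ _ _) (padL D a _ _ _ _)))
    (g := gen A B a b c h e f ∘ₗ assemble a b _ _ _ _ _ _ ∘ₗ
      (TensorProduct.tensorTensorTensorComm ℂ _ _ _ _).toLinearMap)
    (TensorProduct.ext_fourfold' fun μ γ ν ζ => ?_) (x ⊗ₜ y)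
  have leftUnitor_naturality {m m' : M} (k : m ⟶ m') :
      (𝟙_ C ⊴ₗ k) ⊵ᵣ b ≫ (λₗ[C] m').hom ⊵ᵣ b = (λₗ[C] m).hom ⊵ᵣ b ≫ k ⊵ᵣ b := by
    rw [← MonoidalRightAction.comp_actionHomLeft, ← MonoidalRightAction.comp_actionHomLeft,
      MonoidalLeftAction.actionUnitIso_hom_naturality]
  have remove_unit_arcs : (stackIso (𝟙_ C) a b (𝟙_ D) f.rep).inv ≫ (λₗ[C] _).hom ⊵ᵣ b ≫
      (ρᵣ[D] _).hom ⊵ᵣ b = arcMap (λ_ a).hom (λ_ b).hom f.rep := by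
    rw [Iso.inv_comp_eq, stackIso_hom_right_around_left, MonoidalRightAction.comp_actionHomLeft]
  simp only [LinearMap.comp_apply, TensorProduct.lift.tmul, LinearMap.compl₁₂_apply,
    LinearEquiv.coe_coe, padR_tmul, padL_tmul, stack_tmul, Category.assoc,
    TensorProduct.tensorTensorTensorComm_tmul, assemble_tmul, reassoc_of% leftUnitor_naturality,
    MonoidalRightAction.comp_actionHomLeft]
  rw [reassoc_of% remove_unit_arcs, (slideInvariant_gen c h e f).slide]
  simp only [Category.assoc, stackIso_hom_right_around_left,
    MonoidalRightAction.comp_actionHomLeft, reassoc_of% leftUnitor_naturality,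
    MonoidalRightAction.inv_hom_actionHomLeft_assoc,
    MonoidalRightAction.inv_hom_actionHomLeft, Category.comp_id]

lemma gen_stack_padL_padR [BimoduleCategory C D M] {A : Finset (Irr C)} {B : Finset (Irr D)}
    (a : C) (b : D) {d g m n e f : Irr M}
    (y : HalfL a d.rep m.rep n.rep g.rep) (x : HalfR b m.rep e.rep f.rep n.rep) :
    gen A B _ _ d g e f (stack _ _ _ _ _ _ _ _ _ _ (padL D a _ _ _ _ y) (padR C b _ _ _ _ x)) =
      gen A B a b d g e f (slide a b _ _ _ _ _ _ y x) := by
  refine LinearMap.congr_fun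
    (f := gen A B _ _ d g e f ∘ₗ TensorProduct.lift ((stack _ _ _ _ _ _ _ _ _ _).compl₁₂
      (padL D a _ _ _ _) (padR C b _ _ _ _)))
    (g := gen A B a b d g e f ∘ₗ TensorProduct.lift (slide a b _ _ _ _ _ _))
    (TensorProduct.ext_fourfold' fun ν ζ μ γ => ?_) (y ⊗ₜ x)
  have remove_unit_arcs : (stackIso a (𝟙_ C) (𝟙_ D) b f.rep).inv ≫ (ρᵣ[D] _).hom ≫
      a ⊴ₗ ((λₗ[C] f.rep).hom ⊵ᵣ b) = arcMap (ρ_ a).hom (ρ_ b).hom f.rep ≫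
      (BimoduleCategory.midAssoc a f.rep b).hom := by
    rw [Iso.inv_comp_eq, reassoc_of% stackIso_hom_left_around_right]
    simp
  have slide_tmul : slide a b _ _ _ _ _ _ (ν ⊗ₜ ζ) (μ ⊗ₜ γ) =
      (ν ≫ (a ⊴ₗ μ) ≫ (BimoduleCategory.midAssoc a e.rep b).inv) ⊗ₜ
        ((BimoduleCategory.midAssoc a f.rep b).hom ≫ (a ⊴ₗ γ) ≫ ζ) := rfl
  simp only [LinearMap.comp_apply, TensorProduct.lift.tmul, LinearMap.compl₁₂_apply,
    padR_tmul, padL_tmul, stack_tmul, Category.assoc, slide_tmul,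
    ← MonoidalRightAction.actionUnitIso_hom_naturality_assoc]
  simp only [MonoidalLeftAction.actionHomRight_comp, Category.assoc]
  rw [reassoc_of% remove_unit_arcs, (slideInvariant_gen d g e f).slide]
  simp only [Category.assoc, stackIso_hom_left_around_right]
  rw [← MonoidalLeftAction.actionHomRight_comp,
    ← MonoidalRightAction.actionUnitIso_hom_naturality_assoc, Iso.inv_hom_id_assoc]
  simp only [← MonoidalLeftAction.actionHomRight_comp_assoc, Category.assoc,
    MonoidalRightAction.inv_hom_actionHomLeft, Category.comp_id]

variable [Limits.HasKernels M]

lemma sum_expand_padR {c h d g : Irr M} (r : RComp C D M c h d g) :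
    ∑ t, expand (unitLabels C) (allLabels D) (𝟙_ C) t.2.1.1.rep c h d g
      (padR C _ _ _ _ _ (stripR c h d g t r)) = r := by
  simp only [(slideInvariant_expand _ _ _ _ _ _).padR_stripR, sum_expand_toDiag]

lemma sum_expand_padL {d g e f : Irr M} (l : LComp C D M d g e f) :
    ∑ t, expand (allLabels C) (unitLabels D) t.1.1.rep (𝟙_ D) d g e f
      (padL D _ _ _ _ _ (stripL d g e f t l)) = l := by
  simp only [(slideInvariant_expand _ _ _ _ _ _).padL_stripL, sum_expand_toDiag]

variable (C) in
/-- The element of `R(M_D)` represented by a diagram with a right arc only. -/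
def genR (b : D) (c h d g : Irr M) :
    HalfR b c.rep d.rep g.rep h.rep →ₗ[ℂ] RComp C D M c h d g :=
  expand (unitLabels C) (allLabels D) (𝟙_ C) b c h d g ∘ₗ padR C _ _ _ _ _

variable (D) in
/-- The element of `L(_C M)` represented by a diagram with a left arc only. -/
def genL (a : C) (d g e f : Irr M) :
    HalfL a d.rep e.rep f.rep g.rep →ₗ[ℂ] LComp C D M d g e f :=
  expand (allLabels C) (unitLabels D) a (𝟙_ D) d g e f ∘ₗ padL D _ _ _ _ _

lemma sum_genR {c h d g : Irr M} (r : RComp C D M c h d g) :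
    ∑ t, genR C t.2.1.1.rep c h d g (stripR c h d g t r) = r := sum_expand_padR r

lemma sum_genL {d g e f : Irr M} (l : LComp C D M d g e f) :
    ∑ t, genL D t.1.1.rep d g e f (stripL d g e f t l) = l := sum_expand_padL l

lemma inclTube_genR (b : D) {c h d g : Irr M} (x : HalfR b c.rep d.rep g.rep h.rep) :
    inclTube (unitLabels C) (allLabels D) (emb _ _ c h d g (genR C b c h d g x)) =
      gen _ _ (𝟙_ C) b c h d g (padR C _ _ _ _ _ x) :=
  inclTube_gen labelsIn_unit (labelsIn_univ _) _

lemma inclTube_genL (a : C) {d g e f : Irr M} (y : HalfL a d.rep e.rep f.rep g.rep) :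
    inclTube (allLabels C) (unitLabels D) (emb _ _ d g e f (genL D a d g e f y)) =
      gen _ _ a (𝟙_ D) d g e f (padL D _ _ _ _ _ y) :=
  inclTube_gen (labelsIn_univ _) labelsIn_unit _

end Dotted

/-! ### The gluing map -/

section Gluing

lemma tensorTensorTensorComm_involutive {R V₁ V₂ V₃ V₄ : Type*} [CommSemiring R]
    [AddCommMonoid V₁] [AddCommMonoid V₂] [AddCommMonoid V₃] [AddCommMonoid V₄]
    [Module R V₁] [Module R V₂] [Module R V₃] [Module R V₄]
    (z : (V₁ ⊗[R] V₂) ⊗[R] (V₃ ⊗[R] V₄)) :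
    TensorProduct.tensorTensorTensorComm R _ _ _ _
      (TensorProduct.tensorTensorTensorComm R _ _ _ _ z) = z :=
  LinearEquiv.congr_fun
    (TensorProduct.tensorTensorTensorComm_trans_tensorTensorTensorComm ..) z

variable {C D M : Type*} [Category* C] [Category* D] [Category* M]
  [Preadditive C] [Preadditive D] [Preadditive M] [Linear ℂ C] [Linear ℂ D] [Linear ℂ M]
  [MonoidalCategory C] [MonoidalCategory D] [MonoidalLeftAction C M] [MonoidalRightAction D M]
  [IsFiniteSemisimple C] [IsFiniteSemisimple D]

lemma crossedComp_emb_self {c h d g e f : Irr M}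
    (z : RComp C D M c h d g ⊗[ℂ] LComp C D M d g e f) :
    crossedComp C D c h d g e f (crossedEmb C D c h d g e f z) = z :=
  Pi.single_eq_same (M := fun q : Irr M × Irr M × Irr M × Irr M × Irr M × Irr M =>
    RComp C D M q.1 q.2.1 q.2.2.1 q.2.2.2.1 ⊗[ℂ]
      LComp C D M q.2.2.1 q.2.2.2.1 q.2.2.2.2.1 q.2.2.2.2.2) (c, h, d, g, e, f) z

lemma crossedComp_emb_of_ne {c h d g e f c' h' d' g' e' f' : Irr M}
    (hq : (c, h, d, g, e, f) ≠ (c', h', d', g', e', f'))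
    (z : RComp C D M c' h' d' g' ⊗[ℂ] LComp C D M d' g' e' f') :
    crossedComp C D c h d g e f (crossedEmb C D c' h' d' g' e' f' z) = 0 :=
  Pi.single_eq_of_ne (M := fun q : Irr M × Irr M × Irr M × Irr M × Irr M × Irr M =>
    RComp C D M q.1 q.2.1 q.2.2.1 q.2.2.2.1 ⊗[ℂ]
      LComp C D M q.2.2.1 q.2.2.2.1 q.2.2.2.2.1 q.2.2.2.2.2) hq z

variable [IsFiniteSemisimple M]

lemma sum_crossedComp_emb {V : Type*} [AddCommMonoid V]
    (F : ∀ c h d g e f : Irr M, RComp C D M c h d g ⊗[ℂ] LComp C D M d g e f → V)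
    (hF : ∀ c h d g e f, F c h d g e f 0 = 0) {c h d g e f : Irr M}
    (z : RComp C D M c h d g ⊗[ℂ] LComp C D M d g e f) :
    ∑ c', ∑ h', ∑ d', ∑ g', ∑ e', ∑ f', F c' h' d' g' e' f'
      (crossedComp C D c' h' d' g' e' f' (crossedEmb C D c h d g e f z)) = F c h d g e f z := by
  have only_matching_edges := Fintype.sum_eq_single
    (f := fun q => F q.1 q.2.1 q.2.2.1 q.2.2.2.1 q.2.2.2.2.1 q.2.2.2.2.2
      (crossedComp C D q.1 q.2.1 q.2.2.1 q.2.2.2.1 q.2.2.2.2.1 q.2.2.2.2.2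
        (crossedEmb C D c h d g e f z))) (c, h, d, g, e, f)
    (fun q hq => by rw [crossedComp_emb_of_ne hq, hF])
  simpa only [Fintype.sum_prod_type, crossedComp_emb_self] using only_matching_edges

lemma sum_crossedEmb_comp (x : Crossed C D M) :
    ∑ c, ∑ h, ∑ d, ∑ g, ∑ e, ∑ f,
      crossedEmb C D c h d g e f (crossedComp C D c h d g e f x) = x := by
  have sum_single := Finset.univ_sum_single
    (M := fun q : Irr M × Irr M × Irr M × Irr M × Irr M × Irr M =>
      RComp C D M q.1 q.2.1 q.2.2.1 q.2.2.2.1 ⊗[ℂ]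
        LComp C D M q.2.2.1 q.2.2.2.1 q.2.2.2.2.1 q.2.2.2.2.2) x
  simp only [Fintype.sum_prod_type] at sum_single
  exact sum_single

lemma crossed_induction {P : Crossed C D M → Prop} (zero : P 0)
    (add : ∀ x y, P x → P y → P (x + y))
    (tmul : ∀ (c h d g e f : Irr M) (r : RComp C D M c h d g) (l : LComp C D M d g e f),
      P (crossedEmb C D c h d g e f (r ⊗ₜ l)))
    (x : Crossed C D M) : P x := by
  rw [← sum_crossedEmb_comp x]
  refine Finset.sum_induction _ _ add zero fun c _ => Finset.sum_induction _ _ add zero fun h _ =>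
    Finset.sum_induction _ _ add zero fun d _ => Finset.sum_induction _ _ add zero fun g _ =>
    Finset.sum_induction _ _ add zero fun e _ => Finset.sum_induction _ _ add zero fun f _ => ?_
  generalize crossedComp C D c h d g e f x = z
  induction z using TensorProduct.induction_on with
  | zero => simpa using zero
  | add y z hy hz => rw [map_add]; exact add _ _ hy hz
  | tmul r l => exact tmul _ _ _ _ _ _ r l

lemma cross_apply (r : RTube C D M) (l : LTube C D M) :
    cross C D r l = ∑ c, ∑ h, ∑ d, ∑ g, ∑ e, ∑ f,
      crossedEmb C D c h d g e f (comp _ _ c h d g r ⊗ₜ comp _ _ d g e f l) := by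
  simp only [cross, LinearMap.sum_apply]
  rfl

lemma cross_emb_left {c h d g : Irr M} (r : RComp C D M c h d g) (l : LTube C D M) :
    cross C D (emb _ _ c h d g r) l =
      ∑ e, ∑ f, crossedEmb C D c h d g e f (r ⊗ₜ comp _ _ d g e f l) := by
  rw [cross_apply]
  exact sum_comp_emb (fun c h d g r =>
    ∑ e, ∑ f, crossedEmb C D c h d g e f (r ⊗ₜ comp _ _ d g e f l))
    (fun c h d g => by simp) r

lemma cross_emb {c h d g e f : Irr M} (r : RComp C D M c h d g) (l : LComp C D M d g e f) :
    cross C D (emb _ _ c h d g r) (emb _ _ d g e f l) = crossedEmb C D c h d g e f (r ⊗ₜ l) := by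
  rw [cross_emb_left, Fintype.sum_eq_single e, Fintype.sum_eq_single f, comp_emb_self]
  · intro f' hf
    rw [comp_emb_of_ne (by grind), tmul_zero, map_zero]
  · refine fun e' he => Finset.sum_eq_zero fun f' _ => ?_
    rw [comp_emb_of_ne (by grind), tmul_zero, map_zero]

lemma cross_emb_of_ne {c h d g d' g' e f : Irr M} (hdg : (d, g) ≠ (d', g'))
    (r : RComp C D M c h d g) (l : LComp C D M d' g' e f) :
    cross C D (emb _ _ c h d g r) (emb _ _ d' g' e f l) = 0 := by
  rw [cross_emb_left]
  refine Finset.sum_eq_zero fun e' _ => Finset.sum_eq_zero fun f' _ => ?_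
  rw [comp_emb_of_ne (by grind), tmul_zero, map_zero]

lemma exists_inclTube_emb {A : Finset (Irr C)} {B : Finset (Irr D)} {c h e f : Irr M}
    (x : TubeComp M A B c h e f) :
    ∃ y, inclTube A B (emb A B c h e f x) = emb (allLabels C) (allLabels D) c h e f y :=
  ⟨_, (inclTube_emb x).trans (map_sum _ _ _).symm⟩

variable (C D M) in
/-- The inverse of the gluing map: cut a basic tube diagram between the two arcs. -/
def cutting : Tube C D M →ₗ[ℂ] Crossed C D M :=
  ∑ c : Irr M, ∑ h : Irr M, ∑ e : Irr M, ∑ f : Irr M,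
  ∑ t : (allLabels C) × (allLabels D) × Irr M × Irr M,
    crossedEmb C D c h t.2.2.1 t.2.2.2 e f ∘ₗ
    TensorProduct.map (genR C t.2.1.1.rep c h t.2.2.1 t.2.2.2)
      (genL D t.1.1.rep t.2.2.1 t.2.2.2 e f) ∘ₗ
    (TensorProduct.tensorTensorTensorComm ℂ _ _ _ _).toLinearMap ∘ₗ
    coeff _ _ c h e f t ∘ₗ comp _ _ c h e f

lemma cutting_emb {c h e f : Irr M} (x : TubeComp M (allLabels C) (allLabels D) c h e f) :
    cutting C D M (emb _ _ c h e f x) =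
      ∑ t : (allLabels C) × (allLabels D) × Irr M × Irr M,
        crossedEmb C D c h t.2.2.1 t.2.2.2 e f
          (TensorProduct.map (genR C t.2.1.1.rep c h t.2.2.1 t.2.2.2)
            (genL D t.1.1.rep t.2.2.1 t.2.2.2 e f)
            (TensorProduct.tensorTensorTensorComm ℂ _ _ _ _ (coeff _ _ c h e f t x))) := by
  simp only [cutting, LinearMap.sum_apply]
  exact sum_comp_emb (fun c h e f x => ∑ t : (allLabels C) × (allLabels D) × Irr M × Irr M,
        crossedEmb C D c h t.2.2.1 t.2.2.2 e f
          (TensorProduct.map (genR C t.2.1.1.rep c h t.2.2.1 t.2.2.2)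
            (genL D t.1.1.rep t.2.2.1 t.2.2.2 e f)
            (TensorProduct.tensorTensorTensorComm ℂ _ _ _ _ (coeff _ _ c h e f t x))))
    (fun c h e f => by simp) x

lemma cutting_emb_cellEmb {c h e f : Irr M} (t : (allLabels C) × (allLabels D) × Irr M × Irr M)
    (z : Cell t.1.1.rep t.2.1.1.rep c.rep t.2.2.1.rep e.rep f.rep t.2.2.2.rep h.rep) :
    cutting C D M (emb _ _ c h e f (cellEmb _ _ c h e f t z)) =
      crossedEmb C D c h t.2.2.1 t.2.2.2 e f
        (TensorProduct.map (genR C t.2.1.1.rep c h t.2.2.1 t.2.2.2)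
          (genL D t.1.1.rep t.2.2.1 t.2.2.2 e f)
          (TensorProduct.tensorTensorTensorComm ℂ _ _ _ _ z)) := by
  rw [cutting_emb]
  exact sum_coeff_cellEmb (A := allLabels C) (B := allLabels D) (fun t z =>
    crossedEmb C D c h t.2.2.1 t.2.2.2 e f
        (TensorProduct.map (genR C t.2.1.1.rep c h t.2.2.1 t.2.2.2)
          (genL D t.1.1.rep t.2.2.1 t.2.2.2 e f)
          (TensorProduct.tensorTensorTensorComm ℂ _ _ _ _ z))) (fun t => by simp) t z

variable [LinearRightAction D M]

lemma gluing_emb {c h d g e f : Irr M} (z : RComp C D M c h d g ⊗[ℂ] LComp C D M d g e f) :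
    gluing C D (crossedEmb C D c h d g e f z) =
      ∑ t : unitLabels C × (allLabels D) × Irr M × Irr M,
      ∑ t' : (allLabels C) × unitLabels D × Irr M × Irr M,
        emb (allLabels C) (allLabels D) c h e f (cellEmb (allLabels C) (allLabels D) c h e f
          (t'.1, t.2.1, d, g) (TensorProduct.tensorTensorTensorComm ℂ _ _ _ _
            (TensorProduct.map (stripR c h d g t) (stripL d g e f t') z))) := by
  simp only [gluing, LinearMap.sum_apply]
  exact sum_crossedComp_emb (fun c h d g e f z =>
    ∑ t : unitLabels C × (allLabels D) × Irr M × Irr M,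
      ∑ t' : (allLabels C) × unitLabels D × Irr M × Irr M,
        emb (allLabels C) (allLabels D) c h e f (cellEmb (allLabels C) (allLabels D) c h e f
          (t'.1, t.2.1, d, g) (TensorProduct.tensorTensorTensorComm ℂ _ _ _ _
            (TensorProduct.map (stripR c h d g t) (stripL d g e f t') z))))
    (fun c h d g e f => by simp) z

variable [LinearLeftAction C M]

lemma tubeMul_inclTube_emb_of_ne [BimoduleCategory C D M]
    {c h d g d' g' e f : Irr M}
    (hdg : (d, g) ≠ (d', g')) {A A' : Finset (Irr C)} {B B' : Finset (Irr D)}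
    (x : TubeComp M A B c h d g) (y : TubeComp M A' B' d' g' e f) :
    tubeMul (allLabels C) (allLabels D) (inclTube A B (emb A B c h d g x))
      (inclTube A' B' (emb A' B' d' g' e f y)) = 0 := by
  obtain ⟨x', hx⟩ := exists_inclTube_emb x
  obtain ⟨y', hy⟩ := exists_inclTube_emb y
  rw [hx, hy, tubeMul_emb_of_ne hdg]

variable [Limits.HasKernels C] [Limits.HasKernels D] [Limits.HasKernels M]

lemma cutting_gluing (x : Crossed C D M) : cutting C D M (gluing C D x) = x := by
  induction x using crossed_induction with
  | zero => simp
  | add x y hx hy => simp only [map_add, hx, hy]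
  | tmul c h d g e f r l =>
    have cutting_glued_cell (t : unitLabels C × (allLabels D) × Irr M × Irr M)
        (t' : (allLabels C) × unitLabels D × Irr M × Irr M) :
        cutting C D M (emb _ _ c h e f (cellEmb _ _ c h e f (t'.1, t.2.1, d, g)
          (TensorProduct.tensorTensorTensorComm ℂ _ _ _ _
            (stripR c h d g t r ⊗ₜ stripL d g e f t' l)))) =
        crossedEmb C D c h d g e f (genR C t.2.1.1.rep c h d g (stripR c h d g t r) ⊗ₜ
          genL D t'.1.1.rep d g e f (stripL d g e f t' l)) := by
      refine (cutting_emb_cellEmb (t'.1, t.2.1, d, g) _).trans ?_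
      rw [tensorTensorTensorComm_involutive]
      rfl
    simp only [gluing_emb, map_sum, TensorProduct.map_tmul, cutting_glued_cell]
    simp only [← map_sum, ← tmul_sum, ← sum_tmul, sum_genR, sum_genL]

variable [BimoduleCategory C D M]

lemma tubeMul_inclTube_genR_genL (a : C) (b : D) {c h d g e f : Irr M}
    (x : HalfR b c.rep d.rep g.rep h.rep) (y : HalfL a d.rep e.rep f.rep g.rep) :
    tubeMul (allLabels C) (allLabels D)
      (inclTube _ _ (emb _ _ c h d g (genR C b c h d g x)))
      (inclTube _ _ (emb _ _ d g e f (genL D a d g e f y))) =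
      gen _ _ a b c h e f (assemble a b _ _ _ _ _ _
        (TensorProduct.tensorTensorTensorComm ℂ _ _ _ _ (x ⊗ₜ y))) := by
  rw [inclTube_genR, inclTube_genL, tubeMul_gen_allLabels, gen_stack_padR_padL]

lemma tubeMul_inclTube_genL_genR (a : C) (b : D) {d g m n e f : Irr M}
    (y : HalfL a d.rep m.rep n.rep g.rep) (x : HalfR b m.rep e.rep f.rep n.rep) :
    tubeMul (allLabels C) (allLabels D)
      (inclTube _ _ (emb _ _ d g m n (genL D a d g m n y)))
      (inclTube _ _ (emb _ _ m n e f (genR C b m n e f x))) =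
      gen _ _ a b d g e f (slide a b _ _ _ _ _ _ y x) := by
  rw [inclTube_genR, inclTube_genL, tubeMul_gen_allLabels, gen_stack_padL_padR]

lemma gluing_emb_tmul {c h d g e f : Irr M} (r : RComp C D M c h d g) (l : LComp C D M d g e f) :
    gluing C D (crossedEmb C D c h d g e f (r ⊗ₜ l)) =
      tubeMul (allLabels C) (allLabels D) (inclTube _ _ (emb _ _ c h d g r))
        (inclTube _ _ (emb _ _ d g e f l)) := by
  conv_rhs => rw [← sum_genR r, ← sum_genL l]
  simp only [map_sum, LinearMap.sum_apply, tubeMul_inclTube_genR_genL]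
  rw [gluing_emb, Finset.sum_comm]
  refine Finset.sum_congr rfl fun t' _ => Finset.sum_congr rfl fun t _ => ?_
  exact emb_cellEmb (A := allLabels C) (B := allLabels D) (t'.1, t.2.1, d, g) _

theorem gluing_cross (r : RTube C D M) (l : LTube C D M) :
    gluing C D (cross C D r l) = tubeMul (allLabels C) (allLabels D)
      (inclTube _ _ r) (inclTube _ _ l) := by
  have gluing_cross_emb (c h d g d' g' e f : Irr M) (x : RComp C D M c h d g)
      (y : LComp C D M d' g' e f) :
      gluing C D (cross C D (emb _ _ c h d g x) (emb _ _ d' g' e f y)) =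
        tubeMul (allLabels C) (allLabels D) (inclTube _ _ (emb _ _ c h d g x))
          (inclTube _ _ (emb _ _ d' g' e f y)) := by
    by_cases hdg : (d, g) = (d', g')
    · cases hdg
      rw [cross_emb, gluing_emb_tmul]
    · rw [cross_emb_of_ne hdg, tubeMul_inclTube_emb_of_ne hdg, map_zero]
  rw [← sum_emb_comp r, ← sum_emb_comp l]
  simp only [map_sum, LinearMap.sum_apply, gluing_cross_emb]

lemma gluing_genR_genL (a : C) (b : D) {c h d g e f : Irr M}
    (z : HalfR b c.rep d.rep g.rep h.rep ⊗[ℂ] HalfL a d.rep e.rep f.rep g.rep) :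
    gluing C D (crossedEmb C D c h d g e f
      (TensorProduct.map (genR C b c h d g) (genL D a d g e f) z)) =
      gen _ _ a b c h e f (assemble a b _ _ _ _ _ _
        (TensorProduct.tensorTensorTensorComm ℂ _ _ _ _ z)) := by
  induction z using TensorProduct.induction_on with
  | zero => simp
  | add x y hx hy => simp only [map_add, hx, hy]
  | tmul x y => rw [TensorProduct.map_tmul, gluing_emb_tmul, tubeMul_inclTube_genR_genL]

lemma gluing_cutting (x : Tube C D M) : gluing C D (cutting C D M x) = x := by
  have gluing_cutting_emb (c h e f : Irr M) (y : TubeComp M (allLabels C) (allLabels D) c h e f) :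
      gluing C D (cutting C D M (emb _ _ c h e f y)) = emb _ _ c h e f y := by
    rw [← sum_cellEmb_coeff y]
    simp only [map_sum]
    refine Finset.sum_congr rfl fun t _ => ?_
    rw [cutting_emb_cellEmb, gluing_genR_genL, emb_cellEmb, tensorTensorTensorComm_involutive]
  rw [← sum_emb_comp x]
  simp only [map_sum, gluing_cutting_emb]

theorem gluing_bijective :
    Function.Bijective (gluing C D : Crossed C D M →ₗ[ℂ] Tube C D M) :=
  Function.bijective_iff_has_inverse.2 ⟨cutting C D M, cutting_gluing, gluing_cutting⟩

end Gluing

/-! ### The product of the crossed product -/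

section CrossedProduct

variable {C D M : Type*} [Category* C] [Category* D] [Category* M]
  [Preadditive C] [Preadditive D] [Preadditive M] [Linear ℂ C] [Linear ℂ D] [Linear ℂ M]
  [MonoidalCategory C] [MonoidalCategory D] [MonoidalLeftAction C M] [MonoidalRightAction D M]
  [IsFiniteSemisimple C] [IsFiniteSemisimple D] [IsFiniteSemisimple M]

lemma split_tmul (a : C) (b : D) {c h e f : Irr M} (u : c.rep ⟶ (a ⊙ₗ e.rep) ⊙ᵣ b)
    (v : (a ⊙ₗ f.rep) ⊙ᵣ b ⟶ h.rep) :
    split a b c h e f (u ⊗ₜ v) =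
      ∑ x : Fin (dec (a ⊙ₗ e.rep)).n, ∑ y : Fin (dec (a ⊙ₗ f.rep)).n,
        Pi.single (M := fun p : Irr M × Irr M =>
          RComp C D M c h p.1 p.2 ⊗[ℂ] LComp C D M p.1 p.2 e f)
          ((dec (a ⊙ₗ e.rep)).s x, (dec (a ⊙ₗ f.rep)).s y)
          (genR C b c h ((dec (a ⊙ₗ e.rep)).s x) ((dec (a ⊙ₗ f.rep)).s y)
              ((u ≫ (dec (a ⊙ₗ e.rep)).proj x ⊵ᵣ b) ⊗ₜ ((dec (a ⊙ₗ f.rep)).incl y ⊵ᵣ b ≫ v)) ⊗ₜ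
            genL D a ((dec (a ⊙ₗ e.rep)).s x) ((dec (a ⊙ₗ f.rep)).s y) e f
              ((dec (a ⊙ₗ e.rep)).incl x ⊗ₜ (dec (a ⊙ₗ f.rep)).proj y)) := by
  simp only [genR, genL, LinearMap.comp_apply, padR_tmul, padL_tmul, Category.assoc,
    ← MonoidalRightAction.comp_actionHomLeft, ← MonoidalRightAction.comp_actionHomLeft_assoc]
  simp only [split, LinearMap.sum_apply]
  rfl

variable [LinearRightAction D M]

lemma sum_gluing_single {c h e f : Irr M} (q : Irr M × Irr M)
    (z : RComp C D M c h q.1 q.2 ⊗[ℂ] LComp C D M q.1 q.2 e f) :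
    ∑ p : Irr M × Irr M, gluing C D (crossedEmb C D c h p.1 p.2 e f
      (Pi.single (M := fun p : Irr M × Irr M =>
          RComp C D M c h p.1 p.2 ⊗[ℂ] LComp C D M p.1 p.2 e f) q z p)) =
      gluing C D (crossedEmb C D c h q.1 q.2 e f z) := by
  rw [Fintype.sum_eq_single q fun p hp => by rw [Pi.single_eq_of_ne hp, map_zero, map_zero],
    Pi.single_eq_same]

variable [LinearLeftAction C M] [BimoduleCategory C D M]

lemma exchange_apply {d g m n d' g' : Irr M} (l : LComp C D M d g m n)
    (r : RComp C D M m n d' g') :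
    exchange d g m n d' g' l r =
      ∑ t : (allLabels C) × unitLabels D × Irr M × Irr M,
      ∑ t' : unitLabels C × (allLabels D) × Irr M × Irr M,
        split t.1.1.rep t'.2.1.1.rep d g d' g' (slide _ _ _ _ _ _ _ _
          (stripL d g m n t l) (stripR m n d' g' t' r)) := by
  simp only [exchange, LinearMap.sum_apply]
  rfl

lemma crossedMul_apply (s s' : Crossed C D M) :
    crossedMul s s' = ∑ c, ∑ h, ∑ d, ∑ g, ∑ m, ∑ n, ∑ d', ∑ g', ∑ e, ∑ f,
      crossedMulComp c h d g m n d' g' e f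
        (crossedComp C D c h d g m n s ⊗ₜ crossedComp C D m n d' g' e f s') := by
  let evalAt : (Crossed C D M →ₗ[ℂ] Crossed C D M →ₗ[ℂ] Crossed C D M) →ₗ[ℂ] Crossed C D M :=
    LinearMap.applyₗ s' ∘ₗ LinearMap.applyₗ s
  change evalAt crossedMul = _
  -- Generic in `E`: `map_sum` is far cheaper here than `LinearMap.sum_apply` under ten sums.
  generalize hE : evalAt = E
  simp only [crossedMul, map_sum]
  subst hE
  rfl

lemma crossedMul_emb_left {c h d g m n : Irr M}
    (z : RComp C D M c h d g ⊗[ℂ] LComp C D M d g m n) (s' : Crossed C D M) :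
    crossedMul (crossedEmb C D c h d g m n z) s' = ∑ d', ∑ g', ∑ e, ∑ f,
      crossedMulComp c h d g m n d' g' e f (z ⊗ₜ crossedComp C D m n d' g' e f s') := by
  rw [crossedMul_apply]
  exact sum_crossedComp_emb (fun c h d g m n z => ∑ d', ∑ g', ∑ e, ∑ f,
    crossedMulComp c h d g m n d' g' e f (z ⊗ₜ crossedComp C D m n d' g' e f s'))
    (fun c h d g m n => by simp) z

lemma crossedMul_emb {c h d g m n d' g' e f : Irr M}
    (z : RComp C D M c h d g ⊗[ℂ] LComp C D M d g m n)
    (z' : RComp C D M m n d' g' ⊗[ℂ] LComp C D M d' g' e f) :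
    crossedMul (crossedEmb C D c h d g m n z) (crossedEmb C D m n d' g' e f z') =
      crossedMulComp c h d g m n d' g' e f (z ⊗ₜ z') := by
  have zero_of_ne {d'' g'' e' f' : Irr M} (hne : (d'', g'', e', f') ≠ (d', g', e, f)) :
      crossedMulComp c h d g m n d'' g'' e' f' (z ⊗ₜ crossedComp C D m n d'' g'' e' f'
        (crossedEmb C D m n d' g' e f z')) = 0 := by
    rw [crossedComp_emb_of_ne (by grind), tmul_zero, map_zero]
  rw [crossedMul_emb_left,
    Fintype.sum_eq_single d' fun d'' hd => Finset.sum_eq_zero fun g'' _ =>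
      Finset.sum_eq_zero fun e' _ => Finset.sum_eq_zero fun f' _ => zero_of_ne (by grind),
    Fintype.sum_eq_single g' fun g'' hg => Finset.sum_eq_zero fun e' _ =>
      Finset.sum_eq_zero fun f' _ => zero_of_ne (by grind),
    Fintype.sum_eq_single e fun e' he => Finset.sum_eq_zero fun f' _ => zero_of_ne (by grind),
    Fintype.sum_eq_single f fun f' hf => zero_of_ne (by grind), crossedComp_emb_self]

lemma crossedMul_emb_of_ne {c h d g m n m' n' d' g' e f : Irr M} (hmn : (m, n) ≠ (m', n'))
    (z : RComp C D M c h d g ⊗[ℂ] LComp C D M d g m n)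
    (z' : RComp C D M m' n' d' g' ⊗[ℂ] LComp C D M d' g' e f) :
    crossedMul (crossedEmb C D c h d g m n z) (crossedEmb C D m' n' d' g' e f z') = 0 := by
  rw [crossedMul_emb_left]
  refine Finset.sum_eq_zero fun d'' _ => Finset.sum_eq_zero fun g'' _ =>
    Finset.sum_eq_zero fun e'' _ => Finset.sum_eq_zero fun f'' _ => ?_
  rw [crossedComp_emb_of_ne (by grind), tmul_zero, map_zero]

lemma crossedMulComp_tmul {c h d g m n d' g' e f : Irr M} (r : RComp C D M c h d g)
    (l : LComp C D M d g m n) (r' : RComp C D M m n d' g') (l' : LComp C D M d' g' e f) :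
    crossedMulComp c h d g m n d' g' e f ((r ⊗ₜ l) ⊗ₜ (r' ⊗ₜ l')) =
      ∑ p : Irr M × Irr M, crossedEmb C D c h p.1 p.2 e f
        (TensorProduct.map
          (TensorProduct.lift (mulComp (unitLabels C) (allLabels D) c h d g p.1 p.2))
          (TensorProduct.lift (mulComp (allLabels C) (unitLabels D) p.1 p.2 d' g' e f))
          ((TensorProduct.assoc ℂ _ _ _).symm (r ⊗ₜ (TensorProduct.assoc ℂ _ _ _
            (exchange d g m n d' g' l r' p ⊗ₜ l'))))) := by
  simp only [crossedMulComp, LinearMap.sum_apply, Fintype.sum_prod_type]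
  rfl

variable [Limits.HasKernels C] [Limits.HasKernels D] [Limits.HasKernels M]

lemma sum_gluing_split (a : C) (b : D) {c h e f : Irr M}
    (w : Diag a b c.rep e.rep f.rep h.rep) :
    ∑ p : Irr M × Irr M, gluing C D (crossedEmb C D c h p.1 p.2 e f (split a b c h e f w p)) =
      gen _ _ a b c h e f w := by
  induction w using TensorProduct.induction_on with
  | zero => simp
  | add x y hx hy => simp only [map_add, Pi.add_apply, Finset.sum_add_distrib, hx, hy]
  | tmul u v =>
    simp only [split_tmul, Finset.sum_apply, map_sum]
    rw [Finset.sum_comm]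
    trans ∑ x : Fin (dec (a ⊙ₗ e.rep)).n, ∑ y : Fin (dec (a ⊙ₗ f.rep)).n,
      gen (allLabels C) (allLabels D) a b c h e f
        ((u ≫ ((dec (a ⊙ₗ e.rep)).proj x ≫ (dec (a ⊙ₗ e.rep)).incl x) ⊵ᵣ b) ⊗ₜ
          (((dec (a ⊙ₗ f.rep)).proj y ≫ (dec (a ⊙ₗ f.rep)).incl y) ⊵ᵣ b ≫ v))
    · refine Finset.sum_congr rfl fun x _ => ?_
      rw [Finset.sum_comm]
      refine Finset.sum_congr rfl fun y _ => ?_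
      rw [sum_gluing_single, gluing_emb_tmul, tubeMul_inclTube_genR_genL,
        TensorProduct.tensorTensorTensorComm_tmul, assemble_tmul]
      simp only [MonoidalRightAction.comp_actionHomLeft, Category.assoc]
    · simp only [← map_sum, ← tmul_sum, ← sum_tmul, ← Preadditive.comp_sum,
        ← Preadditive.sum_comp, ← actionHomLeft_sum, SimpleDecomp.sum_proj_incl]
      simp

lemma sum_gluing_exchange {d g m n d' g' : Irr M} (l : LComp C D M d g m n)
    (r : RComp C D M m n d' g') :
    ∑ p : Irr M × Irr M,
      gluing C D (crossedEmb C D d g p.1 p.2 d' g' (exchange d g m n d' g' l r p)) =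
      tubeMul (allLabels C) (allLabels D) (inclTube _ _ (emb _ _ d g m n l))
        (inclTube _ _ (emb _ _ m n d' g' r)) := by
  conv_rhs => rw [← sum_genL l, ← sum_genR r]
  simp only [map_sum, LinearMap.sum_apply, tubeMul_inclTube_genL_genR, exchange_apply,
    Finset.sum_apply]
  rw [Finset.sum_comm]
  conv_rhs => rw [Finset.sum_comm]
  refine Finset.sum_congr rfl fun t _ => ?_
  rw [Finset.sum_comm]
  refine Finset.sum_congr rfl fun t' _ => ?_
  rw [sum_gluing_split]

lemma gluing_mulComp {c h d g x y d' g' e f : Irr M} (r : RComp C D M c h d g)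
    (z : RComp C D M d g x y ⊗[ℂ] LComp C D M x y d' g') (l : LComp C D M d' g' e f) :
    gluing C D (crossedEmb C D c h x y e f
      (TensorProduct.map
        (TensorProduct.lift (mulComp (unitLabels C) (allLabels D) c h d g x y))
        (TensorProduct.lift (mulComp (allLabels C) (unitLabels D) x y d' g' e f))
        ((TensorProduct.assoc ℂ _ _ _).symm (r ⊗ₜ (TensorProduct.assoc ℂ _ _ _ (z ⊗ₜ l)))))) =
      tubeMul (allLabels C) (allLabels D) (inclTube _ _ (emb _ _ c h d g r))
        (tubeMul _ _ (gluing C D (crossedEmb C D d g x y d' g' z))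
          (inclTube _ _ (emb _ _ d' g' e f l))) := by
  induction z using TensorProduct.induction_on with
  | zero => simp
  | add x y hx hy => simp only [map_add, add_tmul, tmul_add, LinearMap.add_apply, hx, hy]
  | tmul r' l' =>
    simp only [TensorProduct.assoc_tmul, TensorProduct.assoc_symm_tmul, TensorProduct.map_tmul,
      TensorProduct.lift.tmul, gluing_emb_tmul, ← tubeMul_emb,
      inclTube_mul (fusionClosed_unitLabels C) (fusionClosed_allLabels D),
      inclTube_mul (fusionClosed_allLabels C) (fusionClosed_unitLabels D),
      tubeMul_assoc (fusionClosed_allLabels C) (fusionClosed_allLabels D)]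

theorem gluing_mul (s s' : Crossed C D M) :
    gluing C D (crossedMul s s') =
      tubeMul (allLabels C) (allLabels D) (gluing C D s) (gluing C D s') := by
  induction s using crossed_induction with
  | zero => simp
  | add x y hx hy => simp only [map_add, LinearMap.add_apply, hx, hy]
  | tmul c h d g m n r l =>
  induction s' using crossed_induction with
  | zero => simp
  | add x y hx hy => simp only [map_add, hx, hy]
  | tmul m' n' d' g' e f r' l' =>
  by_cases hmn : (m, n) = (m', n')
  · cases hmn
    rw [crossedMul_emb, crossedMulComp_tmul]
    simp only [map_sum, gluing_mulComp]
    rw [← map_sum, ← LinearMap.sum_apply, ← map_sum, sum_gluing_exchange]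
    simp only [gluing_emb_tmul, tubeMul_assoc (fusionClosed_allLabels C) (fusionClosed_allLabels D)]
  · rw [crossedMul_emb_of_ne hmn, map_zero, gluing_emb_tmul, gluing_emb_tmul,
      tubeMul_assoc (fusionClosed_allLabels C) (fusionClosed_allLabels D),
      ← tubeMul_assoc (fusionClosed_allLabels C) (fusionClosed_allLabels D)
        (inclTube _ _ (emb _ _ d g m n l)), tubeMul_inclTube_emb_of_ne hmn, map_zero,
      LinearMap.zero_apply, map_zero]

theorem gluing_one :
    gluing C D (cross C D (tubeOne _ _) (tubeOne _ _) : Crossed C D M) =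
      tubeOne (allLabels C) (allLabels D) := by
  rw [gluing_cross, inclTube_one (fusionClosed_unitLabels C) (fusionClosed_allLabels D),
    inclTube_one (fusionClosed_allLabels C) (fusionClosed_unitLabels D),
    tubeOne_mul (labelsIn_univ _) (labelsIn_univ _)]

theorem crossedData_isAlgebra : (crossedData C D M).IsAlgebra where
  assoc x y z := gluing_bijective.1 <| by
    simp only [crossedData, gluing_mul,
      tubeMul_assoc (fusionClosed_allLabels C) (fusionClosed_allLabels D)]
  one_mul x := gluing_bijective.1 <| by
    simp only [crossedData, gluing_mul, gluing_one,
      tubeOne_mul (labelsIn_univ _) (labelsIn_univ _)]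
  mul_one x := gluing_bijective.1 <| by
    simp only [crossedData, gluing_mul, gluing_one,
      tubeMul_one (labelsIn_univ _) (labelsIn_univ _)]

end CrossedProduct

/-! ### The coalgebra structure of the crossed product -/

section CrossedCoalgebra

variable {C D M : Type*} [Category* C] [Category* D] [Category* M]
  [Preadditive C] [Preadditive D] [Preadditive M] [Linear ℂ C] [Linear ℂ D] [Linear ℂ M]
  [MonoidalCategory C] [MonoidalCategory D] [MonoidalLeftAction C M] [MonoidalRightAction D M]
  [IsFiniteSemisimple C] [IsFiniteSemisimple D] [IsFiniteSemisimple M]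

lemma crossedComul_emb {c h d g e f : Irr M} (r : RComp C D M c h d g)
    (l : LComp C D M d g e f) :
    crossedComul (crossedEmb C D c h d g e f (r ⊗ₜ l)) =
      TensorProduct.map (TensorProduct.lift (cross C D)) (TensorProduct.lift (cross C D))
        (TensorProduct.tensorTensorTensorComm ℂ _ _ _ _
          (tubeComul _ _ (emb _ _ c h d g r) ⊗ₜ tubeComul _ _ (emb _ _ d g e f l))) := by
  simp only [crossedComul, LinearMap.sum_apply]
  exact sum_crossedComp_emb (fun c h d g e f z =>
    TensorProduct.map (TensorProduct.lift (cross C D)) (TensorProduct.lift (cross C D))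
      (TensorProduct.tensorTensorTensorComm ℂ (RTube C D M) (RTube C D M) (LTube C D M)
        (LTube C D M) (TensorProduct.map (tubeComul (unitLabels C) (allLabels D) ∘ₗ emb _ _ c h d g)
      (tubeComul (allLabels C) (unitLabels D) ∘ₗ emb _ _ d g e f) z)))
    (fun c h d g e f => by simp only [map_zero]) (r ⊗ₜ l)

lemma crossedCounit_emb {c h d g e f : Irr M} (r : RComp C D M c h d g)
    (l : LComp C D M d g e f) :
    crossedCounit (crossedEmb C D c h d g e f (r ⊗ₜ l)) =
      tubeCounit _ _ (emb _ _ c h d g r) * tubeCounit _ _ (emb _ _ d g e f l) := by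
  simp only [crossedCounit, LinearMap.sum_apply]
  exact sum_crossedComp_emb (fun c h d g e f z =>
    LinearMap.mul' ℂ ℂ (TensorProduct.map
      (tubeCounit (unitLabels C) (allLabels D) ∘ₗ emb _ _ c h d g)
      (tubeCounit (allLabels C) (unitLabels D) ∘ₗ emb _ _ d g e f) z))
    (fun c h d g e f => by simp only [map_zero]) (r ⊗ₜ l)

variable [LinearLeftAction C M] [LinearRightAction D M] [Limits.HasKernels M]

lemma tubeCounit_gen_assemble (a : C) (b : D) {c h d g e f : Irr M}
    (x : HalfR b c.rep d.rep g.rep h.rep) (y : HalfL a d.rep e.rep f.rep g.rep) :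
    tubeCounit (allLabels C) (allLabels D) (gen _ _ a b c h e f (assemble a b _ _ _ _ _ _
      (TensorProduct.tensorTensorTensorComm ℂ _ _ _ _ (x ⊗ₜ y)))) =
      tubeCounit _ _ (emb _ _ c h d g (genR C b c h d g x)) *
        tubeCounit _ _ (emb _ _ d g e f (genL D a d g e f y)) := by
  induction x using TensorProduct.induction_on with
  | zero => simp
  | add x x' hx hx' => simp only [map_add, add_tmul, add_mul, hx, hx']
  | tmul μ γ =>
  induction y using TensorProduct.induction_on with
  | zero => simp
  | add y y' hy hy' => simp only [map_add, tmul_add, mul_add, hy, hy']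
  | tmul ν ζ =>
  rw [TensorProduct.tensorTensorTensorComm_tmul, assemble_tmul]
  change _ = tubeCounit _ _ (gen _ _ (𝟙_ C) b c h d g _) *
    tubeCounit _ _ (gen _ _ a (𝟙_ D) d g e f _)
  by_cases hce : (c, e) = (h, f)
  · cases hce
    rw [tubeCounit_gen (labelsIn_univ _) (labelsIn_univ _), diagCounit_tmul]
    by_cases hdg : d = g
    · subst hdg
      rw [tubeCounit_gen labelsIn_unit (labelsIn_univ _),
        tubeCounit_gen (labelsIn_univ _) labelsIn_unit, padR_tmul, padL_tmul,
        diagCounit_tmul, diagCounit_tmul, endScalar_comp_actionHomLeft]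
      simp [← MonoidalRightAction.comp_actionHomLeft_assoc]
    · rw [endScalar_comp_actionHomLeft_of_ne hdg, tubeCounit_gen_of_ne (by simp [hdg]), zero_mul]
  · rw [tubeCounit_gen_of_ne hce]
    by_cases hch : c = h
    · rw [tubeCounit_gen_of_ne (c := d) (h := g) (by grind), mul_zero]
    · rw [tubeCounit_gen_of_ne (c := c) (h := h) (by simp [hch]), zero_mul]

variable [BimoduleCategory C D M] [Limits.HasKernels C]
  [Limits.HasKernels D]

lemma tubeComul_tubeMul {c h m n e f : Irr M}
    (x : TubeComp M (allLabels C) (allLabels D) c h m n)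
    (y : TubeComp M (allLabels C) (allLabels D) m n e f) :
    tubeComul _ _ (tubeMul _ _ (emb _ _ c h m n x) (emb _ _ m n e f y)) =
      TensorProduct.map₂ (tubeMul (allLabels C) (allLabels D))
        (tubeMul (allLabels C) (allLabels D)) (tubeComul _ _ (emb _ _ c h m n x))
        (tubeComul _ _ (emb _ _ m n e f y)) := by
  rw [emb_eq_sum_gen x, emb_eq_sum_gen y]
  simp only [map_sum, LinearMap.sum_apply]
  refine Finset.sum_congr rfl fun t _ => Finset.sum_congr rfl fun t' _ => ?_
  generalize toDiag _ _ c h m n t' x = u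
  generalize toDiag _ _ m n e f t y = v
  rw [tubeMul_gen_allLabels]
  simp only [tubeComul_gen (labelsIn_univ _) (labelsIn_univ _)]
  induction u using TensorProduct.induction_on with
  | zero => simp
  | add u u' hu hu' => simp only [map_add, LinearMap.add_apply, hu, hu']
  | tmul u₁ u₂ =>
  induction v using TensorProduct.induction_on with
  | zero => simp
  | add v v' hv hv' => simp only [map_add, hv, hv']
  | tmul v₁ v₂ => exact (diagComul_stack u₁ u₂ v₁ v₂).symm

lemma map_gluing_cross (s : RTube C D M ⊗[ℂ] RTube C D M) (s' : LTube C D M ⊗[ℂ] LTube C D M) :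
    TensorProduct.map (gluing C D) (gluing C D)
      (TensorProduct.map (TensorProduct.lift (cross C D)) (TensorProduct.lift (cross C D))
        (TensorProduct.tensorTensorTensorComm ℂ _ _ _ _ (s ⊗ₜ s'))) =
      TensorProduct.map₂ (tubeMul (allLabels C) (allLabels D))
        (tubeMul (allLabels C) (allLabels D))
        (TensorProduct.map (inclTube _ _) (inclTube _ _) s)
        (TensorProduct.map (inclTube _ _) (inclTube _ _) s') := by
  induction s using TensorProduct.induction_on with
  | zero => simp
  | add x y hx hy => simp only [map_add, add_tmul, LinearMap.add_apply, hx, hy]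
  | tmul r₁ r₂ =>
  induction s' using TensorProduct.induction_on with
  | zero => simp
  | add x y hx hy => simp only [map_add, tmul_add, hx, hy]
  | tmul l₁ l₂ =>
    simp only [TensorProduct.tensorTensorTensorComm_tmul, TensorProduct.map_tmul,
      TensorProduct.lift.tmul, gluing_cross, TensorProduct.map₂_apply_tmul]

theorem gluing_comul (s : Crossed C D M) :
    TensorProduct.map (gluing C D) (gluing C D) (crossedComul s) =
      tubeComul (allLabels C) (allLabels D) (gluing C D s) := by
  induction s using crossed_induction with
  | zero => simp
  | add x y hx hy => simp only [map_add, hx, hy]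
  | tmul c h d g e f r l =>
    rw [crossedComul_emb, map_gluing_cross, map_inclTube_tubeComul, map_inclTube_tubeComul,
      gluing_emb_tmul]
    obtain ⟨r', hr⟩ := exists_inclTube_emb r
    obtain ⟨l', hl⟩ := exists_inclTube_emb l
    rw [hr, hl, tubeComul_tubeMul]

theorem gluing_counit (s : Crossed C D M) :
    tubeCounit (allLabels C) (allLabels D) (gluing C D s) = crossedCounit s := by
  induction s using crossed_induction with
  | zero => simp
  | add x y hx hy => simp only [map_add, hx, hy]
  | tmul c h d g e f r l =>
    rw [crossedCounit_emb, gluing_emb_tmul]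
    conv_rhs => rw [← sum_genR r, ← sum_genL l]
    conv_lhs => rw [← sum_genR r, ← sum_genL l]
    simp only [map_sum, LinearMap.sum_apply, tubeMul_inclTube_genR_genL, tubeCounit_gen_assemble,
      Finset.sum_mul_sum]
    rw [Finset.sum_comm]

theorem gluing_isHom : (crossedData C D M).IsHom (tubeData (allLabels C) (allLabels D))
    (gluing C D) where
  map_mul := gluing_mul
  map_one := gluing_one
  map_comul := gluing_comul
  map_counit := gluing_counit

end CrossedCoalgebra

end

end DomainWall

theorem mainTheorem9_general
    {C : Type*} [Category* C] [Preadditive C] [Limits.HasKernels C] [Linear ℂ C]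
    [MonoidalCategory C] [DomainWall.IsFiniteSemisimple C]
    {D : Type*} [Category* D] [Preadditive D] [Limits.HasKernels D] [Linear ℂ D]
    [MonoidalCategory D] [DomainWall.IsFiniteSemisimple D]
    {M : Type*} [Category* M] [Preadditive M] [Limits.HasKernels M] [Linear ℂ M]
    [DomainWall.IsFiniteSemisimple M]
    [MonoidalLeftAction C M] [MonoidalRightAction D M]
    [DomainWall.LinearLeftAction C M] [DomainWall.LinearRightAction D M]
    [DomainWall.BimoduleCategory C D M] :
    (DomainWall.tubeData (M := M) (DomainWall.unitLabels C) (DomainWall.allLabels D)).IsSub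
      (DomainWall.tubeData (DomainWall.allLabels C) (DomainWall.allLabels D))
      (DomainWall.inclTube (DomainWall.unitLabels C) (DomainWall.allLabels D)) ∧
    (DomainWall.tubeData (M := M) (DomainWall.allLabels C) (DomainWall.unitLabels D)).IsSub
      (DomainWall.tubeData (DomainWall.allLabels C) (DomainWall.allLabels D))
      (DomainWall.inclTube (DomainWall.allLabels C) (DomainWall.unitLabels D)) ∧
    (DomainWall.crossedData C D M).IsAlgebra ∧
    Function.Bijective (DomainWall.gluing C D : DomainWall.Crossed C D M →ₗ[ℂ] _) ∧
    (DomainWall.crossedData C D M).IsHom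
      (DomainWall.tubeData (DomainWall.allLabels C) (DomainWall.allLabels D))
      (DomainWall.gluing C D) ∧
    (∀ (r : DomainWall.RTube C D M) (l : DomainWall.LTube C D M),
      DomainWall.gluing C D (DomainWall.cross C D r l) =
        (DomainWall.tubeData (DomainWall.allLabels C) (DomainWall.allLabels D)).mul
          (DomainWall.inclTube (DomainWall.unitLabels C) (DomainWall.allLabels D) r)
          (DomainWall.inclTube (DomainWall.allLabels C) (DomainWall.unitLabels D) l)) :=
  ⟨DomainWall.inclTube_isSub (DomainWall.fusionClosed_unitLabels C)
      (DomainWall.fusionClosed_allLabels D),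
    DomainWall.inclTube_isSub (DomainWall.fusionClosed_allLabels C)
      (DomainWall.fusionClosed_unitLabels D),
    DomainWall.crossedData_isAlgebra, DomainWall.gluing_bijective, DomainWall.gluing_isHom,
    DomainWall.gluing_cross⟩

theorem mainTheorem9
    {C : Type*} [Category* C] [Abelian C] [Linear ℂ C] [MonoidalCategory C]
    [MonoidalPreadditive C] [MonoidalLinear ℂ C] [RigidCategory C]
    [DomainWall.IsFiniteSemisimple C]
    {D : Type*} [Category* D] [Abelian D] [Linear ℂ D] [MonoidalCategory D]
    [MonoidalPreadditive D] [MonoidalLinear ℂ D] [RigidCategory D]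
    [DomainWall.IsFiniteSemisimple D]
    {M : Type*} [Category* M] [Abelian M] [Linear ℂ M] [DomainWall.IsFiniteSemisimple M]
    [MonoidalLeftAction C M] [MonoidalRightAction D M]
    [DomainWall.LinearLeftAction C M] [DomainWall.LinearRightAction D M]
    [DomainWall.BimoduleCategory C D M] :
    -- `R(M_D)` and `L(_C M)` are subalgebras, closed under the coproduct, of `Tube(_C M_D)`
    (DomainWall.tubeData (M := M) (DomainWall.unitLabels C) (DomainWall.allLabels D)).IsSub
      (DomainWall.tubeData (DomainWall.allLabels C) (DomainWall.allLabels D))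
      (DomainWall.inclTube (DomainWall.unitLabels C) (DomainWall.allLabels D)) ∧
    (DomainWall.tubeData (M := M) (DomainWall.allLabels C) (DomainWall.unitLabels D)).IsSub
      (DomainWall.tubeData (DomainWall.allLabels C) (DomainWall.allLabels D))
      (DomainWall.inclTube (DomainWall.allLabels C) (DomainWall.unitLabels D)) ∧
    -- the crossed product is an associative unital algebra
    (DomainWall.crossedData C D M).IsAlgebra ∧
    -- the gluing map is an isomorphism of algebras and of coalgebras
    Function.Bijective (DomainWall.gluing C D : DomainWall.Crossed C D M →ₗ[ℂ] _) ∧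
    (DomainWall.crossedData C D M).IsHom
      (DomainWall.tubeData (DomainWall.allLabels C) (DomainWall.allLabels D))
      (DomainWall.gluing C D) ∧
    -- gluing `r ⋈ l` is the product of `r` and `l` in the tube algebra
    (∀ (r : DomainWall.RTube C D M) (l : DomainWall.LTube C D M),
      DomainWall.gluing C D (DomainWall.cross C D r l) =
        (DomainWall.tubeData (DomainWall.allLabels C) (DomainWall.allLabels D)).mul
          (DomainWall.inclTube (DomainWall.unitLabels C) (DomainWall.allLabels D) r)
          (DomainWall.inclTube (DomainWall.allLabels C) (DomainWall.unitLabels D) l)) :=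
  mainTheorem9_general
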